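/- All digraphs are finite and may have loops and parallel edges. A digraph $G$ is Eulerian if at every vertex the in-degree equals the out-degree. A path is a nonempty sequence of distinct edges $(e_1,\dots,e_m)$ with $\operatorname{head}(e_i)=\operatorname{tail}(e_{i+1})$ for $1\le i<m$; these vertices $\operatorname{head}(e_i)$, $1\le i<m$, are its internal vertices. A digraph $H$ is strongly immersed in $G$ if there are an injective map $\gamma\colon V(H)\to V(G)$ and pairwise edge-disjoint paths $\gamma(e)$ in $G$ for $e\in E(H)$, such that $\gamma(e)$ leads from $\gamma(u)$ to $\gamma(v)$ if $e$ leads from $u$ to $v$, and no internal vertex of any $\gamma(e)$ lies in $\gamma(V(H))$. For $X\subseteq V(G)$ let $\delta(X)$ be the number of edges, of either direction, with exactly one end in $X$. The maximum degree of $G$ is $\max_{v}\delta(\{v\})$, that is, loops are not counted. A carving of $G$ is a finite tree $T$, all of whose vertices have degree $1$ or $3$, with an injective map $\ell$ from $V(G)$ to the leaves of $T$; its width is the maximum over the edges $e$ of $T$ of $\delta(\ell^{-1}(V(T_1)))$, where $T_1$ is one of the two components of $T-e$. The carving width of $G$ is the minimum width of a carving of $G$. The treewidth of $G$ is the treewidth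 of its underlying undirected graph, and its directed treewidth is that of Johnson, Robertson, Seymour and Thomas, defined through arboreal decompositions (the empty digraph has directed treewidth at most $0$ by convention). A class of digraphs is well-quasi-ordered by strong immersion if strong immersion is reflexive and transitive on it and every infinite sequence $G_1,G_2,\dots$ in the class has indices $i<j$ such that $G_i$ is strongly immersed in $G_j$. **Theorem 1.3.** For each fixed integer $k\ge 0$, the class of Eulerian digraphs of carving width at most $k$ is well-quasi-ordered by strong immersion. Equivalently, the class of Eulerian digraphs of maximum degree at most $k$ and treewidth at most $k$, and the class of Eulerian digraphs of maximum degree at most $k$ and directed treewidth at most $k$, are well-quasi-ordered by strong immersion. The three conditions are equivalent up to a change of the bound: for every $k\ge0$ there is an $m$ such that, for every Eulerian digraph $G$, if $G$ has carving width at most $k$, then its maximum degree, its treewidth and its directed treewidth are at most $m$; and if $G$ has maximum degree at most $k$ and treewidth or directed treewidth at most $k$, then $G$ has carving width at most $m$. -/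

import Mathlib

universe u v

/-- A finite directed graph in which loops and parallel edges are allowed: edges are objects of their
own, each with a tail and a head. -/
structure MultiDigraph where
  /-- the vertices -/
  V : Type u
  /-- the edges -/
  E : Type v
  tail : E → V
  head : E → V
  finite_vertices : Finite V
  finite_edges : Finite E

namespace MultiDigraph

/-- In-degree and out-degree agree at every vertex. -/
def IsEulerian (G : MultiDigraph.{u, v}) : Prop :=
  ∀ x : G.V, {e : G.E | G.head e = x}.encard = {e : G.E | G.tail e = x}.encard

/-! ### Immersions -/

/-- `G.IsWalk x p y`: the list `p` of edges is a directed walk from `x` to `y`. -/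
def IsWalk (G : MultiDigraph.{u, v}) : G.V → List G.E → G.V → Prop
  | x, [], y => x = y
  | x, e :: p, y => G.tail e = x ∧ G.IsWalk (G.head e) p y

/-- `G.IsPath x p y`: the list `p` is a directed path from `x` to `y` with at least one edge. Edges
are not repeated, vertices may be. -/
def IsPath (G : MultiDigraph.{u, v}) (x : G.V) (p : List G.E) (y : G.V) : Prop :=
  p ≠ [] ∧ p.Nodup ∧ G.IsWalk x p y

/-- The internal vertices of a path: the heads of all of its edges except the last one. -/
def internalVertices (G : MultiDigraph.{u, v}) (p : List G.E) : Set G.V :=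
  {x | x ∈ p.dropLast.map G.head}

/-- A strong immersion of `H` in `G`. -/
structure StrongImmersion (H G : MultiDigraph.{u, v}) where
  /-- the image of a vertex -/
  vertex : H.V → G.V
  /-- the image of an edge -/
  path : H.E → List G.E
  vertex_injective : Function.Injective vertex
  isPath : ∀ e, G.IsPath (vertex (H.tail e)) (path e) (vertex (H.head e))
  edge_disjoint : ∀ e f, e ≠ f → List.Disjoint (path e) (path f)
  strong : ∀ e x, vertex x ∉ G.internalVertices (path e)

/-- `H` is strongly immersed in `G`. -/
def StronglyImmersed (H G : MultiDigraph.{u, v}) : Prop :=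
  Nonempty (StrongImmersion H G)

/-! ### Cuts, degree, carving width -/

/-- The edges (of either direction) with exactly one end in `X`. -/
def cut (G : MultiDigraph.{u, v}) (X : Set G.V) : Set G.E :=
  {e | (G.tail e ∈ X ∧ G.head e ∉ X) ∨ (G.tail e ∉ X ∧ G.head e ∈ X)}

/-- The maximum over all vertices of the number of incident edges that are not loops. -/
noncomputable def maxDegree (G : MultiDigraph.{u, v}) : ℕ∞ :=
  ⨆ x : G.V, (G.cut {x}).encard

end MultiDigraph

/-- For an edge `st` of a tree `T`, the vertices of the component of `T - st` that contains `s`. -/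
def treeSide {N : Type} (T : SimpleGraph N) (s t : N) : Set N :=
  {n | (T.deleteEdges {s(s, t)}).Reachable s n}

namespace MultiDigraph

/-- A carving of `G`: a finite tree, all of whose vertices have degree 1 or 3, and an injective map
from the vertices of `G` to its leaves. -/
structure Carving (G : MultiDigraph.{u, v}) where
  Node : Type
  finite_node : Finite Node
  tree : SimpleGraph Node
  isTree : tree.IsTree
  cubic : ∀ n, (tree.neighborSet n).encard = 1 ∨ (tree.neighborSet n).encard = 3
  leaf : G.V → Node
  leaf_injective : Function.Injective leaf
  isLeaf : ∀ x, (tree.neighborSet (leaf x)).encard = 1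

/-- The maximum over the edges `st` of the tree of the order of the cut of `G` that `st` induces. -/
noncomputable def Carving.width {G : MultiDigraph.{u, v}} (c : Carving G) : ℕ∞ :=
  ⨆ (s : c.Node) (t : c.Node) (_ : c.tree.Adj s t), (G.cut (c.leaf ⁻¹' treeSide c.tree s t)).encard

/-- The minimum width of a carving. -/
noncomputable def carvingWidth (G : MultiDigraph.{u, v}) : ℕ∞ :=
  ⨅ c : Carving G, c.width

/-! ### Treewidth of the underlying undirected graph -/

/-- The underlying undirected graph; multiplicities of edges and loops are irrelevant for tree
decompositions and are forgotten. -/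
def underlying (G : MultiDigraph.{u, v}) : SimpleGraph G.V where
  Adj x y := x ≠ y ∧ ∃ e, (G.tail e = x ∧ G.head e = y) ∨ (G.tail e = y ∧ G.head e = x)
  symm := ⟨fun _ _ h => ⟨h.1.symm, h.2.imp fun _ he => he.symm⟩⟩
  loopless := ⟨fun _ h => h.1 rfl⟩

end MultiDigraph

/-- A tree decomposition of an undirected graph, over a finite tree. -/
structure TreeDecomposition {V : Type u} (G : SimpleGraph V) where
  Node : Type
  finite_node : Finite Node
  tree : SimpleGraph Node
  isTree : tree.IsTree
  bag : Node → Set V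
  vertex_mem : ∀ x, ∃ n, x ∈ bag n
  edge_mem : ∀ x y, G.Adj x y → ∃ n, x ∈ bag n ∧ y ∈ bag n
  connected : ∀ x, (tree.induce {n | x ∈ bag n}).Connected

/-- The maximum size of a bag minus 1 (and 0 if all bags are empty). -/
noncomputable def TreeDecomposition.width {V : Type u} {G : SimpleGraph V}
    (d : TreeDecomposition G) : ℕ∞ :=
  (⨆ n : d.Node, (d.bag n).encard) - 1

namespace MultiDigraph

/-- The treewidth of the underlying undirected graph. -/
noncomputable def treewidth (G : MultiDigraph.{u, v}) : ℕ∞ :=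
  ⨅ d : TreeDecomposition G.underlying, d.width

/-! ### Directed treewidth -/

/-- There is a directed walk (possibly without edges) from `x` to `y`, all of whose vertices lie
outside of `Z`. -/
def ReachableAvoiding (G : MultiDigraph.{u, v}) (Z : Set G.V) (x y : G.V) : Prop :=
  x ∉ Z ∧ Relation.ReflTransGen (fun a b => b ∉ Z ∧ ∃ e, G.tail e = a ∧ G.head e = b) x y

/-- `S` is `Z`-normal: it is disjoint from `Z`, and a directed walk in `G - Z` that starts and ends in
`S` stays in `S`. -/
def IsNormal (G : MultiDigraph.{u, v}) (Z S : Set G.V) : Prop :=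
  Disjoint S Z ∧ ∀ a ∈ S, ∀ b ∈ S, ∀ x,
    G.ReachableAvoiding Z a x → G.ReachableAvoiding Z x b → x ∈ S

/-- An arboreal decomposition in the sense of Johnson, Robertson, Seymour and Thomas. The arborescence
is given as a finite tree with a root, its edges being directed away from the root, so that `s → t` is
an edge if `s` and `t` are adjacent and the root is not on the side of `t`; then the side of `t`
consists of `t` and its descendants. The bags partition the vertex set, and they are nonempty
unless `G` has no vertices at all. -/
structure ArborealDecomposition (G : MultiDigraph.{u, v}) where
  Node : Type
  finite_node : Finite Node
  tree : SimpleGraph Node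
  isTree : tree.IsTree
  root : Node
  bag : Node → Set G.V
  guard : Sym2 Node → Set G.V
  bag_partition : ∀ x, ∃! n, x ∈ bag n
  bag_nonempty : Nonempty G.V → ∀ n, (bag n).Nonempty
  normal : ∀ s t, tree.Adj s t → root ∉ treeSide tree t s →
    G.IsNormal (guard s(s, t)) (⋃ n ∈ treeSide tree t s, bag n)

/-- The maximum over the nodes `n` of the size of the union of the bag of `n` and the guards of the
edges at `n`, minus 1 (and 0 if all of these are empty). -/
noncomputable def ArborealDecomposition.width {G : MultiDigraph.{u, v}}
    (d : ArborealDecomposition G) : ℕ∞ :=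
  (⨆ n : d.Node, (d.bag n ∪ ⋃ e ∈ d.tree.incidenceSet n, d.guard e).encard) - 1

/-- The directed treewidth. -/
noncomputable def directedTreewidth (G : MultiDigraph.{u, v}) : ℕ∞ :=
  ⨅ d : ArborealDecomposition G, d.width

end MultiDigraph

/-- The class `C` is well-quasi-ordered by the relation `r`: on `C`, the relation is reflexive and
transitive, and every infinite sequence in `C` has terms `f m`, `f n` with `m < n` and
`r (f m) (f n)`. -/
structure IsWellQuasiOrderedBy {α : Type*} (C : Set α) (r : α → α → Prop) : Prop where
  refl : ∀ a ∈ C, r a a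
  trans : ∀ a ∈ C, ∀ b ∈ C, ∀ c ∈ C, r a b → r b c → r a c
  wqo : C.PartiallyWellOrderedOn r

/-!
All three classes are handled through recursive bipartitions of the vertex set (`SplitTree`) all
of whose parts are left by a bounded number of edges (`MultiDigraph.SplitWidthLE`).

**Well-quasi-ordering.** In an Eulerian digraph, the number `d X` of the edges that leave `X`
equals the number of those that enter it, so that `d` is submodular and posimodular. A split tree
of bounded width that minimises a suitable potential is *linked* (`SplitTree.IsOptimal.linked`):
if `d` is at least `d s = d t = j` on the path between two subtrees `s` and `t`, then `d` is at
least `j` on all sets in between. By Menger's theorem and the Eulerian condition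
(`MultiDigraph.IsEulerian.exists_linkage`), the `2 * j` edges in the cut of `s` then extend to
edge-disjoint trails that end in those of `t`. Hence `s` is strongly immersed in `t`, as digraphs
with labelled boundary edges (`Piece`), if the labels at `s` are chosen accordingly. Strong
immersions of the two branches at a node can be merged to one of the whole (`Piece.Immersed.glue`)
if the labels of the boundary edges match, for which there are only finitely many patterns.

An argument in the style of Nash-Williams takes a minimal bad sequence of trees and uses that the
branches are smaller and immersed in the whole; but subtrees of a tree with `d = j` at the root
are known to be immersed only if they have `d = j` as well and all the sets on the way have
`d ≥ j`. Therefore one proceeds by downward induction on `j` (`DecomposedDigraph.LabelledWQO.built`):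
trees with `d ≥ j` at all inner nodes are built from given atoms. In a minimal bad sequence of
such trees with `d = j` at the root, the proper subtrees with `d = j` are immersed in the whole
and smaller, so that they may be added to the atoms; what remains above them has `d ≥ j + 1`, and
the induction hypothesis makes the sets of left and right branches of the terms
well-quasi-ordered. Dickson's lemma yields the contradiction.

**Comparison of the widths.** A carving is turned into a split tree by rooting it at an edge
(`MultiDigraph.splitWidthLE_of_carvingWidth_le`), and a split tree into a carving by putting one
node above its root (`MultiDigraph.carvingWidth_le_of_splitWidthLE`). The ends of the edges in the
cuts at a node of a carving form the bags of a tree decomposition. For an arboreal decomposition,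
whose bags must not be empty, every inner node of a split tree receives the leftmost leaf of its
right branch, and the ends of the edges in the cut below a node serve as guards.

Conversely, for every weight on the vertices, some bag of a tree decomposition, or some bag of an
arboreal decomposition with the guards around it, is a set `Z` such that no strong component of
`G - Z` has more than half of the weight (`MultiDigraph.exists_balanced_of_tree`). A minimal set `P`
that is closed under reachability in `G - Z` and has more than a quarter of the weight has at most
three quarters, and the edges that leave it end in `Z`; as `G` is Eulerian, the cut of `P` is
bounded by the size of `Z` and the maximum degree (`MultiDigraph.exists_balanced_cut`). Splitting
a set `X` along such a `P`, with the weight given by the edges that leave `X`, keeps the cuts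
bounded and leads to a split tree (`MultiDigraph.splitWidthLE_of_hasBalancedSeparators`).
-/

/-! ### Split trees and linked split trees -/

/-- A rooted binary tree whose leaves carry elements of `α` or nothing. It describes a recursive
bipartition of the set of its labels. -/
inductive SplitTree (α : Type*)
  | empty : SplitTree α
  | leaf (a : α) : SplitTree α
  | node (l r : SplitTree α) : SplitTree α

namespace SplitTree

variable {α : Type*}

/-- The set of the labels of the leaves. -/
def supp : SplitTree α → Set α
  | empty => ∅
  | leaf a => {a}
  | node l r => l.supp ∪ r.supp

/-- The label sets of all subtrees. -/
def displayed : SplitTree α → Set (Set α)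
  | empty => {∅}
  | leaf a => {{a}}
  | node l r => insert (l.supp ∪ r.supp) (l.displayed ∪ r.displayed)

/-- No label occurs twice. -/
def Proper : SplitTree α → Prop
  | empty => True
  | leaf _ => True
  | node l r => Disjoint l.supp r.supp ∧ l.Proper ∧ r.Proper

open Classical in
/-- The tree obtained by deleting the labels outside of `Y`. -/
noncomputable def restrict (Y : Set α) : SplitTree α → SplitTree α
  | empty => empty
  | leaf a => if a ∈ Y then leaf a else empty
  | node l r => node (l.restrict Y) (r.restrict Y)

theorem supp_mem_displayed (t : SplitTree α) : t.supp ∈ t.displayed := by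
  cases t <;> simp [displayed, supp]

theorem finite_displayed (t : SplitTree α) : t.displayed.Finite := by
  induction t with
  | empty => exact Set.finite_singleton _
  | leaf a => exact Set.finite_singleton _
  | node l r hl hr => exact (hl.union hr).insert _

theorem subset_supp_of_mem_displayed {t : SplitTree α} {E : Set α} (h : E ∈ t.displayed) :
    E ⊆ t.supp := by
  induction t with
  | empty => simp_all [displayed, supp]
  | leaf a => simp_all [displayed, supp]
  | node l r hl hr =>
    rcases h with rfl | h | h
    · exact subset_rfl
    · exact (hl h).trans Set.subset_union_left
    · exact (hr h).trans Set.subset_union_right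

/-- The displayed sets form a laminar family. -/
theorem laminar {t : SplitTree α} (ht : t.Proper) {A B : Set α} (hA : A ∈ t.displayed)
    (hB : B ∈ t.displayed) : Disjoint A B ∨ A ⊆ B ∨ B ⊆ A := by
  induction t with
  | empty => simp_all [displayed]
  | leaf a => simp_all [displayed]
  | node l r hl hr =>
    rcases hA with rfl | hA
    · exact Or.inr (Or.inr (subset_supp_of_mem_displayed (t := node l r) hB))
    rcases hB with rfl | hB
    · exact Or.inr (Or.inl (subset_supp_of_mem_displayed (t := node l r) (Or.inr hA)))
    rcases hA with hA | hA <;> rcases hB with hB | hB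
    · exact hl ht.2.1 hA hB
    · exact Or.inl (ht.1.mono (subset_supp_of_mem_displayed hA) (subset_supp_of_mem_displayed hB))
    · exact Or.inl
        (ht.1.symm.mono (subset_supp_of_mem_displayed hA) (subset_supp_of_mem_displayed hB))
    · exact hr ht.2.2 hA hB

@[simp]
theorem supp_restrict (Y : Set α) (t : SplitTree α) : (t.restrict Y).supp = t.supp ∩ Y := by
  induction t with
  | empty => simp [restrict, supp]
  | leaf a =>
    by_cases h : a ∈ Y
    · simp [restrict, supp, h]
    · simp only [restrict, supp, h, if_false]
      ext x
      simp only [Set.mem_empty_iff_false, Set.mem_inter_iff, Set.mem_singleton_iff, false_iff]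
      rintro ⟨rfl, hx⟩
      exact h hx
  | node l r hl hr => simp [restrict, supp, hl, hr, Set.union_inter_distrib_right]

theorem Proper.restrict {t : SplitTree α} (ht : t.Proper) (Y : Set α) : (t.restrict Y).Proper := by
  induction t with
  | empty => trivial
  | leaf a =>
    by_cases h : a ∈ Y <;> simp [SplitTree.restrict, h, Proper]
  | node l r hl hr =>
    refine ⟨?_, hl ht.2.1, hr ht.2.2⟩
    rw [supp_restrict, supp_restrict]
    exact ht.1.mono Set.inter_subset_left Set.inter_subset_left

theorem restrict_eq_self {t : SplitTree α} {Y : Set α} (h : t.supp ⊆ Y) : t.restrict Y = t := by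
  induction t with
  | empty => rfl
  | leaf a => simp_all [restrict, supp]
  | node l r hl hr =>
    rw [restrict, hl (Set.subset_union_left.trans h), hr (Set.subset_union_right.trans h)]

theorem exists_of_mem_displayed_restrict {t : SplitTree α} {Y E : Set α}
    (h : E ∈ (t.restrict Y).displayed) : ∃ D ∈ t.displayed, E = D ∩ Y := by
  induction t with
  | empty => simp_all [restrict, displayed]
  | leaf a =>
    have := supp_restrict Y (leaf a)
    refine ⟨{a}, rfl, ?_⟩
    by_cases ha : a ∈ Y <;> simp_all [restrict, displayed, supp]
  | node l r hl hr =>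
    rcases h with rfl | h | h
    · exact ⟨_, Or.inl rfl, by simp [Set.union_inter_distrib_right]⟩
    · obtain ⟨D, hD, rfl⟩ := hl h
      exact ⟨D, Or.inr (Or.inl hD), rfl⟩
    · obtain ⟨D, hD, rfl⟩ := hr h
      exact ⟨D, Or.inr (Or.inr hD), rfl⟩

open Classical in
/-- The contribution to `potential` of a node whose children carry the sets `A` and `B`. -/
noncomputable def nodeWeight (f : Set α → ℕ) (A B : Set α) : ℕ :=
  if A = ∅ ∨ B = ∅ then 0 else 3 ^ (f A + f B + f (A ∪ B))

/-- The sum over all nodes with two nonempty children of `3` to the power of the sum of the values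
of `f` at the node and its children. With the base `3`, replacing a node by two nodes with smaller
exponents decreases the potential. -/
noncomputable def potential (f : Set α → ℕ) : SplitTree α → ℕ
  | empty => 0
  | leaf _ => 0
  | node l r => l.potential f + r.potential f + nodeWeight f l.supp r.supp

/-- A set function that is submodular and posimodular and vanishes on the empty set. -/
structure IsCutFunction (f : Set α → ℕ) : Prop where
  empty : f ∅ = 0
  sub : ∀ A B, f (A ∩ B) + f (A ∪ B) ≤ f A + f B
  pos : ∀ A B, f (A \ B) + f (B \ A) ≤ f A + f B

/-- All displayed sets have value at most `w`. -/
def WidthLE (f : Set α → ℕ) (w : ℕ) (t : SplitTree α) : Prop :=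
  ∀ E ∈ t.displayed, f E ≤ w

/-- `t` has least potential among the proper split trees of width at most `w` on the same set. -/
structure IsOptimal (f : Set α → ℕ) (w : ℕ) (t : SplitTree α) : Prop where
  proper : t.Proper
  width : t.WidthLE f w
  le : ∀ t' : SplitTree α, t'.supp = t.supp → t'.Proper → t'.WidthLE f w →
    t.potential f ≤ t'.potential f

theorem exists_isOptimal {f : Set α → ℕ} {w : ℕ} {t : SplitTree α} (hp : t.Proper)
    (hw : t.WidthLE f w) : ∃ t' : SplitTree α, t'.supp = t.supp ∧ t'.IsOptimal f w := by
  obtain ⟨t', ⟨h1, h2, h3⟩, h⟩ := exists_minimalFor_of_wellFoundedLT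
    (fun t' : SplitTree α => t'.supp = t.supp ∧ t'.Proper ∧ t'.WidthLE f w) (potential f)
    ⟨t, rfl, hp, hw⟩
  refine ⟨t', h1, h2, h3, fun s hs hsp hsw => ?_⟩
  rcases le_total (t'.potential f) (s.potential f) with hle | hle
  · exact hle
  · exact h ⟨hs.trans h1, hsp, hsw⟩ hle

theorem WidthLE.left {f : Set α → ℕ} {w : ℕ} {l r : SplitTree α} (h : (node l r).WidthLE f w) :
    l.WidthLE f w := fun E hE => h E (Or.inr (Or.inl hE))

theorem WidthLE.right {f : Set α → ℕ} {w : ℕ} {l r : SplitTree α} (h : (node l r).WidthLE f w) :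
    r.WidthLE f w := fun E hE => h E (Or.inr (Or.inr hE))

theorem WidthLE.node {f : Set α → ℕ} {w : ℕ} {l r : SplitTree α} (hl : l.WidthLE f w)
    (hr : r.WidthLE f w) (h : f (l.supp ∪ r.supp) ≤ w) : (node l r).WidthLE f w := by
  rintro E (rfl | hE | hE)
  exacts [h, hl E hE, hr E hE]

theorem IsOptimal.left {f : Set α → ℕ} {w : ℕ} {l r : SplitTree α}
    (h : (node l r).IsOptimal f w) : l.IsOptimal f w := by
  refine ⟨h.proper.2.1, h.width.left, fun t' hs hp hw => ?_⟩
  have := h.le (node t' r) (by simp [supp, hs]) ⟨hs ▸ h.proper.1, hp, h.proper.2.2⟩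
    (hw.node h.width.right (hs ▸ h.width _ (Or.inl rfl)))
  simp only [potential, hs] at this
  omega

theorem IsOptimal.right {f : Set α → ℕ} {w : ℕ} {l r : SplitTree α}
    (h : (node l r).IsOptimal f w) : r.IsOptimal f w := by
  refine ⟨h.proper.2.2, h.width.right, fun t' hs hp hw => ?_⟩
  have := h.le (node l t') (by simp [supp, hs]) ⟨hs ▸ h.proper.1, h.proper.2.1, hp⟩
    (h.width.left.node hw (hs ▸ h.width _ (Or.inl rfl)))
  simp only [potential, hs] at this
  omega

/-- `Y` splits `A` into two nonempty parts. -/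
def Crosses (Y A : Set α) : Prop := (A ∩ Y).Nonempty ∧ (A \ Y).Nonempty

theorem nodeWeight_eq_zero {f : Set α → ℕ} {A B : Set α} (h : A = ∅ ∨ B = ∅) :
    nodeWeight f A B = 0 := if_pos h

theorem nodeWeight_pos {f : Set α → ℕ} {A B : Set α} (hA : A.Nonempty) (hB : B.Nonempty) :
    0 < nodeWeight f A B := by
  rw [nodeWeight, if_neg (by simp [hA.ne_empty, hB.ne_empty])]
  positivity

theorem nodeWeight_le {f : Set α → ℕ} {A B A' B' : Set α} (hA : A.Nonempty) (hB : B.Nonempty)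
    (fA : f A' ≤ f A) (fB : f B' ≤ f B) (fU : f (A' ∪ B') ≤ f (A ∪ B)) :
    nodeWeight f A' B' ≤ nodeWeight f A B := by
  rw [nodeWeight, nodeWeight, if_neg (c := A = ∅ ∨ B = ∅) (by simp [hA.ne_empty, hB.ne_empty])]
  split_ifs
  · exact Nat.zero_le _
  · exact Nat.pow_le_pow_right (by norm_num) (by omega)

theorem three_mul_nodeWeight_le {f : Set α → ℕ} {A B A' B' : Set α} (hA : A.Nonempty)
    (hB : B.Nonempty) (fA : f A' ≤ f A) (fB : f B' ≤ f B) (fU : f (A' ∪ B') ≤ f (A ∪ B))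
    (h : f A' < f A ∨ f B' < f B ∨ f (A' ∪ B') < f (A ∪ B)) :
    3 * nodeWeight f A' B' ≤ nodeWeight f A B := by
  rw [nodeWeight, nodeWeight, if_neg (c := A = ∅ ∨ B = ∅) (by simp [hA.ne_empty, hB.ne_empty])]
  split_ifs
  · exact Nat.zero_le _
  · rw [← Nat.pow_succ']
    exact Nat.pow_le_pow_right (by norm_num) (by omega)

/-- `Y` does not increase the value of `f` on the sets displayed by `t`, and decreases it on those
that it crosses. -/
def Refines (f : Set α → ℕ) (Y : Set α) (t : SplitTree α) : Prop :=
  ∀ E ∈ t.displayed, f (E ∩ Y) ≤ f E ∧ f (E \ Y) ≤ f E ∧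
    (Crosses Y E → f (E ∩ Y) < f E ∧ f (E \ Y) < f E)

theorem inter_eq_or_of_not_crosses {Y A : Set α} (h : ¬ Crosses Y A) : A ∩ Y = ∅ ∨ A \ Y = ∅ := by
  rw [Crosses, not_and_or, Set.not_nonempty_iff_eq_empty, Set.not_nonempty_iff_eq_empty] at h
  exact h

/-- Cutting a tree along a set that refines it does not increase the total potential. -/
theorem potential_restrict_add {f : Set α → ℕ} {Y : Set α} {t : SplitTree α}
    (h : Refines f Y t) :
    (t.restrict Y).potential f + (t.restrict Yᶜ).potential f ≤ t.potential f := by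
  induction t with
  | empty => simp [restrict, potential]
  | leaf a => by_cases ha : a ∈ Y <;> simp [restrict, potential, ha]
  | node l r hl hr =>
    have hl := hl fun E hE => h E (Or.inr (Or.inl hE))
    have hr := hr fun E hE => h E (Or.inr (Or.inr hE))
    suffices H : nodeWeight f (l.supp ∩ Y) (r.supp ∩ Y) + nodeWeight f (l.supp ∩ Yᶜ) (r.supp ∩ Yᶜ) ≤
        nodeWeight f l.supp r.supp by
      simp only [restrict, potential, supp_restrict]
      omega
    obtain ⟨a1, a2, -⟩ := h l.supp (Or.inr (Or.inl l.supp_mem_displayed))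
    obtain ⟨b1, b2, -⟩ := h r.supp (Or.inr (Or.inr r.supp_mem_displayed))
    obtain ⟨u1, u2, u3⟩ := h (l.supp ∪ r.supp) (Or.inl rfl)
    rw [Set.sdiff_eq] at a2 b2 u2
    rw [Set.union_inter_distrib_right] at u1 u2
    rcases l.supp.eq_empty_or_nonempty with hA | hA
    · simp [nodeWeight, hA]
    rcases r.supp.eq_empty_or_nonempty with hB | hB
    · simp [nodeWeight, hB]
    by_cases hU : Crosses Y (l.supp ∪ r.supp)
    · obtain ⟨v1, v2⟩ := u3 hU
      rw [Set.sdiff_eq] at v2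
      rw [Set.union_inter_distrib_right] at v1 v2
      have := three_mul_nodeWeight_le hA hB a1 b1 u1 (Or.inr (Or.inr v1))
      have := three_mul_nodeWeight_le hA hB a2 b2 u2 (Or.inr (Or.inr v2))
      omega
    · rcases inter_eq_or_of_not_crosses hU with h0 | h0
      · rw [Set.union_inter_distrib_right, Set.union_empty_iff] at h0
        rw [nodeWeight_eq_zero (Or.inl h0.1), zero_add]
        exact nodeWeight_le hA hB a2 b2 u2
      · rw [Set.sdiff_eq, Set.union_inter_distrib_right, Set.union_empty_iff] at h0
        rw [nodeWeight_eq_zero (A := _ ∩ Yᶜ) (Or.inl h0.1), add_zero]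
        exact nodeWeight_le hA hB a1 b1 u1

/-- `s` is a subtree of `t`, and the label sets of all trees between `s` and `t`, inclusively,
satisfy `Q`. -/
inductive SubtreeVia (Q : Set α → Prop) (s : SplitTree α) : SplitTree α → Prop
  | refl : Q s.supp → SubtreeVia Q s s
  | left {l r : SplitTree α} : SubtreeVia Q s l → Q (l.supp ∪ r.supp) → SubtreeVia Q s (node l r)
  | right {l r : SplitTree α} : SubtreeVia Q s r → Q (l.supp ∪ r.supp) → SubtreeVia Q s (node l r)

theorem SubtreeVia.holds {Q : Set α → Prop} {s t : SplitTree α} (h : SubtreeVia Q s t) :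
    Q t.supp := by
  cases h <;> assumption

theorem SubtreeVia.supp_subset {Q : Set α → Prop} {s t : SplitTree α} (h : SubtreeVia Q s t) :
    s.supp ⊆ t.supp := by
  induction h with
  | refl => exact subset_rfl
  | left _ _ ih => exact ih.trans Set.subset_union_left
  | right _ _ ih => exact ih.trans Set.subset_union_right

theorem SubtreeVia.mono {Q Q' : Set α → Prop} {s t : SplitTree α} (h : SubtreeVia Q s t)
    (hQ : ∀ A, Q A → Q' A) : SubtreeVia Q' s t := by
  induction h with
  | refl h => exact .refl (hQ _ h)
  | left _ h ih => exact .left ih (hQ _ h)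
  | right _ h ih => exact .right ih (hQ _ h)

theorem nodeWeight_comm (f : Set α → ℕ) (A B : Set α) : nodeWeight f A B = nodeWeight f B A := by
  simp only [nodeWeight, or_comm, add_comm (f A), Set.union_comm A]

theorem union_union_inter_compl (A D Y : Set α) : A ∪ Y ∪ D ∩ Yᶜ = A ∪ D ∪ Y := by
  ext x
  by_cases hx : x ∈ Y <;> simp [hx]

theorem inter_compl_union_union (A D Y : Set α) : D ∩ Yᶜ ∪ (A ∪ Y) = D ∪ A ∪ Y := by
  rw [Set.union_comm, union_union_inter_compl, Set.union_comm A]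

/-- The change of weight at a node of the path from `F` to the root when `Y` is uncrossed: `A` is
the set of the child on the path, `D` the set of the other child. -/
theorem nodeWeight_uncross {f : Set α → ℕ} (hf : IsCutFunction f) {Y A D F X : Set α}
    (hFX : ∀ Z, F ⊆ Z → Z ⊆ X → f Y ≤ f Z) (hFY : F ⊆ Y) (hYX : Y ⊆ X) (hFA : F ⊆ A)
    (hAX : A ∪ D ⊆ X) (hA : f Y < f A) (hU : f Y < f (A ∪ D))
    (hD : f (D ∩ Y) ≤ f D ∧ f (D \ Y) ≤ f D ∧ (Crosses Y D → f (D ∩ Y) < f D ∧ f (D \ Y) < f D)) :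
    nodeWeight f (A ∩ Y) (D ∩ Y) + nodeWeight f (A ∪ Y) (D \ Y) ≤ nodeWeight f A D ∧
    (nodeWeight f (A ∩ Y) (D ∩ Y) + nodeWeight f (A ∪ Y) (D \ Y) < nodeWeight f A D ∨
      (f (A ∩ Y) = f A → f ((A ∪ D) ∩ Y) = f (A ∪ D))) := by
  have key : ∀ Z, F ⊆ Z → Z ⊆ X → f (Z ∩ Y) + f (Z ∪ Y) ≤ f Z + f Y ∧ f Y ≤ f (Z ∩ Y) ∧
      f Y ≤ f (Z ∪ Y) := fun Z h1 h2 => ⟨hf.sub Z Y,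
    hFX _ (Set.subset_inter h1 hFY) (Set.inter_subset_left.trans h2),
    hFX _ (h1.trans Set.subset_union_left) (Set.union_subset h2 hYX)⟩
  obtain ⟨kA1, kA2, kA3⟩ := key A hFA (Set.subset_union_left.trans hAX)
  obtain ⟨kU1, kU2, kU3⟩ := key (A ∪ D) (hFA.trans Set.subset_union_left) hAX
  obtain ⟨d1, d2, d3⟩ := hD
  have e1 : A ∩ Y ∪ D ∩ Y = (A ∪ D) ∩ Y := (Set.union_inter_distrib_right ..).symm
  have e2 : A ∪ Y ∪ D \ Y = (A ∪ D) ∪ Y := by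
    rw [Set.sdiff_eq, union_union_inter_compl]
  have hAne : A.Nonempty := by
    rw [Set.nonempty_iff_ne_empty]
    rintro rfl
    rw [hf.empty] at hA
    exact absurd hA (by omega)
  rcases D.eq_empty_or_nonempty with rfl | hDne
  · simp [nodeWeight]
  by_cases hc : Crosses Y D
  · obtain ⟨v1, v2⟩ := d3 hc
    have := three_mul_nodeWeight_le (A' := A ∩ Y) (B' := D ∩ Y) hAne hDne (by omega) d1
      (by rw [e1]; omega) (Or.inr (Or.inl v1))
    have := three_mul_nodeWeight_le (A' := A ∪ Y) (B' := D \ Y) hAne hDne (by omega) d2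
      (by rw [e2]; omega) (Or.inr (Or.inl v2))
    have := nodeWeight_pos (f := f) hAne hDne
    omega
  · rcases inter_eq_or_of_not_crosses hc with h0 | h0
    · rw [nodeWeight_eq_zero (A := A ∩ Y) (Or.inr h0), zero_add]
      have := nodeWeight_le (A' := A ∪ Y) (B' := D \ Y) hAne hDne (by omega) d2
        (by rw [e2]; omega)
      refine ⟨this, ?_⟩
      by_cases hlow : f (A ∩ Y) = f A
      · have := three_mul_nodeWeight_le (A' := A ∪ Y) (B' := D \ Y) hAne hDne (by omega) d2
          (by rw [e2]; omega) (Or.inl (by omega))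
        have := nodeWeight_pos (f := f) hAne hDne
        omega
      · exact Or.inr fun h => absurd h hlow
    · rw [nodeWeight_eq_zero (A := A ∪ Y) (Or.inr h0), add_zero]
      have := nodeWeight_le (A' := A ∩ Y) (B' := D ∩ Y) hAne hDne (by omega) d1
        (by rw [e1]; omega)
      refine ⟨this, ?_⟩
      by_cases hlow : f ((A ∪ D) ∩ Y) = f (A ∪ D)
      · exact Or.inr fun _ => hlow
      · have := three_mul_nodeWeight_le (A' := A ∩ Y) (B' := D ∩ Y) hAne hDne (by omega) d1
          (by rw [e1]; omega) (Or.inr (Or.inr (by rw [e1]; omega)))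
        have := nodeWeight_pos (f := f) hAne hDne
        omega

/-- Uncrossing along the path from `s` to `t`: the subtree `s` is replaced by `U`, and the trees
that branch off the path lose the labels in `Y`. -/
theorem exists_uncrossed {f : Set α → ℕ} (hf : IsCutFunction f) {w : ℕ} {s t U : SplitTree α}
    {X : Set α} (hst : SubtreeVia (fun A => f U.supp < f A) s t) (htX : t.supp ⊆ X)
    (hmin : ∀ Z, s.supp ⊆ Z → Z ⊆ X → f U.supp ≤ f Z) (hsU : s.supp ⊆ U.supp) (hUX : U.supp ⊆ X)
    (hU : U.Proper) (hUw : U.WidthLE f w) (ht : t.Proper) (htw : t.WidthLE f w)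
    (href : ∀ E ∈ t.displayed, Disjoint E s.supp → f (E ∩ U.supp) ≤ f E ∧ f (E \ U.supp) ≤ f E ∧
      (Crosses U.supp E → f (E ∩ U.supp) < f E ∧ f (E \ U.supp) < f E)) :
    ∃ t' : SplitTree α, t'.supp = t.supp ∪ U.supp ∧ t'.Proper ∧ t'.WidthLE f w ∧
      t'.potential f + (t.restrict U.supp).potential f ≤ U.potential f + t.potential f ∧
      (t'.potential f + (t.restrict U.supp).potential f < U.potential f + t.potential f ∨
        f (t.supp ∩ U.supp) = f t.supp) := by
  have width : ∀ A, f A ≤ w → s.supp ⊆ A → A ⊆ X → f (A ∪ U.supp) ≤ w := fun A h1 h2 h3 => by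
    have := hf.sub A U.supp
    have := hmin (A ∩ U.supp) (Set.subset_inter h2 hsU) (Set.inter_subset_left.trans h3)
    omega
  -- The trees that branch off the path.
  have off : ∀ D : SplitTree α, D.displayed ⊆ t.displayed → Disjoint D.supp s.supp →
      D.WidthLE f w → Refines f U.supp D ∧ (D.restrict U.suppᶜ).WidthLE f w := by
    intro D hD hdis hw
    have h1 : Refines f U.supp D := fun E hE =>
      href E (hD hE) (hdis.mono_left (subset_supp_of_mem_displayed hE))
    refine ⟨h1, fun E hE => ?_⟩
    obtain ⟨E₀, hE₀, rfl⟩ := exists_of_mem_displayed_restrict hE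
    exact (h1 E₀ hE₀).2.1.trans (hw E₀ hE₀)
  induction hst with
  | refl h =>
    refine ⟨U, ?_, hU, hUw, ?_, Or.inr ?_⟩
    · rw [Set.union_eq_self_of_subset_left hsU]
    · rw [restrict_eq_self hsU]
    · rw [Set.inter_eq_self_of_subset_left hsU]
  | @left l r hsl hQ ih =>
    have hd : l.displayed ⊆ (node l r).displayed := fun E hE => Or.inr (Or.inl hE)
    have hd' : r.displayed ⊆ (node l r).displayed := fun E hE => Or.inr (Or.inr hE)
    obtain ⟨l', hl1, hl2, hl3, hl4, hl5⟩ := ih (Set.subset_union_left.trans htX) ht.2.1 htw.left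
      (fun E hE => href E (hd hE)) (fun D hD => off D (hD.trans hd))
    obtain ⟨o1, o2⟩ := off r hd' (ht.1.symm.mono_right hsl.supp_subset) htw.right
    have hnode := nodeWeight_uncross hf (Y := U.supp) (A := l.supp) (D := r.supp) hmin hsU hUX
      hsl.supp_subset htX hsl.holds hQ (o1 _ r.supp_mem_displayed)
    have hpot := potential_restrict_add o1
    refine ⟨node l' (r.restrict U.suppᶜ), ?_, ?_, ?_, ?_⟩
    · rw [supp, hl1, supp_restrict, union_union_inter_compl, supp]
    · refine ⟨?_, hl2, ht.2.2.restrict _⟩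
      rw [hl1, supp_restrict, Set.disjoint_union_left]
      exact ⟨ht.1.mono_right Set.inter_subset_left,
        (disjoint_compl_right).mono_right Set.inter_subset_right⟩
    · refine hl3.node o2 ?_
      have : l'.supp ∪ (r.restrict U.suppᶜ).supp = (l.supp ∪ r.supp) ∪ U.supp := by
        rw [hl1, supp_restrict, union_union_inter_compl]
      rw [this]
      exact width _ (htw _ (Or.inl rfl)) (hsl.supp_subset.trans Set.subset_union_left) htX
    · simp only [restrict, potential, supp_restrict, supp, hl1]
      rw [← Set.sdiff_eq]
      omega
  | @right l r hsr hQ ih =>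
    have hd : l.displayed ⊆ (node l r).displayed := fun E hE => Or.inr (Or.inl hE)
    have hd' : r.displayed ⊆ (node l r).displayed := fun E hE => Or.inr (Or.inr hE)
    obtain ⟨r', hr1, hr2, hr3, hr4, hr5⟩ := ih (Set.subset_union_right.trans htX) ht.2.2 htw.right
      (fun E hE => href E (hd' hE)) (fun D hD => off D (hD.trans hd'))
    obtain ⟨o1, o2⟩ := off l hd (ht.1.mono_right hsr.supp_subset) htw.left
    have hnode := nodeWeight_uncross hf (Y := U.supp) (A := r.supp) (D := l.supp) hmin hsU hUX
      hsr.supp_subset (by rw [Set.union_comm]; exact htX) hsr.holds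
      (by rw [Set.union_comm]; exact hQ) (o1 _ l.supp_mem_displayed)
    rw [Set.union_comm r.supp l.supp] at hnode
    have hpot := potential_restrict_add o1
    refine ⟨node (l.restrict U.suppᶜ) r', ?_, ?_, ?_, ?_⟩
    · rw [supp, hr1, supp_restrict, inter_compl_union_union, supp]
    · refine ⟨?_, ht.2.1.restrict _, hr2⟩
      rw [hr1, supp_restrict, Set.disjoint_union_right]
      exact ⟨ht.1.mono_left Set.inter_subset_left,
        (disjoint_compl_left).mono_left Set.inter_subset_right⟩
    · refine o2.node hr3 ?_
      have : (l.restrict U.suppᶜ).supp ∪ r'.supp = (l.supp ∪ r.supp) ∪ U.supp := by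
        rw [hr1, supp_restrict, inter_compl_union_union]
      rw [this]
      exact width _ (htw _ (Or.inl rfl)) (hsr.supp_subset.trans Set.subset_union_right) htX
    · simp only [restrict, potential, supp_restrict, supp, hr1]
      rw [← Set.sdiff_eq, nodeWeight_comm f (l.supp ∩ _), nodeWeight_comm f (l.supp \ _),
        nodeWeight_comm f l.supp]
      omega

/-- Optimal split trees are linked: if all sets on the path from `s` to the root `t` have value
more than `m`, then no set between `s` and `t` has value at most `m`. -/
theorem IsOptimal.linked {f : Set α → ℕ} (hf : IsCutFunction f) {w m : ℕ} {s t : SplitTree α}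
    (ht : t.IsOptimal f w) (hst : SubtreeVia (fun A => m < f A) s t) {Y : Set α}
    (hsY : s.supp ⊆ Y) (hYt : Y ⊆ t.supp) : m < f Y := by
  by_contra! hY
  -- Among the sets of least value, choose one that crosses as few branches as possible.
  let cross (Y : Set α) : Set (Set α) := {E | E ∈ t.displayed ∧ Disjoint E s.supp ∧ Crosses Y E}
  obtain ⟨Y₀, ⟨h1, h2⟩, h3⟩ := exists_minimalFor_of_wellFoundedLT
    (fun Y => s.supp ⊆ Y ∧ Y ⊆ t.supp) (fun Y => toLex (f Y, (cross Y).ncard)) ⟨Y, hsY, hYt⟩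
  have hmin : ∀ Z, s.supp ⊆ Z → Z ⊆ t.supp →
      f Y₀ < f Z ∨ f Y₀ = f Z ∧ (cross Y₀).ncard ≤ (cross Z).ncard := by
    intro Z hZ1 hZ2
    have : toLex (f Y₀, (cross Y₀).ncard) ≤ toLex (f Z, (cross Z).ncard) := by
      rcases le_total (toLex (f Y₀, (cross Y₀).ncard)) (toLex (f Z, (cross Z).ncard)) with h | h
      · exact h
      · exact h3 ⟨hZ1, hZ2⟩ h
    simpa [Prod.Lex.toLex_le_toLex] using this
  have hmin' : ∀ Z, s.supp ⊆ Z → Z ⊆ t.supp → f Y₀ ≤ f Z := fun Z hZ1 hZ2 => by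
    have := hmin Z hZ1 hZ2
    omega
  have hY0 : f Y₀ ≤ m := (hmin' Y hsY hYt).trans hY
  have hcross : ∀ E ∈ t.displayed, Disjoint E s.supp → Crosses Y₀ E → ∀ Z, s.supp ⊆ Z →
      Z ⊆ t.supp → (Z = Y₀ ∪ E ∨ Z = Y₀ \ E) → f Y₀ < f Z := by
    intro E hE hEs hEY Z hZ1 hZ2 hZ
    refine (hmin Z hZ1 hZ2).resolve_right fun ⟨_, hle⟩ => ?_
    refine absurd hle (not_le.mpr (Set.ncard_lt_ncard ?_
      (t.finite_displayed.subset fun _ h => h.1)))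
    refine ⟨fun E' ⟨hE'1, hE'2, hE'3⟩ => ⟨hE'1, hE'2, ?_⟩, fun h => ?_⟩
    · obtain ⟨⟨x, hx1, hx2⟩, ⟨y, hy1, hy2⟩⟩ := hE'3
      obtain ⟨⟨a, ha1, ha2⟩, ⟨b, hb1, hb2⟩⟩ := hEY
      rcases hZ with rfl | rfl
      · simp only [Set.mem_union, not_or] at hx2 hy2
        refine ⟨?_, y, hy1, hy2.1⟩
        rcases hx2 with hx2 | hx2
        · exact ⟨x, hx1, hx2⟩
        · rcases laminar ht.proper hE hE'1 with h | h | h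
          · exact absurd hx1 (Set.disjoint_left.mp h hx2)
          · exact ⟨a, h ha1, ha2⟩
          · exact absurd (h hy1) hy2.2
      · simp only [Set.mem_sdiff, not_and, not_not] at hx2 hy2
        refine ⟨⟨x, hx1, hx2.1⟩, ?_⟩
        by_cases hy : y ∈ Y₀
        · rcases laminar ht.proper hE hE'1 with h | h | h
          · exact absurd hy1 (Set.disjoint_left.mp h (hy2 hy))
          · exact ⟨b, h hb1, hb2⟩
          · exact absurd (h hx1) hx2.2
        · exact ⟨y, hy1, hy⟩
    · have := (h (show E ∈ cross Y₀ from ⟨hE, hEs, hEY⟩)).2.2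
      obtain ⟨⟨x, hx1, hx2⟩, ⟨y, hy1, hy2⟩⟩ := this
      rcases hZ with rfl | rfl
      · exact hy2 (Or.inr hy1)
      · exact hx2.2 hx1
  have href : ∀ E ∈ t.displayed, Disjoint E s.supp → f (E ∩ Y₀) ≤ f E ∧ f (E \ Y₀) ≤ f E ∧
      (Crosses Y₀ E → f (E ∩ Y₀) < f E ∧ f (E \ Y₀) < f E) := by
    intro E hE hEs
    have i1 : s.supp ⊆ Y₀ ∪ E := h1.trans Set.subset_union_left
    have i2 : Y₀ ∪ E ⊆ t.supp := Set.union_subset h2 (subset_supp_of_mem_displayed hE)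
    have i3 : s.supp ⊆ Y₀ \ E := fun x hx => ⟨h1 hx, fun h => Set.disjoint_left.mp hEs h hx⟩
    have i4 : Y₀ \ E ⊆ t.supp := Set.sdiff_subset.trans h2
    have j1 := hf.sub E Y₀
    rw [Set.union_comm] at j1
    have j2 := hf.pos E Y₀
    have k1 := hmin' _ i1 i2
    have k2 := hmin' _ i3 i4
    refine ⟨by omega, by omega, fun hc => ?_⟩
    have l1 := hcross E hE hEs hc _ i1 i2 (Or.inl rfl)
    have l2 := hcross E hE hEs hc _ i3 i4 (Or.inr rfl)
    exact ⟨by omega, by omega⟩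
  have hUs : (t.restrict Y₀).supp = Y₀ := by
    rw [supp_restrict, Set.inter_eq_self_of_subset_right h2]
  have hpath : SubtreeVia (fun A => f Y₀ < f A) s t := hst.mono fun A hA => hY0.trans_lt hA
  have hUw : (t.restrict Y₀).WidthLE f w := by
    intro E' hE'
    obtain ⟨E, hE, rfl⟩ := exists_of_mem_displayed_restrict hE'
    refine le_trans ?_ (ht.width E hE)
    have := hf.sub E Y₀
    have := hmin' (E ∪ Y₀) (h1.trans Set.subset_union_right)
      (Set.union_subset (subset_supp_of_mem_displayed hE) h2)
    omega
  -- Putting the restriction of `t` to `Y₀` in place of `s` contradicts the optimality of `t`.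
  obtain ⟨t', t1, t2, t3, -, t4⟩ := exists_uncrossed hf (U := t.restrict Y₀) (w := w) (X := t.supp)
    (by rwa [hUs]) subset_rfl (by rwa [hUs]) (by rwa [hUs]) (by rwa [hUs]) (ht.proper.restrict _)
    hUw ht.proper ht.width (by rwa [hUs])
  rw [hUs, Set.union_eq_self_of_subset_right h2] at t1
  have := ht.le t' t1 t2 t3
  rw [hUs] at t4
  have := hpath.holds
  rw [Set.inter_eq_self_of_subset_right h2] at t4
  omega

end SplitTree

namespace MultiDigraph

/-! ### Cut sizes -/

instance (G : MultiDigraph.{u, v}) : Finite G.V := G.finite_vertices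

instance (G : MultiDigraph.{u, v}) : Finite G.E := G.finite_edges

/-- The edges from `X` to its complement. -/
def outCut (G : MultiDigraph.{u, v}) (X : Set G.V) : Set G.E :=
  {e | G.tail e ∈ X ∧ G.head e ∉ X}

/-- The number of the edges in `S` that lead from `X` to its complement. -/
noncomputable def outCount (G : MultiDigraph.{u, v}) (S : Set G.E) (X : Set G.V) : ℕ :=
  {e | e ∈ S ∧ G.tail e ∈ X ∧ G.head e ∉ X}.ncard

/-- The number of the edges that lead from `X` to its complement. -/
noncomputable def outSize (G : MultiDigraph.{u, v}) (X : Set G.V) : ℕ := (G.outCut X).ncard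

theorem outCount_univ (G : MultiDigraph.{u, v}) (X : Set G.V) :
    G.outCount Set.univ X = G.outSize X := by
  simp [outCount, outSize, outCut]

open Classical in
theorem _root_.Set.ncard_setOf_eq_sum {ι : Type*} [Fintype ι] (P : ι → Prop) :
    {i | P i}.ncard = ∑ i, if P i then 1 else 0 := by
  rw [Set.ncard_eq_toFinset_card', Finset.sum_boole, Set.toFinset_ofPred]
  simp

theorem outCount_submodular (G : MultiDigraph.{u, v}) (S : Set G.E) (A B : Set G.V) :
    G.outCount S (A ∩ B) + G.outCount S (A ∪ B) ≤ G.outCount S A + G.outCount S B := by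
  classical
  have := Fintype.ofFinite G.E
  simp only [outCount, Set.ncard_setOf_eq_sum, ← Finset.sum_add_distrib]
  refine Finset.sum_le_sum fun e _ => ?_
  by_cases h1 : G.tail e ∈ A <;> by_cases h2 : G.tail e ∈ B <;> by_cases h3 : G.head e ∈ A <;>
    by_cases h4 : G.head e ∈ B <;> by_cases h5 : e ∈ S <;> simp [h1, h2, h3, h4, h5]

theorem outSize_submodular (G : MultiDigraph.{u, v}) (A B : Set G.V) :
    G.outSize (A ∩ B) + G.outSize (A ∪ B) ≤ G.outSize A + G.outSize B := by
  simpa only [outCount_univ] using G.outCount_submodular Set.univ A B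

/-- If in- and out-degrees with respect to `S` agree on `M`, then the edges of `S` that enter a
vertex of `M` can be matched to edges of `S` that leave this vertex. -/
theorem exists_transitions {E : Type*} {V : Type*} [Finite E] (tl hd : E → V) (S : Set E)
    (M : Set V) (h : ∀ x ∈ M, {e | e ∈ S ∧ hd e = x}.ncard = {e | e ∈ S ∧ tl e = x}.ncard) :
    ∃ σ : E → E, Set.BijOn σ {e | e ∈ S ∧ hd e ∈ M} {e | e ∈ S ∧ tl e ∈ M} ∧
      ∀ e ∈ S, hd e ∈ M → tl (σ e) = hd e := by
  have : ∀ x, ∃ f : E → E, x ∈ M →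
      Set.BijOn f {e | e ∈ S ∧ hd e = x} {e | e ∈ S ∧ tl e = x} := by
    intro x
    by_cases hx : x ∈ M
    · have hc := h x hx
      rw [← Nat.cast_inj (R := ℕ∞), (Set.toFinite _).cast_ncard_eq,
        (Set.toFinite _).cast_ncard_eq] at hc
      rcases isEmpty_or_nonempty E with hE | hE
      · exact ⟨id, fun _ => ⟨fun a => hE.elim a, fun a => hE.elim a, fun a => hE.elim a⟩⟩
      · obtain ⟨f, hf⟩ := (Set.toFinite _).exists_bijOn_of_encard_eq hc
        exact ⟨f, fun _ => hf⟩
    · exact ⟨id, fun h => absurd h hx⟩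
  choose f hf using this
  have ht : ∀ e ∈ S, hd e ∈ M → f (hd e) e ∈ S ∧ tl (f (hd e) e) = hd e := fun e he hM =>
    (hf _ hM).mapsTo ⟨he, rfl⟩
  refine ⟨fun e => f (hd e) e, ⟨?_, ?_, ?_⟩, fun e he hM => (ht e he hM).2⟩
  · rintro e ⟨he, hM⟩
    refine ⟨(ht e he hM).1, ?_⟩
    rw [(ht e he hM).2]
    exact hM
  · rintro e ⟨he, hM⟩ e' ⟨he', hM'⟩ heq
    have h1 := (ht e he hM).2
    have h2 := (ht e' he' hM').2
    dsimp only at heq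
    rw [heq, h2] at h1
    refine (hf _ hM).injOn ⟨he, rfl⟩ ⟨he', h1⟩ ?_
    rw [heq, h1]
  · rintro e ⟨he, hM⟩
    obtain ⟨a, ⟨ha, ha'⟩, hae⟩ := (hf _ hM).surjOn ⟨he, rfl⟩
    refine ⟨a, ⟨ha, ha' ▸ hM⟩, ?_⟩
    dsimp only
    rw [ha', hae]

/-- If in- and out-degrees with respect to `S` agree on `M`, then there are pairwise disjoint trails
in `S` that start from the edges of `S` with tail outside of `M`, run through `M`, and leave `M`. -/
theorem exists_trails {E : Type*} {V : Type*} [Finite E] (tl hd : E → V) (S : Set E)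
    (M : Set V) (h : ∀ x ∈ M, {e | e ∈ S ∧ hd e = x}.ncard = {e | e ∈ S ∧ tl e = x}.ncard) :
    ∃ p : E → List E, ∀ e ∈ S, tl e ∉ M →
      (p e).head? = some e ∧ (p e).Nodup ∧ (p e).IsChain (fun a b => hd a = tl b ∧ hd a ∈ M) ∧
      (∀ a ∈ p e, a ∈ S ∧ (a = e ∨ tl a ∈ M)) ∧ (∀ a ∈ (p e).getLast?, hd a ∉ M) ∧
      ∀ f ∈ S, tl f ∉ M → e ≠ f → List.Disjoint (p e) (p f) := by
  classical
  obtain ⟨σ, hσ, hσt⟩ := exists_transitions tl hd S M h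
  -- Two coinciding iterates have the same starting edge and the same exponent.
  have inj : ∀ i e f j, e ∈ S → f ∈ S → tl e ∉ M → tl f ∉ M →
      (∀ k < i, σ^[k] e ∈ S ∧ hd (σ^[k] e) ∈ M) → (∀ k < j, σ^[k] f ∈ S ∧ hd (σ^[k] f) ∈ M) →
      σ^[i] e = σ^[j] f → i = j ∧ e = f := by
    intro i
    induction i with
    | zero =>
      intro e f j he hf he' hf' _ hj heq
      cases j with
      | zero => exact ⟨rfl, heq⟩
      | succ j =>
        rw [Function.iterate_zero, id, Function.iterate_succ_apply'] at heq
        refine absurd ?_ he'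
        rw [heq, hσt _ (hj j (by omega)).1 (hj j (by omega)).2]
        exact (hj j (by omega)).2
    | succ i ih =>
      intro e f j he hf he' hf' hi hj heq
      cases j with
      | zero =>
        rw [Function.iterate_zero, id, Function.iterate_succ_apply'] at heq
        refine absurd ?_ hf'
        rw [← heq, hσt _ (hi i (by omega)).1 (hi i (by omega)).2]
        exact (hi i (by omega)).2
      | succ j =>
        rw [Function.iterate_succ_apply', Function.iterate_succ_apply'] at heq
        have := ih e f j he hf he' hf' (fun k hk => hi k (by omega)) (fun k hk => hj k (by omega))
          (hσ.injOn (hi i (by omega)) (hj j (by omega)) heq)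
        exact ⟨by omega, this.2⟩
  have mem : ∀ n e, e ∈ S → (∀ k < n, hd (σ^[k] e) ∈ M) → ∀ k ≤ n, σ^[k] e ∈ S := by
    intro n e he hn k
    induction k with
    | zero => exact fun _ => he
    | succ k ih =>
      intro hk
      rw [Function.iterate_succ_apply']
      exact (hσ.mapsTo ⟨ih (by omega), hn k (by omega)⟩).1
  have ex : ∀ e, e ∈ S → tl e ∉ M → ∃ n, hd (σ^[n] e) ∉ M := by
    intro e he he'
    by_contra! hcon
    have hS : ∀ k, σ^[k] e ∈ S := fun k => mem k e he (fun _ _ => hcon _) k le_rfl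
    exact not_injective_infinite_finite (fun n => σ^[n] e) fun i j hij =>
      (inj i e e j he he he' he' (fun _ _ => ⟨hS _, hcon _⟩) (fun _ _ => ⟨hS _, hcon _⟩) hij).1
  let n : E → ℕ := fun e => if h : ∃ n, hd (σ^[n] e) ∉ M then Nat.find h else 0
  have n1 : ∀ e ∈ S, tl e ∉ M → hd (σ^[n e] e) ∉ M := by
    intro e he he'
    simp only [n, dif_pos (ex e he he')]
    exact Nat.find_spec (ex e he he')
  have n2 : ∀ e ∈ S, tl e ∉ M → ∀ k < n e, hd (σ^[k] e) ∈ M := by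
    intro e he he' k hk
    simp only [n, dif_pos (ex e he he')] at hk
    simpa using Nat.find_min (ex e he he') hk
  have n3 : ∀ e (he : e ∈ S) (he' : tl e ∉ M), ∀ k ≤ n e, σ^[k] e ∈ S := fun e he he' =>
    mem _ e he (n2 e he he')
  refine ⟨fun e => (List.range (n e + 1)).map fun i => σ^[i] e, fun e he he' => ?_⟩
  refine ⟨?_, ?_, ?_, ?_, ?_, ?_⟩
  · simp [List.range_succ_eq_map]
  · refine List.Nodup.map_on (fun i hi j hj hij => ?_) List.nodup_range
    rw [List.mem_range] at hi hj
    exact (inj i e e j he he he' he'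
      (fun k hk => ⟨n3 e he he' k (by omega), n2 e he he' k (by omega)⟩)
      (fun k hk => ⟨n3 e he he' k (by omega), n2 e he he' k (by omega)⟩) hij).1
  · rw [List.isChain_map]
    refine (List.isChain_range_succ _ _).2 fun m hm => ?_
    rw [Function.iterate_succ_apply']
    exact ⟨(hσt _ (n3 e he he' m hm.le) (n2 e he he' m hm)).symm, n2 e he he' m hm⟩
  · intro a ha
    obtain ⟨i, hi, rfl⟩ := List.mem_map.mp ha
    rw [List.mem_range] at hi
    refine ⟨n3 e he he' i (by omega), ?_⟩
    cases i with
    | zero => exact Or.inl rfl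
    | succ i =>
      right
      rw [Function.iterate_succ_apply', hσt _ (n3 e he he' i (by omega)) (n2 e he he' i (by omega))]
      exact n2 e he he' i (by omega)
  · intro a ha
    dsimp only at ha
    rw [List.range_succ, List.map_append, List.map_singleton, List.getLast?_concat,
      Option.mem_some_iff] at ha
    rw [← ha]
    exact n1 e he he'
  · intro f hf hf' hne a ha ha'
    obtain ⟨i, hi, rfl⟩ := List.mem_map.mp ha
    obtain ⟨j, hj, hij⟩ := List.mem_map.mp ha'
    rw [List.mem_range] at hi hj
    exact hne (inj i e f j he hf he' hf'
      (fun k hk => ⟨n3 e he he' k (by omega), n2 e he he' k (by omega)⟩)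
      (fun k hk => ⟨n3 f hf hf' k (by omega), n2 f hf hf' k (by omega)⟩) hij.symm).2

/-! ### Linking two cuts of the same size -/

/-- A form of Menger's theorem: if every set between `F` and `X` is left by at least `n` edges,
then there is a set of edges with this property that is balanced at every vertex of `X \ F` and has
no edge into `F` or from outside of `X`. It is a minimal set of edges with the property. -/
theorem exists_balanced_subset (G : MultiDigraph.{u, v}) {F X : Set G.V} {n : ℕ}
    (hmin : ∀ Y, F ⊆ Y → Y ⊆ X → n ≤ G.outSize Y) :
    ∃ S : Set G.E, (∀ Y, F ⊆ Y → Y ⊆ X → n ≤ G.outCount S Y) ∧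
      (∀ e ∈ S, G.tail e ∈ X ∧ G.head e ∉ F) ∧
      ∀ x ∈ X \ F, {e | e ∈ S ∧ G.head e = x}.ncard = {e | e ∈ S ∧ G.tail e = x}.ncard := by
  classical
  have := Fintype.ofFinite G.E
  obtain ⟨S, -, hS⟩ := exists_minimal_le_of_wellFoundedLT
    (fun S : Set G.E => ∀ Y, F ⊆ Y → Y ⊆ X → n ≤ G.outCount S Y) Set.univ
    (fun Y h1 h2 => by rw [outCount_univ]; exact hmin Y h1 h2)
  -- By minimality, every edge of `S` leaves a set that `S` leaves exactly `n` times.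
  have tight : ∀ e ∈ S, ∃ Y, F ⊆ Y ∧ Y ⊆ X ∧ G.outCount S Y = n ∧ G.tail e ∈ Y ∧ G.head e ∉ Y := by
    intro e he
    have hlt : ¬ ∀ Y, F ⊆ Y → Y ⊆ X → n ≤ G.outCount (S \ {e}) Y := fun h =>
      (hS.le_of_le h Set.sdiff_subset he).2 rfl
    push Not at hlt
    obtain ⟨Y, h1, h2, h3⟩ := hlt
    have h4 := hS.prop Y h1 h2
    have h5 : G.tail e ∈ Y ∧ G.head e ∉ Y := by
      by_contra hcon
      refine h3.not_ge (h4.trans (Set.ncard_le_ncard ?_))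
      rintro a ⟨ha, ha'⟩
      refine ⟨⟨ha, ?_⟩, ha'⟩
      rintro rfl
      exact hcon ha'
    refine ⟨Y, h1, h2, le_antisymm ?_ h4, h5⟩
    have : {a | a ∈ S ∧ G.tail a ∈ Y ∧ G.head a ∉ Y} ⊆
        insert e {a | a ∈ S \ {e} ∧ G.tail a ∈ Y ∧ G.head a ∉ Y} := by
      rintro a ⟨ha, ha'⟩
      by_cases hae : a = e
      · exact Or.inl hae
      · exact Or.inr ⟨⟨ha, hae⟩, ha'⟩
    have h6 := (Set.ncard_le_ncard this).trans (Set.ncard_insert_le _ _)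
    change G.outCount S Y ≤ G.outCount (S \ {e}) Y + 1 at h6
    omega
  have lattice : ∀ Y Z, F ⊆ Y → Y ⊆ X → G.outCount S Y = n → F ⊆ Z → Z ⊆ X →
      G.outCount S Z = n → G.outCount S (Y ∩ Z) = n ∧ G.outCount S (Y ∪ Z) = n := by
    intro Y Z h1 h2 h3 h4 h5 h6
    have a := G.outCount_submodular S Y Z
    have b := hS.prop (Y ∩ Z) (Set.subset_inter h1 h4) (Set.inter_subset_left.trans h2)
    have c := hS.prop (Y ∪ Z) (h1.trans Set.subset_union_left) (Set.union_subset h2 h5)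
    omega
  refine ⟨S, hS.prop, fun e he => ?_, fun x hx => ?_⟩
  · obtain ⟨Y, h1, h2, -, h3, h4⟩ := tight e he
    exact ⟨h2 h3, fun h => h4 (h1 h)⟩
  apply le_antisymm
  · by_cases hne : ∃ e ∈ S, G.head e = x
    · -- Compare the largest tight set that avoids `x` with the set that also contains `x`.
      obtain ⟨e₀, he₀, hx₀⟩ := hne
      obtain ⟨Y₀, y1, y2, y3, -, y5⟩ := tight e₀ he₀
      obtain ⟨Y, -, ⟨h1, h2, h3, h4⟩, h5⟩ := exists_maximal_ge_of_wellFoundedGT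
        (fun Y : Set G.V => F ⊆ Y ∧ Y ⊆ X ∧ G.outCount S Y = n ∧ x ∉ Y) Y₀ ⟨y1, y2, y3, hx₀ ▸ y5⟩
      have hin : ∀ e ∈ S, G.head e = x → G.tail e ∈ Y := by
        intro e he hex
        obtain ⟨Z, z1, z2, z3, z4, z5⟩ := tight e he
        have : Y ∪ Z ⊆ Y := h5 ⟨h1.trans Set.subset_union_left, Set.union_subset h2 z2,
          (lattice Y Z h1 h2 h3 z1 z2 z3).2, by rw [hex] at z5; simp [h4, z5]⟩ Set.subset_union_left
        exact this (Or.inr z4)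
      have h6 := hS.prop (insert x Y) (h1.trans (Set.subset_insert _ _))
        (Set.insert_subset hx.1 h2)
      suffices H : G.outCount S (insert x Y) + {e | e ∈ S ∧ G.head e = x}.ncard ≤
          G.outCount S Y + {e | e ∈ S ∧ G.tail e = x}.ncard by omega
      simp only [outCount, Set.ncard_setOf_eq_sum, ← Finset.sum_add_distrib]
      refine Finset.sum_le_sum fun e _ => ?_
      by_cases he : e ∈ S
      · by_cases hex : G.head e = x
        · simp [he, hex, hin e he hex, h4]
        · by_cases a1 : G.tail e = x <;> by_cases a2 : G.tail e ∈ Y <;>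
            by_cases a3 : G.head e ∈ Y <;> simp [he, hex, a1, a2, a3]
      · simp [he]
    · push Not at hne
      have : {e | e ∈ S ∧ G.head e = x} = ∅ := by
        ext e
        simp only [Set.mem_ofPred_eq, Set.mem_empty_iff_false, iff_false, not_and]
        exact hne e
      rw [this, Set.ncard_empty]
      exact Nat.zero_le _
  · by_cases hne : ∃ e ∈ S, G.tail e = x
    · -- Compare the smallest tight set that contains `x` with the set without `x`.
      obtain ⟨e₀, he₀, hx₀⟩ := hne
      obtain ⟨Y₀, y1, y2, y3, y4, -⟩ := tight e₀ he₀
      obtain ⟨Y, -, ⟨h1, h2, h3, h4⟩, h5⟩ := exists_minimal_le_of_wellFoundedLT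
        (fun Y : Set G.V => F ⊆ Y ∧ Y ⊆ X ∧ G.outCount S Y = n ∧ x ∈ Y) Y₀ ⟨y1, y2, y3, hx₀ ▸ y4⟩
      have hout : ∀ e ∈ S, G.tail e = x → G.head e ∉ Y := by
        intro e he hex hY
        obtain ⟨Z, z1, z2, z3, z4, z5⟩ := tight e he
        have : Y ⊆ Y ∩ Z := h5 ⟨Set.subset_inter h1 z1, Set.inter_subset_left.trans h2,
          (lattice Y Z h1 h2 h3 z1 z2 z3).1, h4, hex ▸ z4⟩ Set.inter_subset_left
        exact z5 (this hY).2
      have h6 := hS.prop (Y \ {x}) (fun a ha => ⟨h1 ha, fun h => hx.2 (h ▸ ha)⟩)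
        (Set.sdiff_subset.trans h2)
      suffices H : G.outCount S (Y \ {x}) + {e | e ∈ S ∧ G.tail e = x}.ncard ≤
          G.outCount S Y + {e | e ∈ S ∧ G.head e = x}.ncard by omega
      simp only [outCount, Set.ncard_setOf_eq_sum, ← Finset.sum_add_distrib]
      refine Finset.sum_le_sum fun e _ => ?_
      by_cases he : e ∈ S
      · by_cases hex : G.tail e = x
        · simp [he, hex, hout e he hex, h4]
        · by_cases a1 : G.head e = x <;> by_cases a2 : G.tail e ∈ Y <;>
            by_cases a3 : G.head e ∈ Y <;> simp [he, hex, a1, a2, a3]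
      · simp [he]
    · push Not at hne
      have : {e | e ∈ S ∧ G.tail e = x} = ∅ := by
        ext e
        simp only [Set.mem_ofPred_eq, Set.mem_empty_iff_false, iff_false, not_and]
        exact hne e
      rw [this, Set.ncard_empty]
      exact Nat.zero_le _

theorem IsEulerian.ncard_eq {G : MultiDigraph.{u, v}} (hG : G.IsEulerian) (x : G.V) :
    {e | G.head e = x}.ncard = {e | G.tail e = x}.ncard := by
  rw [Set.ncard, Set.ncard, hG x]

theorem ncard_setOf_notMem {ι : Type*} [Finite ι] (S : Set ι) (P : ι → Prop) :
    {i | i ∈ Sᶜ ∧ P i}.ncard + {i | i ∈ S ∧ P i}.ncard = {i | P i}.ncard := by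
  classical
  have := Fintype.ofFinite ι
  simp only [Set.ncard_setOf_eq_sum, ← Finset.sum_add_distrib]
  refine Finset.sum_congr rfl fun i _ => ?_
  by_cases h : i ∈ S <;> by_cases h' : P i <;> simp [h, h']

theorem outCut_subset_of_le {G : MultiDigraph.{u, v}} {S : Set G.E} {X : Set G.V}
    (h : G.outSize X ≤ G.outCount S X) : G.outCut X ⊆ S := by
  have : {e | e ∈ S ∧ G.tail e ∈ X ∧ G.head e ∉ X} = G.outCut X :=
    Set.eq_of_subset_of_ncard_le (fun e he => he.2) h
  intro e he
  rw [← this] at he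
  exact he.1

/-- If `F ⊆ X` are left by the same number of edges, and no set between them is left by fewer edges,
then the edges at `F` extend to edge-disjoint trails through `X \ F` to the boundary of `X`. Once
trails from `F` to the outside of `X` have been found, the remaining edges are balanced and give the
trails in the opposite direction. -/
theorem IsEulerian.exists_linkage {G : MultiDigraph.{u, v}} (hG : G.IsEulerian) {F X : Set G.V}
    (hFX : F ⊆ X) (hle : G.outSize X ≤ G.outSize F)
    (hmin : ∀ Y, F ⊆ Y → Y ⊆ X → G.outSize F ≤ G.outSize Y) :
    ∃ p : G.E → List G.E,
      (∀ e, G.tail e ∈ F → G.head e ∈ F → p e = [e]) ∧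
      (∀ e, G.tail e ∈ F → G.head e ∉ F → (p e).head? = some e ∧
        ∀ a ∈ (p e).getLast?, G.tail a ∈ X ∧ G.head a ∉ X) ∧
      (∀ e, G.tail e ∉ F → G.head e ∈ F → (p e).getLast? = some e ∧
        ∀ a ∈ (p e).head?, G.tail a ∉ X ∧ G.head a ∈ X) ∧
      (∀ e, G.tail e ∈ F ∨ G.head e ∈ F → (p e).Nodup ∧
        (p e).IsChain (fun a b => G.head a = G.tail b ∧ G.head a ∈ X \ F) ∧
        ∀ f, G.tail f ∈ F ∨ G.head f ∈ F → e ≠ f → List.Disjoint (p e) (p f)) := by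
  classical
  obtain ⟨S, hS1, hS2, hS3⟩ := G.exists_balanced_subset hmin
  have hSF : G.outCut F ⊆ S := outCut_subset_of_le (hS1 F subset_rfl hFX)
  have hSX : G.outCut X ⊆ S := outCut_subset_of_le (hle.trans (hS1 X hFX subset_rfl))
  obtain ⟨p, hp⟩ := exists_trails G.tail G.head S (X \ F) hS3
  -- The complement of `S` is balanced as well; its trails are followed backwards.
  obtain ⟨q, hq⟩ := exists_trails G.head G.tail Sᶜ (X \ F) fun x hx => by
    have h1 := ncard_setOf_notMem S fun e => G.head e = x
    have h2 := ncard_setOf_notMem S fun e => G.tail e = x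
    have h3 := hS3 x hx
    have h4 := hG.ncard_eq x
    omega
  have hin : ∀ e, G.tail e ∉ F → G.head e ∈ F → e ∈ Sᶜ ∧ G.head e ∉ X \ F := fun e _ h2 =>
    ⟨fun h => (hS2 e h).2 h2, fun h => h.2 h2⟩
  have hout : ∀ e, G.tail e ∈ F → G.head e ∉ F → e ∈ S ∧ G.tail e ∉ X \ F := fun e h1 h2 =>
    ⟨hSF ⟨h1, h2⟩, fun h => h.2 h1⟩
  let r : G.E → List G.E := fun e =>
    if G.tail e ∈ F then (if G.head e ∈ F then [e] else p e) else (q e).reverse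
  have r1 : ∀ e, G.tail e ∈ F → G.head e ∈ F → r e = [e] := fun e h1 h2 => by simp [r, h1, h2]
  have r2 : ∀ e, G.tail e ∈ F → G.head e ∉ F → r e = p e := fun e h1 h2 => by simp [r, h1, h2]
  have r3 : ∀ e, G.tail e ∉ F → r e = (q e).reverse := fun e h1 => by simp [r, h1]
  refine ⟨r, r1, fun e h1 h2 => ?_, fun e h1 h2 => ?_, fun e he => ?_⟩
  · obtain ⟨a1, a2⟩ := hout e h1 h2
    obtain ⟨b1, b2, b3, b4, b5, b6⟩ := hp e a1 a2
    rw [r2 e h1 h2]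
    refine ⟨b1, fun a ha => ?_⟩
    have haS := (b4 a (List.mem_of_getLast? ha)).1
    exact ⟨(hS2 a haS).1, fun h => b5 a ha ⟨h, (hS2 a haS).2⟩⟩
  · obtain ⟨a1, a2⟩ := hin e h1 h2
    obtain ⟨b1, b2, b3, b4, b5, b6⟩ := hq e a1 a2
    rw [r3 e h1, List.getLast?_reverse, List.head?_reverse]
    refine ⟨b1, fun a ha => ?_⟩
    obtain ⟨haS, ha'⟩ := b4 a (List.mem_of_getLast? ha)
    have h3 := b5 a ha
    have hX : G.head a ∈ X := by
      rcases ha' with rfl | ha'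
      · exact hFX h2
      · exact ha'.1
    refine ⟨fun h => h3 ⟨h, fun hF => ?_⟩, hX⟩
    rcases ha' with rfl | ha'
    · exact h1 hF
    · exact haS (hSF ⟨hF, ha'.2⟩)
  · by_cases h1 : G.tail e ∈ F
    · by_cases h2 : G.head e ∈ F
      · rw [r1 e h1 h2]
        refine ⟨List.nodup_singleton _, List.isChain_singleton _, fun f hf hef => ?_⟩
        rw [List.singleton_disjoint]
        intro hmem
        by_cases f1 : G.tail f ∈ F
        · by_cases f2 : G.head f ∈ F
          · rw [r1 f f1 f2, List.mem_singleton] at hmem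
            exact hef hmem
          · obtain ⟨a1, a2⟩ := hout f f1 f2
            rw [r2 f f1 f2] at hmem
            obtain ⟨-, -, -, b4, -⟩ := hp f a1 a2
            exact (hS2 e (b4 e hmem).1).2 h2
        · obtain ⟨a1, a2⟩ := hin f f1 (hf.resolve_left f1)
          rw [r3 f f1, List.mem_reverse] at hmem
          obtain ⟨-, -, -, b4, -⟩ := hq f a1 a2
          exact (b4 e hmem).2.elim hef fun h => h.2 h2
      · obtain ⟨a1, a2⟩ := hout e h1 h2
        obtain ⟨b1, b2, b3, b4, b5, b6⟩ := hp e a1 a2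
        rw [r2 e h1 h2]
        refine ⟨b2, b3, fun f hf hef => ?_⟩
        by_cases f1 : G.tail f ∈ F
        · by_cases f2 : G.head f ∈ F
          · rw [r1 f f1 f2, List.disjoint_singleton]
            exact fun h => (hS2 f (b4 f h).1).2 f2
          · obtain ⟨c1, c2⟩ := hout f f1 f2
            rw [r2 f f1 f2]
            exact b6 f c1 c2 hef
        · obtain ⟨c1, c2⟩ := hin f f1 (hf.resolve_left f1)
          rw [r3 f f1, List.disjoint_reverse_right]
          exact fun a ha ha' => ((hq f c1 c2).2.2.2.1 a ha').1 (b4 a ha).1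
    · obtain ⟨a1, a2⟩ := hin e h1 (he.resolve_left h1)
      obtain ⟨b1, b2, b3, b4, b5, b6⟩ := hq e a1 a2
      rw [r3 e h1]
      refine ⟨List.nodup_reverse.mpr b2, ?_, fun f hf hef => ?_⟩
      · rw [List.isChain_reverse]
        refine b3.imp ?_
        rintro a b ⟨h, h'⟩
        exact ⟨h.symm, h ▸ h'⟩
      · rw [List.disjoint_reverse_left]
        by_cases f1 : G.tail f ∈ F
        · by_cases f2 : G.head f ∈ F
          · rw [r1 f f1 f2, List.disjoint_singleton]
            intro h
            exact (b4 f h).2.elim (fun h => hef h.symm) fun h => h.2 f2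
          · obtain ⟨c1, c2⟩ := hout f f1 f2
            rw [r2 f f1 f2]
            exact fun a ha ha' => (b4 a ha).1 ((hp f c1 c2).2.2.2.1 a ha').1
        · obtain ⟨c1, c2⟩ := hin f f1 (hf.resolve_left f1)
          rw [r3 f f1, List.disjoint_reverse_right]
          exact b6 f c1 c2 hef

end MultiDigraph

/-! ### Pieces and their immersions -/

namespace List

theorem IsChain.head?_or_exists_rel {α : Type*} {R : α → α → Prop} {l : List α} (h : l.IsChain R)
    {a : α} (ha : a ∈ l) : l.head? = some a ∨ ∃ b ∈ l, R b a := by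
  induction l with
  | nil => simp at ha
  | cons x l ih =>
    rw [List.isChain_cons] at h
    rcases mem_cons.mp ha with rfl | ha
    · exact Or.inl rfl
    · rcases ih h.2 ha with h' | ⟨b, hb, hR⟩
      · exact Or.inr ⟨x, mem_cons_self, h.1 a h'⟩
      · exact Or.inr ⟨b, mem_cons_of_mem _ hb, hR⟩

theorem IsChain.getLast?_or_exists_rel {α : Type*} {R : α → α → Prop} {l : List α}
    (h : l.IsChain R) {a : α} (ha : a ∈ l) : l.getLast? = some a ∨ ∃ b ∈ l, R a b := by
  rw [← reverse_reverse l, isChain_reverse] at h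
  rcases h.head?_or_exists_rel (mem_reverse.mpr ha) with h' | ⟨b, hb, hR⟩
  · rw [head?_reverse] at h'
    exact Or.inl h'
  · exact Or.inr ⟨b, mem_reverse.mp hb, hR⟩

theorem IsChain.exists_rel_of_mem_dropLast {α : Type*} {R : α → α → Prop} {l : List α}
    (h : l.IsChain R) {a : α} (ha : a ∈ l.dropLast) : ∃ b, R a b := by
  induction l with
  | nil => simp at ha
  | cons x l ih =>
    rw [List.isChain_cons] at h
    cases l with
    | nil => simp at ha
    | cons y l =>
      rw [dropLast_cons_cons, mem_cons] at ha
      rcases ha with rfl | ha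
      · exact ⟨y, h.1 y rfl⟩
      · exact ih h.2 ha

end List

/-- A vertex set `X` of a digraph together with distinct labels for the edges that have exactly one
end in `X`. -/
structure Piece (ι : Type) where
  /-- the digraph -/
  G : MultiDigraph.{u, v}
  /-- the vertex set -/
  X : Set G.V
  /-- the labels; only those of the edges in the cut of `X` matter -/
  lab : G.E → ι
  lab_inj : Set.InjOn lab (G.cut X)

namespace Piece

variable {ι : Type}

/-- `e` has an end in the piece. -/
def Touches (P : Piece.{u, v} ι) (e : P.G.E) : Prop := P.G.tail e ∈ P.X ∨ P.G.head e ∈ P.X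

/-- A strong immersion of a piece in another one. The edges that leave or enter the first piece
become trails that end or start with the edge of the second piece that has the same label. Nothing
is required of the edges without an end in the piece. -/
structure Immersion (P Q : Piece.{u, v} ι) where
  /-- the image of a vertex -/
  vert : P.G.V → Q.G.V
  /-- the image of an edge -/
  path : P.G.E → List Q.G.E
  mapsTo : ∀ x ∈ P.X, vert x ∈ Q.X
  injOn : Set.InjOn vert P.X
  ne_nil : ∀ e, P.Touches e → path e ≠ []
  nodup : ∀ e, P.Touches e → (path e).Nodup
  chain : ∀ e, P.Touches e → (path e).IsChain fun a b =>
    Q.G.head a = Q.G.tail b ∧ Q.G.head a ∈ Q.X ∧ ∀ x ∈ P.X, vert x ≠ Q.G.head a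
  first_inner : ∀ e, P.G.tail e ∈ P.X → ∀ a ∈ (path e).head?, Q.G.tail a = vert (P.G.tail e)
  first_outer : ∀ e, P.G.tail e ∉ P.X → P.G.head e ∈ P.X → ∀ a ∈ (path e).head?,
    Q.G.tail a ∉ Q.X ∧ Q.G.head a ∈ Q.X ∧ Q.lab a = P.lab e
  last_inner : ∀ e, P.G.head e ∈ P.X → ∀ a ∈ (path e).getLast?, Q.G.head a = vert (P.G.head e)
  last_outer : ∀ e, P.G.tail e ∈ P.X → P.G.head e ∉ P.X → ∀ a ∈ (path e).getLast?,
    Q.G.tail a ∈ Q.X ∧ Q.G.head a ∉ Q.X ∧ Q.lab a = P.lab e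
  disjoint : ∀ e f, P.Touches e → P.Touches f → e ≠ f → List.Disjoint (path e) (path f)

/-- `P` is strongly immersed in `Q`, with matching labels. -/
def Immersed (P Q : Piece.{u, v} ι) : Prop := Nonempty (Immersion P Q)

theorem Immersed.refl (P : Piece.{u, v} ι) : P.Immersed P := by
  refine ⟨⟨id, fun e => [e], fun x hx => hx, fun x _ y _ h => h, ?_, ?_, ?_, ?_, ?_, ?_, ?_, ?_⟩⟩
  · simp
  · simp
  · simp
  · simp
  · intro e h1 h2 a ha
    obtain rfl : e = a := by simpa using ha
    exact ⟨h1, h2, rfl⟩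
  · simp
  · intro e h1 h2 a ha
    obtain rfl : e = a := by simpa using ha
    exact ⟨h1, h2, rfl⟩
  · intro e f _ _ h
    simpa using Ne.symm h

namespace Immersion

variable {P Q R : Piece.{u, v} ι}

theorem tail_mem (I : Immersion P Q) {e : P.G.E} (he : P.Touches e) {a : Q.G.E}
    (ha : a ∈ I.path e) : Q.G.tail a ∈ Q.X ∨
      (Q.G.tail a ∉ Q.X ∧ Q.G.head a ∈ Q.X ∧ P.G.tail e ∉ P.X ∧ Q.lab a = P.lab e) := by
  rcases (I.chain e he).head?_or_exists_rel ha with h | ⟨b, -, h1, h2, -⟩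
  · by_cases ht : P.G.tail e ∈ P.X
    · left
      rw [I.first_inner e ht a h]
      exact I.mapsTo _ ht
    · obtain ⟨h1, h2, h3⟩ := I.first_outer e ht (he.resolve_left ht) a h
      exact Or.inr ⟨h1, h2, ht, h3⟩
  · exact Or.inl (h1 ▸ h2)

theorem head_mem (I : Immersion P Q) {e : P.G.E} (he : P.Touches e) {a : Q.G.E}
    (ha : a ∈ I.path e) : Q.G.head a ∈ Q.X ∨
      (Q.G.head a ∉ Q.X ∧ Q.G.tail a ∈ Q.X ∧ P.G.head e ∉ P.X ∧ Q.lab a = P.lab e) := by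
  rcases (I.chain e he).getLast?_or_exists_rel ha with h | ⟨b, -, h1, h2, -⟩
  · by_cases ht : P.G.head e ∈ P.X
    · left
      rw [I.last_inner e ht a h]
      exact I.mapsTo _ ht
    · obtain ⟨h1, h2, h3⟩ := I.last_outer e (he.resolve_right ht) ht a h
      exact Or.inr ⟨h2, h1, ht, h3⟩
  · exact Or.inl h2

theorem touches (I : Immersion P Q) {e : P.G.E} (he : P.Touches e) {a : Q.G.E}
    (ha : a ∈ I.path e) : Q.Touches a :=
  (I.tail_mem he ha).imp id fun h => h.2.1

theorem head?_flatMap {α β : Type*} {f : α → List β} {l : List α} (h : ∀ a ∈ l, f a ≠ []) {b : β}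
    (hb : b ∈ (l.flatMap f).head?) : ∃ a ∈ l.head?, b ∈ (f a).head? := by
  cases l with
  | nil => simp at hb
  | cons a l =>
    refine ⟨a, rfl, ?_⟩
    rwa [List.flatMap_cons, List.head?_append_of_ne_nil _ (h a List.mem_cons_self)] at hb

theorem getLast?_flatMap {α β : Type*} {f : α → List β} {l : List α} (h : ∀ a ∈ l, f a ≠ [])
    {b : β} (hb : b ∈ (l.flatMap f).getLast?) : ∃ a ∈ l.getLast?, b ∈ (f a).getLast? := by
  rcases List.eq_nil_or_concat l with rfl | ⟨l, a, rfl⟩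
  · simp at hb
  · refine ⟨a, by simp, ?_⟩
    rw [List.concat_eq_append, List.flatMap_append, List.flatMap_singleton,
      List.getLast?_append_of_ne_nil _ (h a (by simp))] at hb
    exact hb

/-- The composition of two immersions of pieces. -/
def trans (I : Immersion P Q) (J : Immersion Q R) : Immersion P R where
  vert x := J.vert (I.vert x)
  path e := (I.path e).flatMap J.path
  mapsTo x hx := J.mapsTo _ (I.mapsTo x hx)
  injOn x hx y hy h := I.injOn hx hy (J.injOn (I.mapsTo x hx) (I.mapsTo y hy) h)
  ne_nil e he := by
    obtain ⟨a, ha⟩ := List.exists_mem_of_ne_nil _ (I.ne_nil e he)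
    intro h
    rw [List.flatMap_eq_nil_iff] at h
    exact J.ne_nil a (I.touches he ha) (h a ha)
  nodup e he := by
    rw [List.nodup_flatMap]
    refine ⟨fun a ha => J.nodup a (I.touches he ha), ?_⟩
    refine (I.nodup e he).imp_of_mem ?_
    intro a b ha hb hab
    exact J.disjoint a b (I.touches he ha) (I.touches he hb) hab
  chain e he := by
    have hne : ([] : List R.G.E) ∉ (I.path e).map J.path := by
      intro h
      obtain ⟨a, ha, h'⟩ := List.mem_map.mp h
      exact J.ne_nil a (I.touches he ha) h'
    rw [List.flatMap_def, List.isChain_flatten hne]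
    constructor
    · intro l hl
      obtain ⟨a, ha, rfl⟩ := List.mem_map.mp hl
      exact (J.chain a (I.touches he ha)).imp fun b c ⟨h1, h2, h3⟩ =>
        ⟨h1, h2, fun x hx => h3 _ (I.mapsTo x hx)⟩
    · rw [List.isChain_map]
      refine (I.chain e he).imp ?_
      rintro a b ⟨h1, h2, h3⟩ x hx y hy
      have hx' := J.last_inner a h2 x hx
      rw [hx', J.first_inner b (h1 ▸ h2) y hy, h1]
      refine ⟨rfl, J.mapsTo _ (h1 ▸ h2), fun z hz h => h3 z hz ?_⟩
      rw [h1]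
      exact J.injOn (I.mapsTo z hz) (h1 ▸ h2) h
  first_inner e he b hb := by
    obtain ⟨a, ha, hab⟩ := head?_flatMap (fun a ha => J.ne_nil a (I.touches (Or.inl he) ha)) hb
    have := I.first_inner e he a ha
    rw [← this]
    exact J.first_inner a (this ▸ I.mapsTo _ he) b hab
  first_outer e h1 h2 b hb := by
    obtain ⟨a, ha, hab⟩ := head?_flatMap (fun a ha => J.ne_nil a (I.touches (Or.inr h2) ha)) hb
    obtain ⟨a1, a2, a3⟩ := I.first_outer e h1 h2 a ha
    rw [← a3]
    exact J.first_outer a a1 a2 b hab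
  last_inner e he b hb := by
    obtain ⟨a, ha, hab⟩ := getLast?_flatMap (fun a ha => J.ne_nil a (I.touches (Or.inr he) ha)) hb
    have := I.last_inner e he a ha
    rw [← this]
    exact J.last_inner a (this ▸ I.mapsTo _ he) b hab
  last_outer e h1 h2 b hb := by
    obtain ⟨a, ha, hab⟩ := getLast?_flatMap (fun a ha => J.ne_nil a (I.touches (Or.inl h1) ha)) hb
    obtain ⟨a1, a2, a3⟩ := I.last_outer e h1 h2 a ha
    rw [← a3]
    exact J.last_outer a a1 a2 b hab
  disjoint e f he hf hef b hb hb' := by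
    obtain ⟨a, ha, hab⟩ := List.mem_flatMap.mp hb
    obtain ⟨c, hc, hcb⟩ := List.mem_flatMap.mp hb'
    by_cases hac : a = c
    · subst hac
      exact I.disjoint e f he hf hef ha hc
    · exact J.disjoint a c (I.touches he ha) (I.touches hf hc) hac hab hcb

end Immersion

theorem Immersed.trans {P Q R : Piece.{u, v} ι} (h : P.Immersed Q) (h' : Q.Immersed R) :
    P.Immersed R :=
  h.elim fun I => h'.elim fun J => ⟨I.trans J⟩

end Piece

namespace MultiDigraph

/-- The piece that consists of all of `G`. -/
def toPiece {ι : Type} (G : MultiDigraph.{u, v}) (lab : G.E → ι) : Piece.{u, v} ι where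
  G := G
  X := Set.univ
  lab := lab
  lab_inj e he := by simp [cut] at he

theorem isWalk_of_isChain (G : MultiDigraph.{u, v}) {p : List G.E} {x y : G.V} (hne : p ≠ [])
    (hc : p.IsChain fun a b => G.head a = G.tail b) (hx : ∀ a ∈ p.head?, G.tail a = x)
    (hy : ∀ a ∈ p.getLast?, G.head a = y) : G.IsWalk x p y := by
  induction p generalizing x with
  | nil => exact absurd rfl hne
  | cons a p ih =>
    refine ⟨hx a rfl, ?_⟩
    rw [List.isChain_cons] at hc
    cases p with
    | nil => exact hy a rfl
    | cons b p =>
      exact ih (by simp) hc.2 (fun c h => (hc.1 c h).symm)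
        fun c h => hy c (by rwa [List.getLast?_cons_cons])

theorem IsWalk.isChain {G : MultiDigraph.{u, v}} {p : List G.E} {x y : G.V} (h : G.IsWalk x p y)
    {Q : G.V → Prop} (hQ : ∀ a ∈ p.dropLast, Q (G.head a)) :
    (p.IsChain fun a b => G.head a = G.tail b ∧ Q (G.head a)) ∧ (∀ a ∈ p.head?, G.tail a = x) ∧
      ∀ a ∈ p.getLast?, G.head a = y := by
  induction p generalizing x with
  | nil => simp
  | cons a p ih =>
    obtain ⟨h1, h2⟩ := h
    cases p with
    | nil =>
      have h2 : G.head a = y := h2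
      refine ⟨List.isChain_singleton _, ?_, ?_⟩
      · simp [h1]
      · simp [h2]
    | cons b p =>
      obtain ⟨i1, i2, i3⟩ := ih h2 fun c hc => hQ c (by simp [hc])
      refine ⟨?_, by simp [h1], fun c hc => i3 c (by rwa [List.getLast?_cons_cons] at hc)⟩
      rw [List.isChain_cons]
      refine ⟨fun c hc => ⟨(i2 c hc).symm, hQ a (by simp)⟩, i1⟩

/-- The labels are arbitrary, since the whole digraph has no boundary edges. -/
theorem stronglyImmersed_iff {ι : Type} (G H : MultiDigraph.{u, v}) (lab : G.E → ι)
    (lab' : H.E → ι) : G.StronglyImmersed H ↔ (G.toPiece lab).Immersed (H.toPiece lab') := by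
  constructor
  · rintro ⟨I⟩
    have key := fun e => (I.isPath e).2.2.isChain (Q := fun y => ∀ x, I.vertex x ≠ y)
      fun a ha x hx => I.strong e x (List.mem_map.mpr ⟨a, ha, hx.symm⟩)
    exact ⟨{
      vert := I.vertex
      path := I.path
      mapsTo := fun _ _ => trivial
      injOn := fun x _ y _ h => I.vertex_injective h
      ne_nil := fun e _ => (I.isPath e).1
      nodup := fun e _ => (I.isPath e).2.1
      chain := fun e _ => (key e).1.imp fun a b h => ⟨h.1, trivial, fun x _ => h.2 x⟩
      first_inner := fun e _ a ha => (key e).2.1 a ha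
      first_outer := fun e h => absurd trivial h
      last_inner := fun e _ a ha => (key e).2.2 a ha
      last_outer := fun e _ h => absurd trivial h
      disjoint := fun e f _ _ hef => I.edge_disjoint e f hef }⟩
  · rintro ⟨I⟩
    refine ⟨⟨I.vert, I.path, fun x y h => I.injOn trivial trivial h, fun e => ?_, fun e f hef =>
      I.disjoint e f (Or.inl trivial) (Or.inl trivial) hef, fun e x hx => ?_⟩⟩
    · exact ⟨I.ne_nil e (Or.inl trivial), I.nodup e (Or.inl trivial),
        H.isWalk_of_isChain (I.ne_nil e (Or.inl trivial))
          ((I.chain e (Or.inl trivial)).imp fun _ _ h => h.1)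
          (I.first_inner e trivial) (I.last_inner e trivial)⟩
    · obtain ⟨a, ha, hax⟩ := List.mem_map.mp hx
      obtain ⟨b, -, -, h⟩ := (I.chain e (Or.inl trivial)).exists_rel_of_mem_dropLast ha
      exact h x trivial hax.symm

theorem StronglyImmersed.refl (G : MultiDigraph.{u, v}) : G.StronglyImmersed G :=
  (stronglyImmersed_iff G G (fun _ => ()) fun _ => ()).2 (Piece.Immersed.refl _)

theorem StronglyImmersed.trans {G H K : MultiDigraph.{u, v}} (h : G.StronglyImmersed H)
    (h' : H.StronglyImmersed K) : G.StronglyImmersed K := by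
  rw [stronglyImmersed_iff _ _ (fun _ => ()) fun _ => ()] at h h' ⊢
  exact h.trans h'

end MultiDigraph

/-! ### Gluing immersions of disjoint pieces -/

namespace Piece

variable {ι : Type}

/-- The list `p` is a suitable image for the edge `e` under an immersion of pieces with vertex
map `w`. -/
structure Realizes (P Q : Piece.{u, v} ι) (w : P.G.V → Q.G.V) (e : P.G.E) (p : List Q.G.E) :
    Prop where
  ne_nil : p ≠ []
  nodup : p.Nodup
  chain : p.IsChain fun a b =>
    Q.G.head a = Q.G.tail b ∧ Q.G.head a ∈ Q.X ∧ ∀ x ∈ P.X, w x ≠ Q.G.head a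
  first_inner : P.G.tail e ∈ P.X → ∀ a ∈ p.head?, Q.G.tail a = w (P.G.tail e)
  first_outer : P.G.tail e ∉ P.X → P.G.head e ∈ P.X → ∀ a ∈ p.head?,
    Q.G.tail a ∉ Q.X ∧ Q.G.head a ∈ Q.X ∧ Q.lab a = P.lab e
  last_inner : P.G.head e ∈ P.X → ∀ a ∈ p.getLast?, Q.G.head a = w (P.G.head e)
  last_outer : P.G.tail e ∈ P.X → P.G.head e ∉ P.X → ∀ a ∈ p.getLast?,
    Q.G.tail a ∈ Q.X ∧ Q.G.head a ∉ Q.X ∧ Q.lab a = P.lab e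

/-- The pairs of labels that the edges in the cuts of both `A` and `B` carry. -/
def pattern (G : MultiDigraph.{u, v}) (A B : Set G.V) (a b : G.E → ι) : Set (ι × ι) :=
  {c | ∃ e, e ∈ G.cut A ∧ e ∈ G.cut B ∧ (a e, b e) = c}

variable {G H : MultiDigraph.{u, v}} {A B : Set G.V} {A' B' : Set H.V} {a b : G.E → ι}
  {a' b' : H.E → ι} {hA : Set.InjOn a (G.cut A)} {hB : Set.InjOn b (G.cut B)}
  {hA' : Set.InjOn a' (H.cut A')} {hB' : Set.InjOn b' (H.cut B')}

/-- The images under two immersions into disjoint pieces share only boundary edges. -/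
theorem Immersion.mem_both (I : Immersion ⟨G, A, a, hA⟩ ⟨H, A', a', hA'⟩)
    (J : Immersion ⟨G, B, b, hB⟩ ⟨H, B', b', hB'⟩) (hd : Disjoint A' B') {e f : G.E}
    (he : G.tail e ∈ A ∨ G.head e ∈ A) (hf : G.tail f ∈ B ∨ G.head f ∈ B) {d : H.E}
    (hdI : d ∈ I.path e) (hdJ : d ∈ J.path f) :
    e ∈ G.cut A ∧ f ∈ G.cut B ∧ d ∈ H.cut A' ∧ d ∈ H.cut B' ∧ a' d = a e ∧ b' d = b f := by
  have i1 := I.tail_mem he hdI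
  have i2 := I.head_mem he hdI
  have j1 := J.tail_mem hf hdJ
  have j2 := J.head_mem hf hdJ
  have n1 : H.tail d ∈ A' → H.tail d ∉ B' := fun h => Set.disjoint_left.mp hd h
  have n2 : H.head d ∈ A' → H.head d ∉ B' := fun h => Set.disjoint_left.mp hd h
  simp only [MultiDigraph.cut, Set.mem_ofPred_eq]
  dsimp only at i1 i2 j1 j2
  rcases i1 with i1 | ⟨i1, i1', i1'', i1'''⟩
  · rcases j1 with j1 | ⟨j1, j1', j1'', j1'''⟩
    · exact absurd j1 (n1 i1)
    · rcases i2 with i2 | ⟨i2, i2', i2'', i2'''⟩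
      · exact absurd j1' (n2 i2)
      · exact ⟨Or.inl ⟨he.resolve_right i2'', i2''⟩, Or.inr ⟨j1'', hf.resolve_left j1''⟩,
          Or.inl ⟨i1, i2⟩, Or.inr ⟨j1, j1'⟩, i2''', j1'''⟩
  · rcases j2 with j2 | ⟨j2, j2', j2'', j2'''⟩
    · exact absurd j2 (n2 i1')
    · exact ⟨Or.inr ⟨i1'', he.resolve_left i1''⟩, Or.inl ⟨hf.resolve_right j2'', j2''⟩,
          Or.inr ⟨i1, i1'⟩, Or.inl ⟨j2', j2⟩, i1''', j2'''⟩

variable {X : Set G.V} {X' : Set H.V} {x : G.E → ι} {x' : H.E → ι} {hX : Set.InjOn x (G.cut X)}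
  {hX' : Set.InjOn x' (H.cut X')}

theorem Immersion.chain_glue (I : Immersion ⟨G, A, a, hA⟩ ⟨H, A', a', hA'⟩)
    (hXAB : X = A ∪ B) (hXAB' : X' = A' ∪ B') (hd : Disjoint A' B') {w : G.V → H.V}
    (hwA : ∀ y ∈ A, w y = I.vert y) (hwB : ∀ y ∈ B, w y ∈ B') {e : G.E}
    (he : G.tail e ∈ A ∨ G.head e ∈ A) : (I.path e).IsChain fun c d =>
      H.head c = H.tail d ∧ H.head c ∈ X' ∧ ∀ y ∈ X, w y ≠ H.head c := by
  subst hXAB hXAB'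
  refine (I.chain e he).imp ?_
  rintro c d ⟨h1, h2, h3⟩
  refine ⟨h1, Or.inl h2, ?_⟩
  rintro y (hy | hy)
  · rw [hwA y hy]
    exact h3 y hy
  · intro h
    exact Set.disjoint_left.mp hd h2 (h ▸ hwB y hy)

theorem Immersion.realizes_of_not_touches (I : Immersion ⟨G, A, a, hA⟩ ⟨H, A', a', hA'⟩)
    (hXAB : X = A ∪ B) (hXAB' : X' = A' ∪ B') (hd : Disjoint A' B') {w : G.V → H.V}
    (hwA : ∀ y ∈ A, w y = I.vert y) (hwB : ∀ y ∈ B, w y ∈ B')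
    (hpat : pattern G A X a x ⊆ pattern H A' X' a' x') {e : G.E}
    (he : G.tail e ∈ A ∨ G.head e ∈ A) (he' : ¬(G.tail e ∈ B ∨ G.head e ∈ B)) :
    Realizes ⟨G, X, x, hX⟩ ⟨H, X', x', hX'⟩ w e (I.path e) := by
  have hchain := I.chain_glue hXAB hXAB' hd hwA hwB he
  subst hXAB hXAB'
  rw [not_or] at he'
  refine ⟨I.ne_nil e he, I.nodup e he, hchain, ?_, ?_, ?_, ?_⟩
  · intro h c hc
    have h : G.tail e ∈ A := h.resolve_right he'.1
    rw [hwA _ h]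
    exact I.first_inner e h c hc
  · intro h1 h2 c hc
    have h1 : G.tail e ∉ A := fun h => h1 (Or.inl h)
    have h2 : G.head e ∈ A := h2.resolve_right he'.2
    obtain ⟨c1, c2, c3⟩ := I.first_outer e h1 h2 c hc
    dsimp only at c1 c2 c3
    obtain ⟨d, d1, d2, d3⟩ := hpat ⟨e, Or.inr ⟨h1, h2⟩,
      Or.inr ⟨fun h => h.elim h1 he'.1, Or.inl h2⟩, rfl⟩
    rw [Prod.mk.injEq] at d3
    obtain rfl : d = c := hA' d1 (Or.inr ⟨c1, c2⟩) (d3.1.trans c3.symm)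
    refine ⟨fun h => ?_, Or.inl c2, d3.2⟩
    exact d2.elim (fun h' => h'.2 (Or.inl c2)) fun h' => h'.1 h
  · intro h c hc
    have h : G.head e ∈ A := h.resolve_right he'.2
    rw [hwA _ h]
    exact I.last_inner e h c hc
  · intro h1 h2 c hc
    have h2 : G.head e ∉ A := fun h => h2 (Or.inl h)
    have h1 : G.tail e ∈ A := h1.resolve_right he'.1
    obtain ⟨c1, c2, c3⟩ := I.last_outer e h1 h2 c hc
    dsimp only at c1 c2 c3
    obtain ⟨d, d1, d2, d3⟩ := hpat ⟨e, Or.inl ⟨h1, h2⟩,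
      Or.inl ⟨Or.inl h1, fun h => h.elim h2 he'.2⟩, rfl⟩
    rw [Prod.mk.injEq] at d3
    obtain rfl : d = c := hA' d1 (Or.inl ⟨c1, c2⟩) (d3.1.trans c3.symm)
    refine ⟨Or.inl c1, fun h => ?_, d3.2⟩
    exact d2.elim (fun h' => h'.2 h) fun h' => h'.1 (Or.inl c1)

/-- The image of an edge from `A` to `B` is obtained by merging its images under the immersions of
`A` and of `B` at the boundary edge that they share. -/
theorem Immersion.exists_realizes_of_crosses (I : Immersion ⟨G, A, a, hA⟩ ⟨H, A', a', hA'⟩)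
    (J : Immersion ⟨G, B, b, hB⟩ ⟨H, B', b', hB'⟩)
    (hXAB : X = A ∪ B) (hXAB' : X' = A' ∪ B') (hd : Disjoint A B) (hd' : Disjoint A' B')
    {w : G.V → H.V} (hwA : ∀ y ∈ A, w y = I.vert y) (hwB : ∀ y ∈ B, w y = J.vert y)
    (hpat : pattern G A B a b ⊆ pattern H A' B' a' b') {e : G.E}
    (he : G.tail e ∈ A) (he' : G.head e ∈ B) :
    ∃ p, Realizes ⟨G, X, x, hX⟩ ⟨H, X', x', hX'⟩ w e p ∧ ∀ d ∈ p, d ∈ I.path e ∨ d ∈ J.path e := by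
  have hA0 : G.head e ∉ A := fun h => Set.disjoint_left.mp hd h he'
  have hB0 : G.tail e ∉ B := fun h => Set.disjoint_left.mp hd he h
  have hcA : e ∈ G.cut A := Or.inl ⟨he, hA0⟩
  have hcB : e ∈ G.cut B := Or.inr ⟨hB0, he'⟩
  obtain ⟨c, c1, c2, c3⟩ := hpat ⟨e, hcA, hcB, rfl⟩
  rw [Prod.mk.injEq] at c3
  have hwA' : ∀ y ∈ A, w y ∈ A' := fun y hy => (hwA y hy) ▸ I.mapsTo y hy
  have hwB' : ∀ y ∈ B, w y ∈ B' := fun y hy => (hwB y hy) ▸ J.mapsTo y hy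
  have hI := I.chain_glue hXAB hXAB' hd' hwA hwB' (Or.inl he)
  have hJ := J.chain_glue (hXAB.trans (Set.union_comm _ _)) (hXAB'.trans (Set.union_comm _ _))
    hd'.symm hwB hwA' (Or.inr he')
  -- Both images contain the edge `c`.
  obtain ⟨p, hp⟩ : ∃ p, I.path e = p ++ [c] := by
    have hne := I.ne_nil e (Or.inl he)
    refine ⟨(I.path e).dropLast, ?_⟩
    have hlast := List.getLast?_eq_some_getLast hne
    obtain ⟨l1, l2, l3⟩ := I.last_outer e he hA0 _ hlast
    have : (I.path e).getLast hne = c := hA' (Or.inl ⟨l1, l2⟩) c1 (l3.trans c3.1.symm)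
    conv_rhs => rw [← this]
    exact (List.dropLast_append_getLast hne).symm
  obtain ⟨q, hq⟩ : ∃ q, J.path e = c :: q := by
    have hne := J.ne_nil e (Or.inr he')
    refine ⟨(J.path e).tail, ?_⟩
    have hfirst := List.head?_eq_some_head hne
    obtain ⟨l1, l2, l3⟩ := J.first_outer e hB0 he' _ hfirst
    have : (J.path e).head hne = c := hB' (Or.inr ⟨l1, l2⟩) c2 (l3.trans c3.2.symm)
    conv_rhs => rw [← this]
    exact (List.cons_head_tail hne).symm
  have hpn := I.nodup e (Or.inl he)
  have hqn := J.nodup e (Or.inr he')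
  refine ⟨p ++ c :: q, ⟨by simp, ?_, ?_, ?_, ?_, ?_, ?_⟩, ?_⟩
  · refine List.Nodup.append ?_ (hq ▸ hqn) ?_
    · rw [hp] at hpn
      exact (List.nodup_append.mp hpn).1
    · intro d h1 h2
      obtain ⟨-, -, d1, -, d2, -⟩ := I.mem_both J hd' (Or.inl he) (Or.inr he') (d := d)
        (by rw [hp]; simp [h1]) (by rw [hq]; exact h2)
      obtain rfl : d = c := hA' d1 c1 (d2.trans c3.1.symm)
      rw [hp] at hpn
      exact List.disjoint_of_nodup_append hpn h1 (by simp)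
  · rw [hp] at hI
    rw [hq] at hJ
    have := List.IsChain.append_overlap (l₁ := p) (l₂ := [c]) (l₃ := q) hI (by simpa using hJ)
      (by simp)
    simpa using this
  · intro _ d hd
    rw [hwA _ he]
    refine I.first_inner e he d ?_
    rw [hp]
    cases p <;> simpa using hd
  · intro h
    exact absurd (show G.tail e ∈ X by rw [hXAB]; exact Or.inl he) h
  · intro _ d hd
    rw [hwB _ he']
    refine J.last_inner e he' d ?_
    rw [hq]
    rwa [List.getLast?_append_of_ne_nil _ (by simp)] at hd
  · intro _ h
    exact absurd (show G.head e ∈ X by rw [hXAB]; exact Or.inr he') h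
  · intro d hd
    rw [hp, hq]
    simp only [List.mem_append, List.mem_cons] at hd ⊢
    tauto

/-- Immersions of two disjoint pieces can be glued if the labels match. -/
theorem Immersed.glue (hI : Immersed ⟨G, A, a, hA⟩ ⟨H, A', a', hA'⟩)
    (hJ : Immersed ⟨G, B, b, hB⟩ ⟨H, B', b', hB'⟩)
    (hXAB : X = A ∪ B) (hXAB' : X' = A' ∪ B') (hd : Disjoint A B) (hd' : Disjoint A' B')
    (hAB : pattern G A B a b = pattern H A' B' a' b')
    (hAX : pattern G A X a x ⊆ pattern H A' X' a' x')
    (hBX : pattern G B X b x ⊆ pattern H B' X' b' x') :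
    Immersed ⟨G, X, x, hX⟩ ⟨H, X', x', hX'⟩ := by
  classical
  obtain ⟨I⟩ := hI
  obtain ⟨J⟩ := hJ
  let w : G.V → H.V := fun y => if y ∈ A then I.vert y else J.vert y
  have hwA : ∀ y ∈ A, w y = I.vert y := fun y hy => if_pos hy
  have hwB : ∀ y ∈ B, w y = J.vert y := fun y hy => if_neg (Set.disjoint_right.mp hd hy)
  have hwA' : ∀ y ∈ A, w y ∈ A' := fun y hy => (hwA y hy) ▸ I.mapsTo y hy
  have hwB' : ∀ y ∈ B, w y ∈ B' := fun y hy => (hwB y hy) ▸ J.mapsTo y hy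
  have hBA : pattern G B A b a ⊆ pattern H B' A' b' a' := by
    rintro _ ⟨e, h1, h2, rfl⟩
    have : (a e, b e) ∈ pattern H A' B' a' b' := hAB ▸ ⟨e, h2, h1, rfl⟩
    obtain ⟨d, d1, d2, d3⟩ := this
    rw [Prod.mk.injEq] at d3
    exact ⟨d, d2, d1, by rw [d3.1, d3.2]⟩
  have key : ∀ e, (G.tail e ∈ X ∨ G.head e ∈ X) → ∃ p,
      Realizes ⟨G, X, x, hX⟩ ⟨H, X', x', hX'⟩ w e p ∧ ∀ d ∈ p,
        ((G.tail e ∈ A ∨ G.head e ∈ A) ∧ d ∈ I.path e) ∨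
        ((G.tail e ∈ B ∨ G.head e ∈ B) ∧ d ∈ J.path e) := by
    intro e he
    by_cases tA : G.tail e ∈ A ∨ G.head e ∈ A
    · by_cases tB : G.tail e ∈ B ∨ G.head e ∈ B
      · rcases tA with hA1 | hA1
        · have hB1 := tB.resolve_left (Set.disjoint_left.mp hd hA1)
          obtain ⟨p, hp, hp'⟩ := I.exists_realizes_of_crosses (hX := hX) (hX' := hX') J hXAB hXAB'
            hd hd' hwA hwB hAB.subset hA1 hB1
          exact ⟨p, hp, fun d h => (hp' d h).imp (fun h => ⟨Or.inl hA1, h⟩) fun h => ⟨tB, h⟩⟩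
        · have hB1 := tB.resolve_right (Set.disjoint_left.mp hd hA1)
          obtain ⟨p, hp, hp'⟩ := J.exists_realizes_of_crosses (hX := hX) (hX' := hX') I
            (hXAB.trans (Set.union_comm _ _)) (hXAB'.trans (Set.union_comm _ _)) hd.symm hd'.symm
            hwB hwA hBA hB1 hA1
          exact ⟨p, hp, fun d h => (hp' d h).symm.imp (fun h => ⟨Or.inr hA1, h⟩) fun h => ⟨tB, h⟩⟩
      · exact ⟨_, I.realizes_of_not_touches hXAB hXAB' hd' hwA hwB' hAX tA tB,
          fun d h => Or.inl ⟨tA, h⟩⟩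
    · have tB : G.tail e ∈ B ∨ G.head e ∈ B := by
        rw [hXAB] at he
        exact he.imp (fun h => h.resolve_left fun h => tA (Or.inl h))
          fun h => h.resolve_left fun h => tA (Or.inr h)
      exact ⟨_, J.realizes_of_not_touches (hXAB.trans (Set.union_comm _ _))
        (hXAB'.trans (Set.union_comm _ _)) hd'.symm hwB hwA' hBX tB tA, fun d h => Or.inr ⟨tB, h⟩⟩
  choose! path hpath hmem using key
  have both : ∀ e f d, (G.tail e ∈ A ∨ G.head e ∈ A) → (G.tail f ∈ B ∨ G.head f ∈ B) →
      d ∈ I.path e → d ∈ J.path f → e = f := by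
    intro e f d he hf h1 h2
    obtain ⟨m1, m2, m3, m4, m5, m6⟩ := I.mem_both J hd' he hf h1 h2
    have : (a' d, b' d) ∈ pattern G A B a b := hAB ▸ ⟨d, m3, m4, rfl⟩
    obtain ⟨c, c1, c2, c3⟩ := this
    rw [Prod.mk.injEq] at c3
    exact (hA m1 c1 (m5.symm.trans c3.1.symm)).trans (hB c2 m2 (c3.2.trans m6))
  refine ⟨⟨w, path, ?_, ?_, fun e he => (hpath e he).ne_nil, fun e he => (hpath e he).nodup,
    fun e he => (hpath e he).chain, fun e he => (hpath e (Or.inl he)).first_inner he,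
    fun e h he => (hpath e (Or.inr he)).first_outer h he,
    fun e he => (hpath e (Or.inr he)).last_inner he,
    fun e he h => (hpath e (Or.inl he)).last_outer he h, ?_⟩⟩
  · intro y hy
    subst hXAB hXAB'
    exact hy.imp (hwA' y) (hwB' y)
  · subst hXAB
    rintro y (hy | hy) z (hz | hz) h
    · rw [hwA y hy, hwA z hz] at h
      exact I.injOn hy hz h
    · exact absurd (h ▸ hwA' y hy) (Set.disjoint_right.mp hd' (hwB' z hz))
    · exact absurd (h ▸ hwB' y hy) (Set.disjoint_left.mp hd' (hwA' z hz))
    · rw [hwB y hy, hwB z hz] at h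
      exact J.injOn hy hz h
  · intro e f he hf hef d h1 h2
    rcases hmem e he d h1 with ⟨e1, e2⟩ | ⟨e1, e2⟩ <;>
      rcases hmem f hf d h2 with ⟨f1, f2⟩ | ⟨f1, f2⟩
    · exact I.disjoint e f e1 f1 hef e2 f2
    · exact hef (both e f d e1 f1 e2 f2)
    · exact hef (both f e d f1 e1 f2 e2).symm
    · exact J.disjoint e f e1 f1 hef e2 f2

/-- A linkage between `F` and `X` turns into an immersion of pieces for suitable labels on `F`. -/
theorem exists_immersed_of_linked (hG : G.IsEulerian) {F : Set G.V}
    (hFX : F ⊆ X) (hle : G.outSize X ≤ G.outSize F)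
    (hmin : ∀ Y, F ⊆ Y → Y ⊆ X → G.outSize F ≤ G.outSize Y) :
    ∃ (y : G.E → ι) (hy : Set.InjOn y (G.cut F)), Immersed ⟨G, F, y, hy⟩ ⟨G, X, x, hX⟩ := by
  obtain ⟨p, p1, p2, p3, p4⟩ := hG.exists_linkage hFX hle hmin
  have hne : ∀ e, G.tail e ∈ F ∨ G.head e ∈ F → p e ≠ [] := by
    intro e he h
    by_cases h1 : G.tail e ∈ F
    · by_cases h2 : G.head e ∈ F
      · simp [p1 e h1 h2] at h
      · simpa [h] using (p2 e h1 h2).1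
    · simpa [h] using (p3 e h1 (he.resolve_left h1)).1
  -- The edge of the cut of `X` that the trail of an edge in the cut of `F` leads to.
  have : ∀ e, ∃ c, (G.tail e ∈ F → G.head e ∉ F → (p e).getLast? = some c) ∧
      (G.tail e ∉ F → G.head e ∈ F → (p e).head? = some c) := by
    intro e
    by_cases he : G.tail e ∈ F ∨ G.head e ∈ F
    · by_cases h1 : G.tail e ∈ F
      · exact ⟨_, fun _ _ => List.getLast?_eq_some_getLast (hne e he), fun h => absurd h1 h⟩
      · exact ⟨_, fun h => absurd h h1, fun _ _ => List.head?_eq_some_head (hne e he)⟩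
    · exact ⟨e, fun h => absurd (Or.inl h) he, fun _ h => absurd (Or.inr h) he⟩
  choose c hc1 hc2 using this
  have hcut : ∀ e ∈ G.cut F, c e ∈ p e ∧ c e ∈ G.cut X ∧ (G.tail e ∈ F ∨ G.head e ∈ F) := by
    rintro e (⟨h1, h2⟩ | ⟨h1, h2⟩)
    · have := hc1 e h1 h2
      exact ⟨List.mem_of_getLast? this, Or.inl ((p2 e h1 h2).2 _ this), Or.inl h1⟩
    · have := hc2 e h1 h2
      exact ⟨List.mem_of_head? this, Or.inr ((p3 e h1 h2).2 _ this), Or.inr h2⟩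
  refine ⟨fun e => x (c e), fun e he f hf hef => ?_, ⟨⟨id, p, fun y hy => hFX hy,
    fun y _ z _ h => h, hne, fun e he => (p4 e he).1, ?_, ?_, ?_, ?_, ?_,
    fun e f he hf hef => (p4 e he).2.2 f hf hef⟩⟩⟩
  · obtain ⟨e1, e2, e3⟩ := hcut e he
    obtain ⟨f1, f2, f3⟩ := hcut f hf
    by_contra hne
    exact (p4 e e3).2.2 f f3 hne e1 (hX e2 f2 hef ▸ f1)
  · intro e he
    refine (p4 e he).2.1.imp ?_
    rintro d d' ⟨h1, h2, h3⟩
    exact ⟨h1, h2, fun y hy h => h3 (h ▸ hy)⟩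
  · intro e h1 d hd
    by_cases h2 : G.head e ∈ F
    · obtain rfl : e = d := by simpa [p1 e h1 h2] using hd
      rfl
    · obtain rfl : e = d := by simpa [(p2 e h1 h2).1] using hd
      rfl
  · intro e h1 h2 d hd
    obtain ⟨d1, d2⟩ := (p3 e h1 h2).2 d hd
    have := hc2 e h1 h2
    rw [Option.mem_def.mp hd, Option.some_inj] at this
    exact ⟨d1, d2, by rw [this]⟩
  · intro e h1 d hd
    by_cases h2 : G.tail e ∈ F
    · obtain rfl : e = d := by simpa [p1 e h2 h1] using hd
      rfl
    · obtain rfl : e = d := by simpa [(p3 e h2 h1).1] using hd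
      rfl
  · intro e h1 h2 d hd
    obtain ⟨d1, d2⟩ := (p2 e h1 h2).2 d hd
    have := hc1 e h1 h2
    rw [Option.mem_def.mp hd, Option.some_inj] at this
    exact ⟨d1, d2, by rw [this]⟩

end Piece

/-! ### Cuts of Eulerian digraphs -/

namespace MultiDigraph

theorem IsEulerian.outSize_compl {G : MultiDigraph.{u, v}} (hG : G.IsEulerian) (X : Set G.V) :
    G.outSize Xᶜ = G.outSize X := by
  classical
  have := Fintype.ofFinite G.E
  obtain ⟨σ, hσ, -⟩ := exists_transitions G.tail G.head Set.univ X
    fun x _ => by simpa using hG.ncard_eq x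
  have h1 : {e | G.head e ∈ X}.ncard = {e | G.tail e ∈ X}.ncard := by
    have h2 := hσ.image_eq ▸ hσ.injOn.ncard_image
    simpa using h2.symm
  have h2 : G.outSize X + {e | G.head e ∈ X}.ncard = G.outSize Xᶜ + {e | G.tail e ∈ X}.ncard := by
    simp only [outSize, outCut, Set.ncard_setOf_eq_sum, ← Finset.sum_add_distrib]
    refine Finset.sum_congr rfl fun e _ => ?_
    by_cases a : G.tail e ∈ X <;> by_cases b : G.head e ∈ X <;> simp [a, b]
  omega

theorem IsEulerian.ncard_cut {G : MultiDigraph.{u, v}} (hG : G.IsEulerian) (X : Set G.V) :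
    (G.cut X).ncard = 2 * G.outSize X := by
  classical
  have := Fintype.ofFinite G.E
  have h : (G.cut X).ncard = G.outSize X + G.outSize Xᶜ := by
    simp only [outSize, outCut, cut, Set.ncard_setOf_eq_sum, ← Finset.sum_add_distrib]
    refine Finset.sum_congr rfl fun e _ => ?_
    by_cases a : G.tail e ∈ X <;> by_cases b : G.head e ∈ X <;> simp [a, b]
  rw [h, hG.outSize_compl]
  omega

/-- In an Eulerian digraph, the out-degree of sets is symmetric, hence posimodular. -/
theorem IsEulerian.isCutFunction {G : MultiDigraph.{u, v}} (hG : G.IsEulerian) :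
    SplitTree.IsCutFunction G.outSize where
  empty := by simp [outSize, outCut]
  sub := G.outSize_submodular
  pos A B := by
    have h := G.outSize_submodular A Bᶜ
    rw [← hG.outSize_compl (A ∪ Bᶜ), hG.outSize_compl B, Set.compl_union, compl_compl,
      Set.inter_comm Aᶜ] at h
    exact h

end MultiDigraph

/-! ### Well-quasi-ordering of labelled decomposed digraphs -/

theorem SplitTree.SubtreeVia.cons_left {α : Type*} {Q : Set α → Prop} {l r t : SplitTree α}
    (h : SubtreeVia Q (node l r) t) (hl : Q l.supp) : SubtreeVia Q l t := by
  induction h with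
  | refl h => exact .left (.refl hl) h
  | left _ h ih => exact .left ih h
  | right _ h ih => exact .right ih h

theorem SplitTree.SubtreeVia.cons_right {α : Type*} {Q : Set α → Prop} {l r t : SplitTree α}
    (h : SubtreeVia Q (node l r) t) (hr : Q r.supp) : SubtreeVia Q r t := by
  induction h with
  | refl h => exact .right (.refl hr) h
  | left _ h ih => exact .left ih h
  | right _ h ih => exact .right ih h

theorem SplitTree.SubtreeVia.isOptimal {α : Type*} {Q : Set α → Prop} {s t : SplitTree α}
    {f : Set α → ℕ} {w : ℕ} (h : SubtreeVia Q s t) (ht : t.IsOptimal f w) : s.IsOptimal f w := by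
  induction h with
  | refl h => exact ht
  | left _ h ih => exact ih ht.left
  | right _ h ih => exact ih ht.right

/-- The number of constructors. -/
def SplitTree.size {α : Type*} : SplitTree α → ℕ
  | empty => 1
  | leaf _ => 1
  | node l r => l.size + r.size + 1

/-- An Eulerian digraph with a split tree on a subset of its vertices. The edges without an end in
this subset are kept, so that subtrees are trees on the same digraph. -/
structure DecomposedDigraph where
  /-- the digraph -/
  G : MultiDigraph.{u, v}
  isEulerian : G.IsEulerian
  /-- the split tree -/
  tree : SplitTree G.V

/-- A decomposed digraph together with labels for the edges in the cut of its vertex set. -/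
structure LabelledDigraph (ι : Type) extends DecomposedDigraph.{u, v} where
  /-- the labels -/
  lab : G.E → ι
  lab_inj : Set.InjOn lab (G.cut tree.supp)

namespace LabelledDigraph

variable {ι : Type}

/-- The piece on the vertex set of the split tree. -/
abbrev toPiece (P : LabelledDigraph.{u, v} ι) : Piece.{u, v} ι :=
  ⟨P.G, P.tree.supp, P.lab, P.lab_inj⟩

/-- Immersion of the underlying pieces. -/
def Le (P Q : LabelledDigraph.{u, v} ι) : Prop := P.toPiece.Immersed Q.toPiece

instance : IsPreorder (LabelledDigraph.{u, v} ι) Le where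
  refl P := Piece.Immersed.refl P.toPiece
  trans _ _ _ := Piece.Immersed.trans

end LabelledDigraph

namespace DecomposedDigraph

/-- All labelled digraphs over members of `𝓐` form a well-quasi-order. -/
def LabelledWQO (ι : Type) (𝓐 : Set DecomposedDigraph.{u, v}) : Prop :=
  {P : LabelledDigraph.{u, v} ι | P.toDecomposedDigraph ∈ 𝓐}.PartiallyWellOrderedOn
    LabelledDigraph.Le

variable {ι : Type}

theorem LabelledWQO.mono {𝓐 𝓑 : Set DecomposedDigraph.{u, v}} (h : LabelledWQO ι 𝓑) (hs : 𝓐 ⊆ 𝓑) :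
    LabelledWQO ι 𝓐 := Set.PartiallyWellOrderedOn.mono h fun _ hP => hs hP

theorem LabelledWQO.union {𝓐 𝓑 : Set DecomposedDigraph.{u, v}} (h : LabelledWQO ι 𝓐)
    (h' : LabelledWQO ι 𝓑) : LabelledWQO ι (𝓐 ∪ 𝓑) :=
  (Set.PartiallyWellOrderedOn.union h h').mono fun _ hP => hP

/-- If a bad sequence is minimal, then the elements below and of smaller rank than one of its terms
form a well-quasi-order. -/
theorem _root_.Set.PartiallyWellOrderedOn.of_isMinBadSeq {α : Type*} {r : α → α → Prop}
    (htrans : ∀ a b c, r a b → r b c → r a c) {rk : α → ℕ} {s : Set α} {f : ℕ → α}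
    (hf : Set.PartiallyWellOrderedOn.IsBadSeq r s f)
    (hmin : ∀ n, Set.PartiallyWellOrderedOn.IsMinBadSeq r rk s n f) :
    {x | x ∈ s ∧ ∃ n, rk x < rk (f n) ∧ r x (f n)}.PartiallyWellOrderedOn r := by
  rw [Set.PartiallyWellOrderedOn.iff_forall_not_isBadSeq]
  rintro g ⟨hg, hbad⟩
  have hgs : ∀ i, g i ∈ s := fun i => (hg i).1
  choose n hn hr using fun i => (hg i).2
  obtain ⟨i₀, hi₀⟩ : ∃ i₀, ∀ i, n i₀ ≤ n i := by
    obtain ⟨_, ⟨i, rfl⟩, h⟩ :=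
      WellFounded.has_min (wellFounded_lt (α := ℕ)) (Set.range n) ⟨_, 0, rfl⟩
    exact ⟨i, fun j => not_lt.mp (h (n j) ⟨j, rfl⟩)⟩
  refine hmin (n i₀) (fun i => if i < n i₀ then f i else g (i₀ + (i - n i₀))) ?_ ?_ ⟨?_, ?_⟩
  · intro m hm
    simp [hm]
  · simpa using hn i₀
  · intro i
    dsimp only
    split_ifs
    exacts [hf.1 i, hgs _]
  · intro i j hij
    dsimp only
    split_ifs with h1 h2 h2
    · exact hf.2 i j hij
    · intro h
      exact hf.2 i _ (h1.trans_le (hi₀ _)) (htrans _ _ _ h (hr _))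
    · omega
    · exact hbad _ _ (by omega)

theorem exists_lt_eq_of_finite {κ : Type*} [Finite κ] (c : ℕ → κ) : ∃ m n, m < n ∧ c m = c n := by
  obtain ⟨m, n, hne, h⟩ := Finite.exists_ne_map_eq_of_infinite c
  rcases hne.lt_or_gt with hlt | hlt
  exacts [⟨m, n, hlt, h⟩, ⟨n, m, hlt, h.symm⟩]

theorem _root_.Piece.Immersed.relabel {G H : MultiDigraph.{u, v}} {A : Set G.V} {A' : Set H.V}
    {a : G.E → ι} {a' : H.E → ι} {hA : Set.InjOn a (G.cut A)} {hA' : Set.InjOn a' (H.cut A')}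
    (h : Piece.Immersed ⟨G, A, a, hA⟩ ⟨H, A', a', hA'⟩) (π : ι → ι) {b : G.E → ι} {b' : H.E → ι}
    (hB : Set.InjOn b (G.cut A)) (hB' : Set.InjOn b' (H.cut A'))
    (hab : ∀ e ∈ G.cut A, b e = π (a e)) (hab' : ∀ e ∈ H.cut A', b' e = π (a' e)) :
    Piece.Immersed ⟨G, A, b, hB⟩ ⟨H, A', b', hB'⟩ := by
  obtain ⟨I⟩ := h
  refine ⟨⟨I.vert, I.path, I.mapsTo, I.injOn, I.ne_nil, I.nodup, I.chain, I.first_inner, ?_,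
    I.last_inner, ?_, I.disjoint⟩⟩
  · intro e h1 h2 c hc
    obtain ⟨c1, c2, c3⟩ := I.first_outer e h1 h2 c hc
    refine ⟨c1, c2, ?_⟩
    have := hab e (Or.inr ⟨h1, h2⟩)
    have := hab' c (Or.inr ⟨c1, c2⟩)
    simp_all
  · intro e h1 h2 c hc
    obtain ⟨c1, c2, c3⟩ := I.last_outer e h1 h2 c hc
    refine ⟨c1, c2, ?_⟩
    have := hab e (Or.inl ⟨h1, h2⟩)
    have := hab' c (Or.inl ⟨c1, c2⟩)
    simp_all

/-- For the well-quasi-ordering, it suffices to consider one labelling of every digraph, as any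
other one is obtained by one of finitely many maps of the labels. -/
theorem labelledWQO_of_exists [Finite ι] {𝓐 : Set DecomposedDigraph.{u, v}}
    {S : Set (LabelledDigraph.{u, v} ι)} (hS : S.PartiallyWellOrderedOn LabelledDigraph.Le)
    (h : ∀ D ∈ 𝓐, ∃ lab hlab, (⟨D, lab, hlab⟩ : LabelledDigraph.{u, v} ι) ∈ S) :
    LabelledWQO ι 𝓐 := by
  rw [LabelledWQO, Set.partiallyWellOrderedOn_iff_exists_lt]
  intro g hg
  choose lab hlab hmem using fun n => h _ (hg n)
  obtain ⟨φ, hφ⟩ := hS.exists_monotone_subseq hmem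
  have : ∀ n, ∃ π : ι → ι, ∀ e ∈ (g n).G.cut (g n).tree.supp, (g n).lab e = π (lab n e) := by
    intro n
    rcases isEmpty_or_nonempty ((g n).G.E) with hE | hE
    · exact ⟨id, fun e => hE.elim e⟩
    · refine ⟨fun i => (g n).lab (Function.invFunOn (lab n) ((g n).G.cut (g n).tree.supp) i),
        fun e he => ?_⟩
      dsimp only
      rw [(hlab n).leftInvOn_invFunOn he]
  choose π hπ using this
  obtain ⟨m, n, hmn, hπmn⟩ := exists_lt_eq_of_finite fun n => π (φ n)
  refine ⟨φ m, φ n, φ.strictMono hmn, ?_⟩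
  exact (hφ m n hmn.le).relabel (π (φ m)) _ _ (hπ _) (by simpa only [hπmn] using hπ (φ n))

theorem exists_label [Finite ι] [Nonempty ι] {w : ℕ} (hw : 2 * w ≤ Nat.card ι)
    (D : DecomposedDigraph.{u, v}) {X : Set D.G.V} (hX : D.G.outSize X ≤ w) :
    ∃ lab : D.G.E → ι, Set.InjOn lab (D.G.cut X) := by
  have h : (D.G.cut X).encard ≤ (Set.univ : Set ι).encard := by
    rw [← (Set.toFinite (D.G.cut X)).cast_ncard_eq, ← (Set.toFinite Set.univ).cast_ncard_eq,
      D.isEulerian.ncard_cut, Set.ncard_univ, Nat.cast_le]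
    omega
  obtain ⟨f, -, hf⟩ := (Set.toFinite (D.G.cut X)).exists_injOn_of_encard_le h
  exact ⟨f, hf⟩

/-- If the branches of the trees come from a well-quasi-ordered class, then so do the trees: by
Dickson's lemma, two terms of a sequence have comparable left branches, comparable right branches
and the same pattern of labels, so that the immersions of the branches can be glued. -/
theorem LabelledWQO.node [Finite ι] [Nonempty ι] {𝓐 : Set DecomposedDigraph.{u, v}}
    (h : LabelledWQO ι 𝓐) {w : ℕ} (hw : 2 * w ≤ Nat.card ι) :
    LabelledWQO ι {D | D.tree.IsOptimal D.G.outSize w ∧ ∃ l r, D.tree = .node l r ∧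
      ⟨D.G, D.isEulerian, l⟩ ∈ 𝓐 ∧ ⟨D.G, D.isEulerian, r⟩ ∈ 𝓐} := by
  rw [LabelledWQO, Set.partiallyWellOrderedOn_iff_exists_lt]
  intro g hg
  choose hopt l r htree hl hr using hg
  have hsupp : ∀ n, (g n).tree.supp = (l n).supp ∪ (r n).supp := fun n => by
    rw [htree n, SplitTree.supp]
  have hdisj : ∀ n, Disjoint (l n).supp (r n).supp := fun n => by
    have := (hopt n).proper
    rw [htree n] at this
    exact this.1
  choose labl hlabl using fun n => exists_label hw (g n).toDecomposedDigraph (X := (l n).supp)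
    ((hopt n).width _ (by rw [htree n]; exact Or.inr (Or.inl (l n).supp_mem_displayed)))
  choose labr hlabr using fun n => exists_label hw (g n).toDecomposedDigraph (X := (r n).supp)
    ((hopt n).width _ (by rw [htree n]; exact Or.inr (Or.inr (r n).supp_mem_displayed)))
  let gl : ℕ → LabelledDigraph ι := fun n => ⟨⟨(g n).G, (g n).isEulerian, l n⟩, labl n, hlabl n⟩
  let gr : ℕ → LabelledDigraph ι := fun n => ⟨⟨(g n).G, (g n).isEulerian, r n⟩, labr n, hlabr n⟩
  obtain ⟨φ, hφ⟩ := Set.PartiallyWellOrderedOn.exists_monotone_subseq h (f := gl) hl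
  obtain ⟨ψ, hψ⟩ := Set.PartiallyWellOrderedOn.exists_monotone_subseq h (f := gr ∘ φ)
    fun n => hr (φ n)
  obtain ⟨m, n, hmn, hpat⟩ := exists_lt_eq_of_finite fun i =>
    (Piece.pattern (g (φ (ψ i))).G (l (φ (ψ i))).supp (r (φ (ψ i))).supp (labl _) (labr _),
      Piece.pattern (g (φ (ψ i))).G (l (φ (ψ i))).supp (g (φ (ψ i))).tree.supp (labl _) (g _).lab,
      Piece.pattern (g (φ (ψ i))).G (r (φ (ψ i))).supp (g (φ (ψ i))).tree.supp (labr _) (g _).lab)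
  simp only [Prod.mk.injEq] at hpat
  refine ⟨φ (ψ m), φ (ψ n), φ.strictMono (ψ.strictMono hmn), ?_⟩
  exact Piece.Immersed.glue (hφ _ _ (ψ.strictMono hmn).le) (hψ _ _ hmn.le) (hsupp _) (hsupp _)
    (hdisj _) (hdisj _) hpat.1 hpat.2.1.subset hpat.2.2.subset

theorem labelledWQO_empty : LabelledWQO ι {D : DecomposedDigraph.{u, v} | D.tree = .empty} := by
  rw [LabelledWQO, Set.partiallyWellOrderedOn_iff_exists_lt]
  intro g hg
  have hX : ∀ n x, x ∉ (g n).tree.supp := fun n x => by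
    rw [hg n]
    exact fun h => h
  -- A map between the vertex sets is needed even though the pieces have no vertices.
  obtain ⟨m, n, hmn, hne⟩ := exists_lt_eq_of_finite fun n => Nonempty (g n).G.V
  obtain ⟨w⟩ : Nonempty ((g m).G.V → (g n).G.V) := by
    by_cases h : Nonempty (g n).G.V
    · exact h.map fun x _ => x
    · rw [← hne, not_nonempty_iff] at h
      exact ⟨fun x => h.elim x⟩
  refine ⟨m, n, hmn, ⟨⟨w, fun _ => [], fun x hx => absurd hx (hX m x),
    fun x hx => absurd hx (hX m x), fun e he => absurd he ?_, by simp, by simp, by simp, by simp,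
    by simp, by simp, by simp⟩⟩⟩
  exact fun h => h.elim (hX m _) (hX m _)

/-- Pieces with a single vertex: the immersion is determined by the sets of labels of the edges that
leave and enter the vertex and by the number of loops. -/
theorem labelledWQO_leaf [Finite ι] :
    LabelledWQO ι {D : DecomposedDigraph.{u, v} | ∃ x, D.tree = .leaf x} := by
  rw [LabelledWQO, Set.partiallyWellOrderedOn_iff_exists_lt]
  intro g hg
  choose x hx using hg
  have hsupp : ∀ n, (g n).tree.supp = {x n} := fun n => by rw [hx n, SplitTree.supp]
  let loops : ∀ n, Set (g n).G.E := fun n => {e | (g n).G.tail e = x n ∧ (g n).G.head e = x n}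
  let outs : ∀ n, Set (g n).G.E := fun n => {e | (g n).G.tail e = x n ∧ (g n).G.head e ≠ x n}
  let ins : ∀ n, Set (g n).G.E := fun n => {e | (g n).G.tail e ≠ x n ∧ (g n).G.head e = x n}
  obtain ⟨φ, hφ⟩ := (wellQuasiOrdered_le (α := ℕ)).exists_monotone_subseq fun n => (loops n).ncard
  obtain ⟨m, n, hmn, hlab⟩ := exists_lt_eq_of_finite fun i =>
    ((g (φ i)).lab '' outs (φ i), (g (φ i)).lab '' ins (φ i))
  simp only [Prod.mk.injEq] at hlab
  refine ⟨φ m, φ n, φ.strictMono hmn, ?_⟩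
  have hloops := hφ m n hmn.le
  generalize φ m = i at *
  generalize φ n = j at *
  have hcard : Nat.card (loops i) ≤ Nat.card (loops j) := hloops
  obtain ⟨f⟩ : Nonempty (loops i ↪ loops j) := by
    have := Fintype.ofFinite (loops i)
    have := Fintype.ofFinite (loops j)
    rw [Nat.card_eq_fintype_card, Nat.card_eq_fintype_card] at hcard
    exact Function.Embedding.nonempty_of_card_le hcard
  have key : ∀ e, ∃ p : List (g j).G.E, (∀ h : e ∈ loops i, p = [(f ⟨e, h⟩ : (g j).G.E)]) ∧
      (e ∈ outs i → ∃ c ∈ outs j, (g j).lab c = (g i).lab e ∧ p = [c]) ∧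
      (e ∈ ins i → ∃ c ∈ ins j, (g j).lab c = (g i).lab e ∧ p = [c]) := by
    intro e
    by_cases h1 : (g i).G.tail e = x i <;> by_cases h2 : (g i).G.head e = x i
    · exact ⟨[(f ⟨e, h1, h2⟩ : (g j).G.E)], fun _ => rfl, fun h => absurd h2 h.2,
        fun h => absurd h1 h.1⟩
    · have : (g i).lab e ∈ (g j).lab '' outs j := hlab.1 ▸ ⟨e, ⟨h1, h2⟩, rfl⟩
      obtain ⟨c, hc, hc'⟩ := this
      exact ⟨[c], fun h => absurd h.2 h2, fun _ => ⟨c, hc, hc', rfl⟩, fun h => absurd h1 h.1⟩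
    · have : (g i).lab e ∈ (g j).lab '' ins j := hlab.2 ▸ ⟨e, ⟨h1, h2⟩, rfl⟩
      obtain ⟨c, hc, hc'⟩ := this
      exact ⟨[c], fun h => absurd h.1 h1, fun h => absurd h.1 h1, fun _ => ⟨c, hc, hc', rfl⟩⟩
    · exact ⟨[], fun h => absurd h.1 h1, fun h => absurd h.1 h1, fun h => absurd h.2 h2⟩
  choose p p1 p2 p3 using key
  have hti : ∀ y, y ∈ (g i).tree.supp ↔ y = x i := fun y => by rw [hsupp i, Set.mem_singleton_iff]
  have htj : ∀ y, y ∈ (g j).tree.supp ↔ y = x j := fun y => by rw [hsupp j, Set.mem_singleton_iff]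
  have hcut : ∀ e, e ∈ outs i ∨ e ∈ ins i → e ∈ (g i).G.cut (g i).tree.supp := by
    rintro e (⟨h1, h2⟩ | ⟨h1, h2⟩)
    · exact Or.inl ⟨(hti _).2 h1, fun h => h2 ((hti _).1 h)⟩
    · exact Or.inr ⟨fun h => h1 ((hti _).1 h), (hti _).2 h2⟩
  have hsing : ∀ e, (g i).G.tail e = x i ∨ (g i).G.head e = x i → ∃ c, p e = [c] ∧
      ((∃ h : e ∈ loops i, c = f ⟨e, h⟩) ∧ c ∈ loops j ∨
        e ∈ outs i ∧ c ∈ outs j ∧ (g j).lab c = (g i).lab e ∨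
        e ∈ ins i ∧ c ∈ ins j ∧ (g j).lab c = (g i).lab e) := by
    intro e he
    by_cases h1 : (g i).G.tail e = x i <;> by_cases h2 : (g i).G.head e = x i
    · exact ⟨_, p1 e ⟨h1, h2⟩, Or.inl ⟨⟨⟨h1, h2⟩, rfl⟩, (f ⟨e, ⟨h1, h2⟩⟩).2⟩⟩
    · obtain ⟨c, c1, c2, c3⟩ := p2 e ⟨h1, h2⟩
      exact ⟨c, c3, Or.inr (Or.inl ⟨⟨h1, h2⟩, c1, c2⟩)⟩
    · obtain ⟨c, c1, c2, c3⟩ := p3 e ⟨h1, h2⟩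
      exact ⟨c, c3, Or.inr (Or.inr ⟨⟨h1, h2⟩, c1, c2⟩)⟩
    · exact absurd he (by simp [h1, h2])
  have htouch : ∀ e, (g i).toPiece.Touches e → (g i).G.tail e = x i ∨ (g i).G.head e = x i :=
    fun e he => he.imp (hti _).1 (hti _).1
  refine ⟨⟨fun _ => x j, p, fun _ _ => (htj _).2 rfl, ?_, ?_, ?_, ?_, ?_, ?_, ?_, ?_, ?_⟩⟩
  · intro y hy z hz _
    exact ((hti _).1 hy).trans ((hti _).1 hz).symm
  · intro e he
    obtain ⟨c, hc, -⟩ := hsing e (htouch e he)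
    simp [hc]
  · intro e he
    obtain ⟨c, hc, -⟩ := hsing e (htouch e he)
    simp [hc]
  · intro e he
    obtain ⟨c, hc, -⟩ := hsing e (htouch e he)
    simp [hc]
  · intro e he a ha
    have he : (g i).G.tail e = x i := (hti _).1 he
    obtain ⟨c, hc, h⟩ := hsing e (Or.inl he)
    rw [hc, List.head?_cons, Option.mem_some_iff] at ha
    subst ha
    rcases h with ⟨-, h⟩ | ⟨-, h, -⟩ | ⟨h, -⟩
    exacts [h.1, h.1, absurd he h.1]
  · intro e he he' a ha
    have he : (g i).G.tail e ≠ x i := fun h => he ((hti _).2 h)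
    have he' : (g i).G.head e = x i := (hti _).1 he'
    obtain ⟨c, c1, c2, c3⟩ := p3 e ⟨he, he'⟩
    rw [c3, List.head?_cons, Option.mem_some_iff] at ha
    subst ha
    exact ⟨fun h => c1.1 ((htj _).1 h), (htj _).2 c1.2, c2⟩
  · intro e he a ha
    have he : (g i).G.head e = x i := (hti _).1 he
    obtain ⟨c, hc, h⟩ := hsing e (Or.inr he)
    rw [hc, List.getLast?_singleton, Option.mem_some_iff] at ha
    subst ha
    rcases h with ⟨-, h⟩ | ⟨h, -⟩ | ⟨-, h, -⟩
    exacts [h.2, absurd he h.2, h.2]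
  · intro e he he' a ha
    have he : (g i).G.tail e = x i := (hti _).1 he
    have he' : (g i).G.head e ≠ x i := fun h => he' ((hti _).2 h)
    obtain ⟨c, c1, c2, c3⟩ := p2 e ⟨he, he'⟩
    rw [c3, List.getLast?_singleton, Option.mem_some_iff] at ha
    subst ha
    exact ⟨(htj _).2 c1.1, fun h => c1.2 ((htj _).1 h), c2⟩
  · intro e e' he he' hne
    obtain ⟨c, hc, h⟩ := hsing e (htouch e he)
    obtain ⟨c', hc', h'⟩ := hsing e' (htouch e' he')
    rw [hc, hc', List.disjoint_singleton, List.mem_singleton]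
    rintro rfl
    refine hne ?_
    have hinj : (e ∈ outs i ∨ e ∈ ins i) → (e' ∈ outs i ∨ e' ∈ ins i) →
        (g j).lab c' = (g i).lab e → (g j).lab c' = (g i).lab e' → e = e' :=
      fun h1 h2 h3 h4 => (g i).lab_inj (hcut e h1) (hcut e' h2) (h3.symm.trans h4)
    rcases h with ⟨⟨h1, h2⟩, h3⟩ | ⟨h1, h2, h3⟩ | ⟨h1, h2, h3⟩ <;>
      rcases h' with ⟨⟨k1, k2⟩, k3⟩ | ⟨k1, k2, k3⟩ | ⟨k1, k2, k3⟩
    · exact congrArg Subtype.val (f.injective (Subtype.ext (h2.symm.trans k2)))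
    · exact absurd h3.2 k2.2
    · exact absurd h3.1 k2.1
    · exact absurd k3.2 h2.2
    · exact hinj (Or.inl h1) (Or.inl k1) h3 k3
    · exact absurd h2.1 k2.1
    · exact absurd k3.1 h2.1
    · exact absurd k2.1 h2.1
    · exact hinj (Or.inr h1) (Or.inr k1) h3 k3

/-- The split tree is composed of atoms from `𝓛` by nodes at which the cut has at least `j`
edges in each direction. -/
inductive Built (G : MultiDigraph.{u, v}) (hG : G.IsEulerian) (j : ℕ)
    (𝓛 : Set DecomposedDigraph.{u, v}) : SplitTree G.V → Prop
  | atom {t : SplitTree G.V} : ⟨G, hG, t⟩ ∈ 𝓛 → Built G hG j 𝓛 t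
  | node {l r : SplitTree G.V} : j ≤ G.outSize (l.supp ∪ r.supp) → Built G hG j 𝓛 l →
      Built G hG j 𝓛 r → Built G hG j 𝓛 (.node l r)

/-- The digraphs with an optimal split tree of width at most `w` that is composed of atoms
from `𝓛` by nodes at which the cut has at least `j` edges in each direction. -/
def builtSet (w j : ℕ) (𝓛 : Set DecomposedDigraph.{u, v}) : Set DecomposedDigraph.{u, v} :=
  {D | D.tree.IsOptimal D.G.outSize w ∧ Built D.G D.isEulerian j 𝓛 D.tree}

/-- A proper subtree at which the cut has `j` edges in each direction, the least number on the path
to the root, is immersed in the whole, as optimal split trees are linked. -/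
theorem exists_immersed_subtree {G : MultiDigraph.{u, v}} (hG : G.IsEulerian) {w j : ℕ}
    {s t : SplitTree G.V} (ht : t.IsOptimal G.outSize w)
    (hst : SplitTree.SubtreeVia (fun A => j ≤ G.outSize A) s t) (hs : G.outSize s.supp = j)
    (htj : G.outSize t.supp = j) (x : G.E → ι) (hx : Set.InjOn x (G.cut t.supp)) :
    ∃ (y : G.E → ι) (hy : Set.InjOn y (G.cut s.supp)),
      Piece.Immersed ⟨G, s.supp, y, hy⟩ ⟨G, t.supp, x, hx⟩ := by
  refine Piece.exists_immersed_of_linked hG hst.supp_subset (by omega) fun Y h1 h2 => ?_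
  rw [hs]
  cases j with
  | zero => exact Nat.zero_le _
  | succ j => exact ht.linked hG.isCutFunction hst h1 h2

/-- Downward induction on `j`. For the digraphs with exactly `j` edges in each direction, the proper
subtrees of a minimal bad sequence that are cut off by `j` edges may serve as further atoms. -/
theorem LabelledWQO.built [Finite ι] [Nonempty ι] {w : ℕ} (hw : 2 * w ≤ Nat.card ι) (n j : ℕ)
    (hj : w < j + n) {𝓛 : Set DecomposedDigraph.{u, v}} (h𝓛 : LabelledWQO ι 𝓛) :
    LabelledWQO ι (builtSet w j 𝓛) := by
  induction n generalizing j 𝓛 with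
  | zero =>
    refine h𝓛.mono ?_
    rintro ⟨G, hG, t⟩ ⟨h1, h2⟩
    dsimp only at h1 h2
    cases h2 with
    | atom h => exact h
    | node h => exact absurd (h1.width _ (Or.inl rfl)) (by omega)
  | succ n ih =>
    let 𝓒 : Set DecomposedDigraph := {D | D ∈ builtSet w j 𝓛 ∧ D.G.outSize D.tree.supp = j}
    have h𝓒 : LabelledWQO ι 𝓒 := by
      rw [LabelledWQO, Set.PartiallyWellOrderedOn.iff_not_exists_isMinBadSeq fun P => P.tree.size]
      rintro ⟨f, hbad, hmin⟩
      have hS := Set.PartiallyWellOrderedOn.of_isMinBadSeq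
        (r := LabelledDigraph.Le) (fun _ _ _ h h' => Piece.Immersed.trans h h') hbad hmin
      let 𝓓 : Set DecomposedDigraph := {D | ∃ lab hlab,
        (⟨D, lab, hlab⟩ : LabelledDigraph ι) ∈ {P : LabelledDigraph ι | P ∈
          {P : LabelledDigraph ι | P.toDecomposedDigraph ∈ 𝓒} ∧
            ∃ n, P.tree.size < (f n).tree.size ∧ P.Le (f n)}}
      have h𝓓 : LabelledWQO ι 𝓓 := labelledWQO_of_exists hS fun D hD => hD
      have hnode := (ih (j + 1) (by omega) (h𝓛.union h𝓓)).node hw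
      obtain ⟨a, b, hab, hr⟩ := (Set.PartiallyWellOrderedOn.union h𝓛 hnode).exists_lt (f := f) <| by
        intro i
        obtain ⟨⟨hopt, hbuilt⟩, hlevel⟩ := hbad.1 i
        -- Below the root, subtrees at which the cut has size `j` are turned into atoms.
        have down : ∀ s, Built (f i).G (f i).isEulerian j 𝓛 s → s.size < (f i).tree.size →
            (j ≤ (f i).G.outSize s.supp →
              SplitTree.SubtreeVia (fun A => j ≤ (f i).G.outSize A) s (f i).tree) →
            Built (f i).G (f i).isEulerian (j + 1) (𝓛 ∪ 𝓓) s := by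
          intro s hs
          induction hs with
          | atom h => exact fun _ _ => .atom (Or.inl h)
          | @node l r hjs hl hr ihl ihr =>
            intro hsize hpath
            have hpath := hpath hjs
            rcases hjs.eq_or_lt with heq | hlt
            · refine .atom (Or.inr ?_)
              obtain ⟨y, hy, himm⟩ := exists_immersed_subtree (f i).isEulerian hopt hpath heq.symm
                hlevel (f i).lab (f i).lab_inj
              exact ⟨y, hy, ⟨⟨hpath.isOptimal hopt, .node hjs hl hr⟩, heq.symm⟩, i, hsize, himm⟩
            · refine .node hlt (ihl ?_ fun h => hpath.cons_left h)
                (ihr ?_ fun h => hpath.cons_right h)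
              all_goals
                rw [SplitTree.size] at hsize
                omega
        generalize hT : (f i).tree = T at hopt hbuilt hlevel down
        cases hbuilt with
        | atom h =>
          left
          rw [← hT] at h
          exact h
        | @node l r hjs hl hr =>
          right
          have hroot := SplitTree.SubtreeVia.refl (Q := fun A => j ≤ (f i).G.outSize A)
            (s := .node l r) hjs
          refine ⟨hT ▸ hopt, l, r, hT, ⟨hopt.left, down l hl ?_ fun h => hroot.cons_left h⟩,
            ⟨hopt.right, down r hr ?_ fun h => hroot.cons_right h⟩⟩
          all_goals
            rw [SplitTree.size]
            omega
      exact hbad.2 a b hab hr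
    refine (ih (j + 1) (by omega) (h𝓛.union h𝓒)).mono ?_
    rintro ⟨G, hG, t⟩ ⟨hopt, hbuilt⟩
    refine ⟨hopt, ?_⟩
    dsimp only at hopt hbuilt ⊢
    induction hbuilt with
    | atom h => exact .atom (Or.inl h)
    | node hjs hl hr ihl ihr =>
      rcases hjs.eq_or_lt with heq | hlt
      · exact .atom (Or.inr ⟨⟨hopt, .node hjs hl hr⟩, heq.symm⟩)
      · exact .node hlt (ihl hopt.left) (ihr hopt.right)

/-- Eulerian digraphs with optimal split trees of bounded width are well-quasi-ordered. -/
theorem labelledWQO_isOptimal [Finite ι] [Nonempty ι] {w : ℕ} (hw : 2 * w ≤ Nat.card ι) :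
    LabelledWQO ι {D : DecomposedDigraph.{u, v} | D.tree.IsOptimal D.G.outSize w} := by
  refine (LabelledWQO.built hw (w + 1) 0 (by omega)
    (labelledWQO_empty.union labelledWQO_leaf)).mono ?_
  rintro ⟨G, hG, t⟩ hopt
  refine ⟨hopt, ?_⟩
  dsimp only
  clear hopt
  induction t with
  | empty => exact .atom (Or.inl rfl)
  | leaf x => exact .atom (Or.inr ⟨x, rfl⟩)
  | node l r hl hr => exact .node (Nat.zero_le _) hl hr

end DecomposedDigraph

/-- Eulerian digraphs with split trees of bounded width are well-quasi-ordered by strong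
immersion. -/
theorem MultiDigraph.partiallyWellOrderedOn_of_splitTree (w : ℕ) :
    {G : MultiDigraph.{u, v} | G.IsEulerian ∧ ∃ t : SplitTree G.V, t.supp = Set.univ ∧ t.Proper ∧
      t.WidthLE G.outSize w}.PartiallyWellOrderedOn MultiDigraph.StronglyImmersed := by
  rw [Set.partiallyWellOrderedOn_iff_exists_lt]
  intro g hg
  choose hG t ht hp hw using hg
  choose t' ht' hopt using fun n => SplitTree.exists_isOptimal (hp n) (hw n)
  have hcut : ∀ n e, e ∉ (g n).cut (t' n).supp := by
    intro n e he
    rw [ht' n, ht n] at he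
    simp [cut] at he
  obtain ⟨m, n, hmn, h⟩ := (DecomposedDigraph.labelledWQO_isOptimal (ι := Fin (2 * w + 1)) (w := w)
    (by simp)).exists_lt (f := fun n => ⟨⟨g n, hG n, t' n⟩, fun _ => 0,
      fun e he => absurd he (hcut n e)⟩) hopt
  refine ⟨m, n, hmn, ?_⟩
  rw [stronglyImmersed_iff _ _ (fun _ => (0 : Fin (2 * w + 1))) fun _ => 0]
  obtain ⟨I⟩ := h
  have hX : ∀ i, (t' i).supp = Set.univ := fun i => (ht' i).trans (ht i)
  have e : ∀ i hi hi', (⟨g i, (t' i).supp, fun _ => 0, hi⟩ : Piece (Fin (2 * w + 1))) =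
      ⟨g i, Set.univ, fun _ => 0, hi'⟩ := by
    intro i
    rw [hX i]
    exact fun _ _ => rfl
  have := Nonempty.intro I
  change Piece.Immersed ⟨_, _, _, _⟩ ⟨_, _, _, _⟩ at this
  dsimp only at this
  rwa [e m _ ((g m).toPiece fun _ => 0).lab_inj, e n _ ((g n).toPiece fun _ => 0).lab_inj] at this

/-! ### Edges of a tree -/

section treeSide

variable {N : Type} {T : SimpleGraph N} {s t a b m n : N}

theorem mem_treeSide_self (T : SimpleGraph N) (s t : N) : s ∈ treeSide T s t :=
  SimpleGraph.Reachable.refl s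

theorem mem_treeSide_of_adj (hm : m ∈ treeSide T s t) (h : T.Adj m n) (hne : s(m, n) ≠ s(s, t)) :
    n ∈ treeSide T s t :=
  SimpleGraph.Reachable.trans hm
    (SimpleGraph.Adj.reachable ((SimpleGraph.deleteEdges_adj).2 ⟨h, hne⟩))

theorem mem_treeSide_of_adj' (hm : m ∈ treeSide T s t) (h : T.Adj m n) (hne : n ≠ t) :
    n ∈ treeSide T s t := by
  by_cases h' : s(m, n) = s(s, t)
  · rcases Sym2.eq_iff.1 h' with ⟨-, h'⟩ | ⟨-, rfl⟩
    · exact absurd h' hne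
    · exact mem_treeSide_self T _ _
  · exact mem_treeSide_of_adj hm h h'

theorem treeSide_induction {P : N → Prop} (hs : P s)
    (step : ∀ m n, m ∈ treeSide T s t → P m → T.Adj m n → s(m, n) ≠ s(s, t) → P n)
    (hn : n ∈ treeSide T s t) : P n := by
  have h := (SimpleGraph.reachable_iff_reflTransGen _ _).1 hn
  suffices n ∈ treeSide T s t ∧ P n from this.2
  clear hn
  induction h with
  | refl => exact ⟨mem_treeSide_self T s t, hs⟩
  | tail _ hbc ih =>
    obtain ⟨h1, h2⟩ := SimpleGraph.deleteEdges_adj.1 hbc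
    exact ⟨mem_treeSide_of_adj ih.1 h1 h2, step _ _ ih.1 ih.2 h1 h2⟩

theorem SimpleGraph.Connected.induction_on_adj (hT : T.Connected) {P : N → Prop} (hs : P s)
    (step : ∀ m n, P m → T.Adj m n → P n) (n : N) : P n := by
  have h := (SimpleGraph.reachable_iff_reflTransGen _ _).1 (hT.preconnected s n)
  induction h with
  | refl => exact hs
  | tail _ hbc ih => exact step _ _ ih hbc

namespace SimpleGraph.IsTree

theorem disjoint_treeSide (hT : T.IsTree) (h : T.Adj s t) :
    Disjoint (treeSide T s t) (treeSide T t s) := by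
  rw [Set.disjoint_left]
  intro n h1 h2
  have := (SimpleGraph.isAcyclic_iff_forall_adj_isBridge.1 hT.isAcyclic) h
  rw [SimpleGraph.isBridge_iff] at this
  refine this ?_
  rw [treeSide, Sym2.eq_swap] at h2
  exact SimpleGraph.Reachable.trans h1 (SimpleGraph.Reachable.symm h2)

theorem treeSide_union (hT : T.IsTree) (s t : N) :
    treeSide T s t ∪ treeSide T t s = Set.univ := by
  refine Set.eq_univ_of_forall (hT.connected.induction_on_adj (Or.inl (mem_treeSide_self T s t)) ?_)
  rintro m n (hm | hm) h
  · by_cases hn : n = t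
    · exact Or.inr (hn ▸ mem_treeSide_self T _ _)
    · exact Or.inl (mem_treeSide_of_adj' hm h hn)
  · by_cases hn : n = s
    · exact Or.inl (hn ▸ mem_treeSide_self T _ _)
    · exact Or.inr (mem_treeSide_of_adj' hm h hn)

theorem compl_treeSide (hT : T.IsTree) (h : T.Adj s t) : (treeSide T s t)ᶜ = treeSide T t s :=
  (IsCompl.of_eq (hT.disjoint_treeSide h).eq_bot (hT.treeSide_union s t)).compl_eq

theorem exists_mem_treeSide (hT : T.IsTree) (h : m ≠ n) :
    ∃ a, T.Adj n a ∧ m ∈ treeSide T a n := by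
  refine (hT.connected.induction_on_adj (s := n)
    (P := fun m => m = n ∨ ∃ a, T.Adj n a ∧ m ∈ treeSide T a n) (Or.inl rfl) ?_ m).resolve_left h
  rintro m m' (rfl | ⟨a, ha, hm⟩) hmm'
  · exact Or.inr ⟨m', hmm', mem_treeSide_self T _ _⟩
  · by_cases hn : m' = n
    · exact Or.inl hn
    · exact Or.inr ⟨a, ha, mem_treeSide_of_adj' hm hmm' hn⟩

theorem treeSide_subset (hT : T.IsTree) (ha : T.Adj s a) (ht : T.Adj s t) (hat : a ≠ t) :
    treeSide T a s ⊆ treeSide T s t := by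
  intro n hn
  refine treeSide_induction (P := fun n => n ∈ treeSide T s t)
    (mem_treeSide_of_adj' (mem_treeSide_self T s t) ha hat) ?_ hn
  intro m n hm hms hmn _
  by_cases h : s(m, n) = s(s, t)
  · rcases Sym2.eq_iff.1 h with ⟨rfl, -⟩ | ⟨-, rfl⟩
    · exact absurd (mem_treeSide_self T _ _) (Set.disjoint_left.1 (hT.disjoint_treeSide ha.symm) hm)
    · exact mem_treeSide_self T _ _
  · exact mem_treeSide_of_adj hms hmn h

theorem exists_mem_treeSide_of_ne (hT : T.IsTree) (ht : T.Adj s t) (hn : n ∈ treeSide T s t)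
    (hns : n ≠ s) : ∃ a, T.Adj s a ∧ a ≠ t ∧ n ∈ treeSide T a s := by
  obtain ⟨a, ha, hna⟩ := hT.exists_mem_treeSide hns
  refine ⟨a, ha, ?_, hna⟩
  rintro rfl
  exact Set.disjoint_left.1 (hT.disjoint_treeSide ha) hn hna

theorem disjoint_treeSide_of_ne (hT : T.IsTree) (ha : T.Adj s a) (hb : T.Adj s b) (hab : a ≠ b) :
    Disjoint (treeSide T a s) (treeSide T b s) :=
  (hT.disjoint_treeSide hb).mono_left (hT.treeSide_subset ha hb hab)

/-- If every node of a finite tree points to a neighbour, then two adjacent nodes point to each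
other, as there are fewer edges than nodes. -/
theorem exists_apply_apply_eq [Finite N] (hT : T.IsTree) (f : N → N) (hf : ∀ n, T.Adj n (f n)) :
    ∃ n, f (f n) = n := by
  classical
  have := Fintype.ofFinite N
  have := hT.card_edgeFinset
  obtain ⟨x, y, hxy, h⟩ := Fintype.exists_ne_map_eq_of_card_lt
    (fun n => (⟨s(n, f n), SimpleGraph.mem_edgeFinset.2 (hf n)⟩ : T.edgeFinset))
    (by rw [Fintype.card_coe]; omega)
  rcases Sym2.eq_iff.1 (congrArg Subtype.val h) with ⟨h, -⟩ | ⟨h, h'⟩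
  · exact absurd h hxy
  · exact ⟨x, by rw [h']; exact h.symm⟩

end SimpleGraph.IsTree

end treeSide

/-! ### From carvings to split trees -/

namespace MultiDigraph

/-- `G.SplitWidthLE w`: the vertex set has a recursive bipartition all of whose parts are left by at
most `w` edges. -/
def SplitWidthLE (G : MultiDigraph.{u, v}) (w : ℕ) : Prop :=
  ∃ t : SplitTree G.V, t.supp = Set.univ ∧ t.Proper ∧ t.WidthLE G.outSize w

variable {G : MultiDigraph.{u, v}}

theorem outSize_le_ncard_cut (G : MultiDigraph.{u, v}) (X : Set G.V) :
    G.outSize X ≤ (G.cut X).ncard :=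
  Set.ncard_le_ncard (fun _ h => Or.inl h) (Set.toFinite _)

theorem outSize_univ (G : MultiDigraph.{u, v}) : G.outSize Set.univ = 0 := by
  rw [outSize, Set.ncard_eq_zero (Set.toFinite _)]
  ext e
  simp [outCut]

theorem cut_compl (G : MultiDigraph.{u, v}) (X : Set G.V) : G.cut Xᶜ = G.cut X := by
  ext e
  simp only [cut, Set.mem_compl_iff, Set.mem_ofPred_eq]
  tauto

/-- The induction is on the size of the side of an edge. A node of degree `3` is no leaf, so that
as far as `G` is concerned, its side is made up of the sides of the other two edges at the node. -/
theorem Carving.exists_splitTree (c : G.Carving) {w : ℕ}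
    (hw : ∀ s t, c.tree.Adj s t → G.outSize (c.leaf ⁻¹' treeSide c.tree s t) ≤ w) (n : ℕ) :
    ∀ s t, c.tree.Adj s t → (treeSide c.tree s t).ncard = n → ∃ τ : SplitTree G.V,
      τ.supp = c.leaf ⁻¹' treeSide c.tree s t ∧ τ.Proper ∧ τ.WidthLE G.outSize w := by
  have := c.finite_node
  induction n using Nat.strong_induction_on with
  | _ n ih =>
  rintro s t hst rfl
  have hT := c.isTree
  have ht : t ∈ c.tree.neighborSet s := hst
  have hws := hw s t hst
  rcases c.cubic s with h1 | h3
  · obtain ⟨t', ht'⟩ := Set.encard_eq_one.1 h1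
    have hside : treeSide c.tree s t = {s} := by
      refine Set.eq_singleton_iff_unique_mem.2 ⟨mem_treeSide_self _ _ _, fun m hm => ?_⟩
      by_contra hne
      obtain ⟨a, ha, hat, -⟩ := hT.exists_mem_treeSide_of_ne hst hm hne
      have ha : a ∈ c.tree.neighborSet s := ha
      rw [ht'] at ha ht
      exact hat (ha.trans ht.symm)
    by_cases hx : ∃ x, c.leaf x = s
    · obtain ⟨x, rfl⟩ := hx
      have : c.leaf ⁻¹' treeSide c.tree (c.leaf x) t = {x} := by
        rw [hside]
        ext y
        exact c.leaf_injective.eq_iff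
      rw [this] at hws ⊢
      refine ⟨.leaf x, rfl, trivial, ?_⟩
      rintro E rfl
      exact hws
    · have : c.leaf ⁻¹' treeSide c.tree s t = ∅ := by
        rw [hside, Set.preimage_singleton_eq_empty]
        rintro ⟨x, h⟩
        exact hx ⟨x, h⟩
      rw [this] at hws ⊢
      refine ⟨.empty, rfl, trivial, ?_⟩
      rintro E rfl
      exact hws
  · have h2 : (c.tree.neighborSet s \ {t}).encard = 2 := by
      have := Set.encard_sdiff_singleton_add_one ht
      rw [h3] at this
      exact WithTop.add_right_cancel ENat.one_ne_top (this.trans (by norm_num : (3 : ℕ∞) = 2 + 1))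
    obtain ⟨a, b, hab, hN⟩ := Set.encard_eq_two.1 h2
    obtain ⟨ha, hat⟩ : a ∈ c.tree.neighborSet s \ {t} := hN ▸ Set.mem_insert a _
    obtain ⟨hb, hbt⟩ : b ∈ c.tree.neighborSet s \ {t} := hN ▸ Or.inr rfl
    have lt : ∀ a, c.tree.Adj s a → a ≠ t →
        (treeSide c.tree a s).ncard < (treeSide c.tree s t).ncard := by
      intro a ha hat
      refine Set.ncard_lt_ncard ⟨hT.treeSide_subset ha hst hat, fun h => ?_⟩ (Set.toFinite _)
      exact Set.disjoint_left.1 (hT.disjoint_treeSide ha) (mem_treeSide_self _ _ _)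
        (h (mem_treeSide_self _ _ _))
    obtain ⟨α, hα, pα, wα⟩ := ih _ (lt a ha hat) a s ha.symm rfl
    obtain ⟨β, hβ, pβ, wβ⟩ := ih _ (lt b hb hbt) b s hb.symm rfl
    have hsupp : α.supp ∪ β.supp = c.leaf ⁻¹' treeSide c.tree s t := by
      rw [hα, hβ]
      ext x
      constructor
      · rintro (h | h)
        exacts [hT.treeSide_subset ha hst hat h, hT.treeSide_subset hb hst hbt h]
      · intro h
        have hne : c.leaf x ≠ s := by
          rintro rfl
          rw [c.isLeaf x] at h3
          exact absurd h3 (by norm_num)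
        obtain ⟨d, hd, hdt, hxd⟩ := hT.exists_mem_treeSide_of_ne hst h hne
        have : d ∈ c.tree.neighborSet s \ {t} := ⟨hd, hdt⟩
        rw [hN] at this
        rcases this with rfl | rfl
        exacts [Or.inl hxd, Or.inr hxd]
    refine ⟨.node α β, hsupp, ⟨?_, pα, pβ⟩, ?_⟩
    · rw [hα, hβ]
      exact (hT.disjoint_treeSide_of_ne ha hb hab).preimage _
    · rintro E (rfl | hE | hE)
      exacts [hsupp ▸ hws, wα E hE, wβ E hE]

theorem Carving.encard_cut_le (c : G.Carving) {w : ℕ∞} (h : c.width ≤ w) {s t : c.Node}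
    (hst : c.tree.Adj s t) : (G.cut (c.leaf ⁻¹' treeSide c.tree s t)).encard ≤ w :=
  (le_iSup_of_le s (le_iSup_of_le t (le_iSup
    (fun _ : c.tree.Adj s t => (G.cut (c.leaf ⁻¹' treeSide c.tree s t)).encard) hst))).trans h

theorem _root_.ENat.exists_le_of_iInf_le {ι : Sort*} {f : ι → ℕ∞} {k : ℕ} (h : ⨅ i, f i ≤ k) :
    ∃ i, f i ≤ k := by
  have : ⨅ i, f i < k + 1 := (ENat.lt_add_one_iff (ENat.natCast_ne_top k)).2 h
  obtain ⟨i, hi⟩ := iInf_lt_iff.1 this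
  exact ⟨i, (ENat.lt_add_one_iff (ENat.natCast_ne_top k)).1 hi⟩

theorem splitWidthLE_of_carvingWidth_le {k : ℕ} (h : G.carvingWidth ≤ k) : G.SplitWidthLE k := by
  obtain ⟨c, hc⟩ := ENat.exists_le_of_iInf_le h
  have hw : ∀ s t, c.tree.Adj s t → G.outSize (c.leaf ⁻¹' treeSide c.tree s t) ≤ k := by
    intro s t hst
    refine (G.outSize_le_ncard_cut _).trans ?_
    have := c.encard_cut_le hc hst
    rwa [← (Set.toFinite _).cast_ncard_eq, Nat.cast_le] at this
  have hT := c.isTree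
  obtain ⟨s⟩ := hT.connected.nonempty
  obtain ⟨t, ht⟩ : (c.tree.neighborSet s).Nonempty := by
    rw [← Set.encard_pos]
    rcases c.cubic s with h | h <;> simp [h]
  have hst : c.tree.Adj s t := ht
  obtain ⟨α, hα, pα, wα⟩ := c.exists_splitTree hw _ s t hst rfl
  obtain ⟨β, hβ, pβ, wβ⟩ := c.exists_splitTree hw _ t s hst.symm rfl
  have hsupp : α.supp ∪ β.supp = Set.univ := by
    rw [hα, hβ, ← Set.preimage_union, hT.treeSide_union, Set.preimage_univ]
  refine ⟨.node α β, hsupp, ⟨?_, pα, pβ⟩, ?_⟩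
  · rw [hα, hβ]
    exact (hT.disjoint_treeSide hst).preimage _
  · rintro E (rfl | hE | hE)
    · rw [hsupp, outSize_univ]
      exact Nat.zero_le _
    · exact wα E hE
    · exact wβ E hE

end MultiDigraph

/-! ### Trees given by a parent function -/

/-- The graph in which every element except for the root is joined to its parent. -/
def parentGraph {N : Type} (root : N) (par : N → N) : SimpleGraph N :=
  SimpleGraph.fromRel fun a b => a ≠ root ∧ par a = b

section parentGraph

variable {N : Type} {root : N} {par : N → N} {rank : N → ℕ}

theorem parentGraph_adj (hrank : ∀ a, a ≠ root → rank (par a) < rank a) {a b : N} :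
    (parentGraph root par).Adj a b ↔ (a ≠ root ∧ par a = b) ∨ (b ≠ root ∧ par b = a) := by
  rw [parentGraph, SimpleGraph.fromRel_adj, and_iff_right_iff_imp]
  rintro (⟨h, h'⟩ | ⟨h, h'⟩) rfl <;> exact absurd (hrank a h) (by rw [h']; exact lt_irrefl _)

theorem parentGraph_edge_injective (hrank : ∀ a, a ≠ root → rank (par a) < rank a) {a b : N}
    (ha : a ≠ root) (hb : b ≠ root) (h : s(a, par a) = s(b, par b)) : a = b := by
  rcases Sym2.eq_iff.1 h with ⟨h, -⟩ | ⟨h1, h2⟩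
  · exact h
  · have h3 := hrank a ha
    have h4 := hrank b hb
    rw [h2] at h3
    rw [← h1] at h4
    omega

theorem parentGraph_isTree [Finite N] (hrank : ∀ a, a ≠ root → rank (par a) < rank a) :
    (parentGraph root par).IsTree := by
  have hconn : ∀ n a, rank a = n → (parentGraph root par).Reachable a root := by
    intro n
    induction n using Nat.strong_induction_on with
    | _ n ih =>
      rintro a rfl
      by_cases ha : a = root
      · rw [ha]
      · exact (SimpleGraph.Adj.reachable ((parentGraph_adj hrank).2 (Or.inl ⟨ha, rfl⟩))).trans
          (ih _ (hrank a ha) _ rfl)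
  rw [SimpleGraph.isTree_iff_connected_and_card]
  refine ⟨(SimpleGraph.connected_iff _).2
    ⟨fun a b => (hconn _ a rfl).trans (hconn _ b rfl).symm, ⟨root⟩⟩, ?_⟩
  have hbij : Function.Bijective (fun a : {a // a ≠ root} =>
      (⟨s(a.1, par a.1), (parentGraph_adj hrank).2 (Or.inl ⟨a.2, rfl⟩)⟩ :
        (parentGraph root par).edgeSet)) := by
    constructor
    · intro a b h
      exact Subtype.ext (parentGraph_edge_injective hrank a.2 b.2 (congrArg Subtype.val h))
    · rintro ⟨e, he⟩
      induction e using Sym2.ind with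
      | _ a b =>
        have he' : (parentGraph root par).Adj a b := he
        rcases (parentGraph_adj hrank).1 he' with ⟨h, rfl⟩ | ⟨h, rfl⟩
        · exact ⟨⟨a, h⟩, rfl⟩
        · exact ⟨⟨b, h⟩, Subtype.ext Sym2.eq_swap⟩
  rw [← Nat.card_congr (Equiv.ofBijective _ hbij)]
  have := Fintype.ofFinite N
  classical
  have hpos : 0 < Fintype.card N := Fintype.card_pos_iff.2 ⟨root⟩
  rw [Nat.card_eq_fintype_card, Nat.card_eq_fintype_card, Fintype.card_subtype_compl,
    Fintype.card_subtype_eq]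
  omega

/-- The side of a node `a` is the set of its descendants. -/
theorem treeSide_parentGraph (hrank : ∀ a, a ≠ root → rank (par a) < rank a) {a : N} {D : Set N}
    (ha : a ∈ D) (hroot : root ∉ D) (hD : ∀ n, n ≠ root → n ≠ a → (n ∈ D ↔ par n ∈ D)) :
    treeSide (parentGraph root par) a (par a) = D := by
  have har : a ≠ root := fun h => hroot (h ▸ ha)
  apply Set.Subset.antisymm
  · intro n hn
    refine treeSide_induction (P := fun n => n ∈ D) ha ?_ hn
    intro m n _ hm hmn hne
    rcases (parentGraph_adj hrank).1 hmn with ⟨h, rfl⟩ | ⟨h, rfl⟩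
    · exact (hD m h (by rintro rfl; exact hne rfl)).1 hm
    · exact (hD n h (by rintro rfl; exact hne Sym2.eq_swap)).2 hm
  · have : ∀ k n, rank n = k → n ∈ D → n ∈ treeSide (parentGraph root par) a (par a) := by
      intro k
      induction k using Nat.strong_induction_on with
      | _ k ih =>
        rintro n rfl hn
        by_cases hna : n = a
        · rw [hna]
          exact mem_treeSide_self _ _ _
        · have hnr : n ≠ root := fun h => hroot (h ▸ hn)
          refine mem_treeSide_of_adj (ih _ (hrank n hnr) _ rfl ((hD n hnr hna).1 hn))
            ((parentGraph_adj hrank).2 (Or.inr ⟨hnr, rfl⟩)) fun h => hna ?_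
          exact parentGraph_edge_injective hrank hnr har (Sym2.eq_swap.trans h)
    exact fun n hn => this _ n rfl hn

end parentGraph

/-! ### Positions in split trees -/

namespace SplitTree

variable {α : Type*} {t s s' l r : SplitTree α} {p q : List Bool} {x y : α}

/-- `t.IsAt p s`: the subtree of `t` at the position `p` is `s`. The position of a child is obtained
by putting one letter in front of the position of the node; that of `t` itself is `[true]`, so that
the empty list is left for an additional node above the root. -/
inductive IsAt (t : SplitTree α) : List Bool → SplitTree α → Prop
  | root : IsAt t [true] t
  | left {p : List Bool} {l r : SplitTree α} : IsAt t p (.node l r) → IsAt t (true :: p) l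
  | right {p : List Bool} {l r : SplitTree α} : IsAt t p (.node l r) → IsAt t (false :: p) r

namespace IsAt

theorem ne_nil (h : t.IsAt p s) : p ≠ [] := by
  cases h <;> exact List.cons_ne_nil _ _

theorem unique (h : t.IsAt p s) (h' : t.IsAt p s') : s = s' := by
  induction h generalizing s' with
  | root =>
    cases h' with
    | root => rfl
    | left h => exact absurd rfl h.ne_nil
  | left h ih =>
    cases h' with
    | root => exact absurd rfl h.ne_nil
    | left h => exact (SplitTree.node.inj (ih h)).1
  | right h ih =>
    cases h' with
    | right h => exact (SplitTree.node.inj (ih h)).2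

theorem of_cons {b : Bool} (h : t.IsAt (b :: p) s) (hp : p ≠ []) :
    ∃ l r, t.IsAt p (.node l r) ∧ s.supp ⊆ (SplitTree.node l r).supp := by
  cases h with
  | root => exact absurd rfl hp
  | left h => exact ⟨_, _, h, Set.subset_union_left⟩
  | right h => exact ⟨_, _, h, Set.subset_union_right⟩

theorem singleton_suffix (h : t.IsAt p s) : [true] <:+ p := by
  induction h with
  | root => exact List.suffix_rfl
  | left _ ih => exact ih.trans (List.suffix_cons _ _)
  | right _ ih => exact ih.trans (List.suffix_cons _ _)

theorem of_suffix (h : t.IsAt q s) (hp : p <:+ q) (hp' : p ≠ []) :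
    ∃ s', t.IsAt p s' ∧ s.supp ⊆ s'.supp := by
  induction q generalizing s with
  | nil => exact absurd rfl h.ne_nil
  | cons b q ih =>
    rcases List.suffix_cons_iff.1 hp with rfl | hp
    · exact ⟨s, h, subset_rfl⟩
    · have hq : q ≠ [] := by
        rintro rfl
        exact hp' (List.suffix_nil.1 hp)
      obtain ⟨l, r, h1, h2⟩ := h.of_cons hq
      obtain ⟨s', h3, h4⟩ := ih h1 hp
      exact ⟨s', h3, h2.trans h4⟩

theorem displayed_subset (h : t.IsAt p s) : s.displayed ⊆ t.displayed := by
  induction h with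
  | root => exact subset_rfl
  | left _ ih => exact fun E hE => ih (Or.inr (Or.inl hE))
  | right _ ih => exact fun E hE => ih (Or.inr (Or.inr hE))

theorem supp_mem_displayed (h : t.IsAt p s) : s.supp ∈ t.displayed :=
  h.displayed_subset s.supp_mem_displayed

theorem proper (h : t.IsAt p s) (ht : t.Proper) : s.Proper := by
  induction h with
  | root => exact ht
  | left _ ih => exact ih.2.1
  | right _ ih => exact ih.2.2

theorem exists_leaf (h : t.IsAt p s) (hx : x ∈ s.supp) : ∃ q, t.IsAt q (.leaf x) := by
  induction s generalizing p with
  | empty => exact absurd hx (Set.notMem_empty x)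
  | leaf a =>
    obtain rfl : x = a := hx
    exact ⟨p, h⟩
  | node l r hl hr =>
    rcases hx with hx | hx
    exacts [hl h.left hx, hr h.right hx]

/-- The positions of the subtrees that contain `x` are the suffixes of the position of its leaf. -/
theorem suffix_leaf (ht : t.Proper) (h : t.IsAt p s) (hq : t.IsAt q (.leaf x)) (hx : x ∈ s.supp) :
    p <:+ q := by
  have key : ∀ {p l r}, t.IsAt p (.node l r) → p <:+ q → ∃ c, (c :: p) <:+ q := by
    rintro p l r h ⟨q', rfl⟩
    rcases List.eq_nil_or_concat q' with rfl | ⟨q'', c, rfl⟩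
    · exact absurd (h.unique hq) (by simp)
    · exact ⟨c, q'', by simp⟩
  induction h with
  | root => exact hq.singleton_suffix
  | @left p l r h ih =>
    obtain ⟨c, hc⟩ := key h (ih (Or.inl hx))
    cases c with
    | true => exact hc
    | false =>
      obtain ⟨s', h1, h2⟩ := hq.of_suffix hc (List.cons_ne_nil _ _)
      rw [← h.right.unique h1] at h2
      exact absurd (h2 rfl) (Set.disjoint_left.1 (h.proper ht).1 hx)
  | @right p l r h ih =>
    obtain ⟨c, hc⟩ := key h (ih (Or.inr hx))
    cases c with
    | false => exact hc
    | true =>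
      obtain ⟨s', h1, h2⟩ := hq.of_suffix hc (List.cons_ne_nil _ _)
      rw [← h.left.unique h1] at h2
      exact absurd hx (Set.disjoint_left.1 (h.proper ht).1 (h2 rfl))

theorem length_add_size (h : t.IsAt p s) : p.length + s.size ≤ t.size + 1 := by
  induction h with
  | root => simp [add_comm]
  | left _ ih =>
    rw [size] at ih
    rw [List.length_cons]
    omega
  | right _ ih =>
    rw [size] at ih
    rw [List.length_cons]
    omega

end IsAt

theorem finite_setOf_isAt (t : SplitTree α) : {p | p = [] ∨ ∃ s, t.IsAt p s}.Finite := by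
  refine (List.finite_length_le Bool (t.size + 1)).subset ?_
  rintro p (rfl | ⟨s, h⟩)
  · exact Nat.zero_le _
  · have := h.length_add_size
    change p.length ≤ _
    omega

end SplitTree

/-- The tree on a set of lists that is closed under suffixes; the parent of a list is its tail. -/
def suffixTree (P : Set (List Bool)) (hP : ∀ p ∈ P, p.tail ∈ P) (h0 : [] ∈ P) : SimpleGraph P :=
  parentGraph ⟨[], h0⟩ fun p => ⟨p.1.tail, hP p p.2⟩

section suffixTree

variable {P : Set (List Bool)} {hP : ∀ p ∈ P, p.tail ∈ P} {h0 : [] ∈ P}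

theorem length_tail_lt_of_ne (a : P) (ha : a ≠ ⟨[], h0⟩) : a.1.tail.length < a.1.length := by
  have : 0 < a.1.length := List.length_pos_iff.2 fun h => ha (Subtype.ext h)
  rw [List.length_tail]
  omega

theorem suffixTree_adj {p q : P} : (suffixTree P hP h0).Adj p q ↔
    (∃ b, p.1 = b :: q.1) ∨ ∃ b, q.1 = b :: p.1 := by
  have key : ∀ p q : P, p ≠ ⟨[], h0⟩ ∧ (⟨p.1.tail, hP p p.2⟩ : P) = q ↔ ∃ b, p.1 = b :: q.1 := by
    rintro ⟨p, hp⟩ ⟨q, hq⟩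
    rw [Ne, Subtype.mk.injEq, Subtype.mk.injEq]
    cases p with
    | nil => simp
    | cons b p => simp
  rw [suffixTree, parentGraph_adj (rank := fun p : P => p.1.length) length_tail_lt_of_ne, key, key]

theorem suffixTree_isTree [Finite P] : (suffixTree P hP h0).IsTree :=
  parentGraph_isTree (rank := fun p : P => p.1.length) length_tail_lt_of_ne

theorem treeSide_suffixTree {p q : P} {b : Bool} (h : p.1 = b :: q.1) :
    treeSide (suffixTree P hP h0) p q = {n | p.1 <:+ n.1} := by
  have hq : q = ⟨p.1.tail, hP p p.2⟩ :=
    Subtype.ext (by change q.1 = p.1.tail; rw [h, List.tail_cons])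
  rw [hq]
  refine treeSide_parentGraph (rank := fun p : P => p.1.length) length_tail_lt_of_ne
    List.suffix_rfl ?_ ?_
  · intro h'
    have := List.suffix_nil.1 h'
    rw [h] at this
    exact List.cons_ne_nil _ _ this
  · rintro ⟨n, hn⟩ - hne
    change p.1 <:+ n ↔ p.1 <:+ n.tail
    cases n with
    | nil => rfl
    | cons c n =>
      rw [List.suffix_cons_iff, List.tail_cons]
      exact or_iff_right fun h' => hne (Subtype.ext h'.symm)

theorem suffixTree_neighborSet {p : P} {b : Bool} {q : List Bool} (hq : q ∈ P) (h : p.1 = b :: q) :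
    (suffixTree P hP h0).neighborSet p = {⟨q, hq⟩} ∪ {n | ∃ b, n.1 = b :: p.1} := by
  ext n
  rw [SimpleGraph.mem_neighborSet, suffixTree_adj]
  refine or_congr ?_ Iff.rfl
  rw [h, Set.mem_singleton_iff]
  constructor
  · rintro ⟨c, hc⟩
    exact Subtype.ext (List.cons.inj hc).2.symm
  · rintro rfl
    exact ⟨b, rfl⟩

end suffixTree

/-! ### From split trees to carvings and tree decompositions -/

namespace MultiDigraph

variable {G : MultiDigraph.{u, v}}

theorem IsEulerian.encard_cut_le (hG : G.IsEulerian) {X : Set G.V} {w : ℕ}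
    (h : G.outSize X ≤ w) : (G.cut X).encard ≤ (2 * w : ℕ) := by
  rw [← (Set.toFinite (G.cut X)).cast_ncard_eq, hG.ncard_cut, Nat.cast_le]
  omega

theorem carvingWidth_le_of_splitWidthLE (hG : G.IsEulerian) {w : ℕ} (h : G.SplitWidthLE w) :
    G.carvingWidth ≤ (2 * w : ℕ) := by
  obtain ⟨t, ht, hproper, hw⟩ := h
  choose pos hpos using fun x =>
    SplitTree.IsAt.root.exists_leaf (t := t) (x := x) (by rw [ht]; trivial)
  let P : Set (List Bool) := {p | p = [] ∨ ∃ s, t.IsAt p s}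
  have hP : ∀ p ∈ P, p.tail ∈ P := by
    rintro p (rfl | ⟨s, h⟩)
    · exact Or.inl rfl
    · cases h with
      | root => exact Or.inl rfl
      | left h => exact Or.inr ⟨_, h⟩
      | right h => exact Or.inr ⟨_, h⟩
  have h0 : [] ∈ P := Or.inl rfl
  have hfin : Finite P := t.finite_setOf_isAt
  have hleaf : ∀ (p : P) {s}, t.IsAt p.1 s → (∀ l r, s ≠ .node l r) →
      ((suffixTree P hP h0).neighborSet p).encard = 1 := by
    rintro ⟨p, hp⟩ s hs hne
    obtain ⟨b, q, rfl⟩ := List.exists_cons_of_ne_nil hs.ne_nil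
    rw [suffixTree_neighborSet (hP _ hp) rfl, Set.encard_eq_one]
    refine ⟨_, Set.union_eq_left.2 ?_⟩
    rintro ⟨n, hn⟩ ⟨c, hc⟩
    dsimp only at hc
    subst hc
    obtain ⟨s', hs'⟩ := hn.resolve_left (List.cons_ne_nil _ _)
    obtain ⟨l, r, h, -⟩ := hs'.of_cons hs.ne_nil
    exact absurd (hs.unique h) (hne l r)
  let c : G.Carving :=
    { Node := P
      finite_node := hfin
      tree := suffixTree P hP h0
      isTree := suffixTree_isTree
      cubic := by
        rintro ⟨p, hp⟩
        rcases id hp with rfl | ⟨s, hs⟩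
        · left
          refine Set.encard_eq_one.2 ⟨⟨[true], Or.inr ⟨t, .root⟩⟩, ?_⟩
          ext ⟨n, hn⟩
          rw [SimpleGraph.mem_neighborSet, suffixTree_adj, Set.mem_singleton_iff, Subtype.mk.injEq]
          constructor
          · rintro (⟨b, h⟩ | ⟨b, h⟩)
            · exact absurd h (List.cons_ne_nil _ _).symm
            · dsimp only at h
              subst h
              obtain ⟨s', hs'⟩ := hn.resolve_left (List.cons_ne_nil _ _)
              cases hs' with
              | root => rfl
              | left h => exact absurd rfl h.ne_nil
              | right h => exact absurd rfl h.ne_nil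
          · rintro rfl
            exact Or.inr ⟨true, rfl⟩
        · cases s with
          | empty => exact Or.inl (hleaf ⟨p, hp⟩ hs nofun)
          | leaf a => exact Or.inl (hleaf ⟨p, hp⟩ hs nofun)
          | node l r =>
            right
            obtain ⟨b, q, rfl⟩ := List.exists_cons_of_ne_nil hs.ne_nil
            rw [suffixTree_neighborSet (hP _ hp) rfl]
            refine Set.encard_eq_three.2 ⟨⟨q, hP _ hp⟩, ⟨true :: b :: q, Or.inr ⟨_, hs.left⟩⟩,
              ⟨false :: b :: q, Or.inr ⟨_, hs.right⟩⟩, ?_, ?_, ?_, ?_⟩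
            · exact fun h => absurd (congrArg (fun p : P => p.1.length) h) (by simp; omega)
            · exact fun h => absurd (congrArg (fun p : P => p.1.length) h) (by simp; omega)
            · simp
            · rw [Set.singleton_union]
              congr 1
              ext ⟨n, hn⟩
              simp [Bool.exists_bool, or_comm]
      leaf x := ⟨pos x, Or.inr ⟨_, hpos x⟩⟩
      leaf_injective := by
        intro x y hxy
        have hxy : pos x = pos y := congrArg Subtype.val hxy
        have h := hpos x
        rw [hxy] at h
        exact SplitTree.leaf.inj (h.unique (hpos y))
      isLeaf x := hleaf _ (hpos x) nofun }
  have hdown : ∀ (p q : P) (b : Bool), p.1 = b :: q.1 →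
      (G.cut (c.leaf ⁻¹' treeSide c.tree p q)).encard ≤ (2 * w : ℕ) := by
    rintro ⟨p, hp⟩ q b hpq
    have hne : p ≠ [] := fun h => List.cons_ne_nil _ _ (hpq.symm.trans h)
    obtain ⟨s, hs⟩ := hp.resolve_left hne
    have : c.leaf ⁻¹' treeSide c.tree ⟨p, hp⟩ q = s.supp := by
      rw [show treeSide c.tree ⟨p, hp⟩ q = _ from
        treeSide_suffixTree (hP := hP) (h0 := h0) hpq]
      ext x
      constructor
      · intro hx
        obtain ⟨s', h1, h2⟩ := (hpos x).of_suffix hx hne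
        rw [hs.unique h1]
        exact h2 rfl
      · exact fun hx => hs.suffix_leaf hproper (hpos x) hx
    rw [this]
    exact hG.encard_cut_le (hw _ hs.supp_mem_displayed)
  refine (iInf_le _ c).trans (iSup_le fun p => iSup_le fun q => iSup_le fun hpq => ?_)
  rcases (suffixTree_adj (hP := hP) (h0 := h0)).1 hpq with ⟨b, h⟩ | ⟨b, h⟩
  · exact hdown p q b h
  · have := hdown q p b h
    rwa [← cut_compl, ← Set.preimage_compl, c.isTree.compl_treeSide hpq.symm] at this

/-- The edge `e` joins `x` and `y`, in either direction. -/
def Joins (G : MultiDigraph.{u, v}) (e : G.E) (x y : G.V) : Prop :=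
  (G.tail e = x ∧ G.head e = y) ∨ (G.tail e = y ∧ G.head e = x)

theorem Joins.mem_cut_iff {e : G.E} {x y : G.V} (h : G.Joins e x y) {X : Set G.V} :
    e ∈ G.cut X ↔ (x ∈ X ∧ y ∉ X) ∨ (x ∉ X ∧ y ∈ X) := by
  rcases h with ⟨rfl, rfl⟩ | ⟨rfl, rfl⟩
  · rfl
  · simp only [cut, Set.mem_ofPred_eq]
    tauto

/-- The ends of the edges in `F`. -/
def endsOf (G : MultiDigraph.{u, v}) (F : Set G.E) : Set G.V :=
  {x | ∃ e ∈ F, ∃ y, G.Joins e x y}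

theorem encard_endsOf_le {F : Set G.E} {w : ℕ∞} (hF : F.encard ≤ w) :
    (G.endsOf F).encard ≤ 2 * w := by
  have : G.endsOf F ⊆ G.tail '' F ∪ G.head '' F := by
    rintro x ⟨e, he, y, ⟨h, -⟩ | ⟨-, h⟩⟩
    exacts [Or.inl ⟨e, he, h⟩, Or.inr ⟨e, he, h⟩]
  rw [two_mul]
  exact (Set.encard_le_encard this).trans <| (Set.encard_union_le _ _).trans <|
    add_le_add ((Set.encard_image_le _ _).trans hF) ((Set.encard_image_le _ _).trans hF)

theorem _root_.Set.encard_biUnion_le_mul {α ι : Type*} {s : Set ι} {n : ℕ} (hs : s.encard ≤ n)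
    {f : ι → Set α} {w : ℕ∞} (hf : ∀ i ∈ s, (f i).encard ≤ w) :
    (⋃ i ∈ s, f i).encard ≤ n * w := by
  have hfin : s.Finite := Set.finite_of_encard_le_coe hs
  have h := hfin.toFinset.set_encard_biUnion_le f
  simp only [Set.Finite.mem_toFinset] at h
  refine h.trans ((Finset.sum_le_card_nsmul _ _ w fun i hi => hf i (by simpa using hi)).trans ?_)
  rw [nsmul_eq_mul]
  gcongr
  rwa [hfin.encard_eq_coe_toFinset_card, Nat.cast_le] at hs

namespace Carving

/-- The bag of a node consists of the vertex at the node and the ends of the edges of `G` in the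
cuts that correspond to the edges at the node. -/
def bag (c : G.Carving) (n : c.Node) : Set G.V :=
  c.leaf ⁻¹' {n} ∪ ⋃ m ∈ c.tree.neighborSet n, G.endsOf (G.cut (c.leaf ⁻¹' treeSide c.tree m n))

theorem leaf_mem_bag (c : G.Carving) (x : G.V) : x ∈ c.bag (c.leaf x) := Or.inl rfl

theorem mem_bag_of_mem_treeSide {c : G.Carving} {x y : G.V} {e : G.E} (he : G.Joins e x y)
    {n a : c.Node} (hna : c.tree.Adj n a) (hx : c.leaf x ∈ treeSide c.tree a n)
    (hy : c.leaf y ∉ treeSide c.tree a n) : x ∈ c.bag n ∧ x ∈ c.bag a ∧ y ∈ c.bag n := by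
  have hcut : e ∈ G.cut (c.leaf ⁻¹' treeSide c.tree a n) := he.mem_cut_iff.2 (Or.inl ⟨hx, hy⟩)
  have hcut' : e ∈ G.cut (c.leaf ⁻¹' treeSide c.tree n a) := by
    rwa [← cut_compl, ← Set.preimage_compl, c.isTree.compl_treeSide hna]
  refine ⟨Or.inr (Set.mem_biUnion (x := a) hna ⟨e, hcut, y, he⟩),
    Or.inr (Set.mem_biUnion (x := n) hna.symm ⟨e, hcut', y, he⟩),
    Or.inr (Set.mem_biUnion (x := a) hna ⟨e, hcut, x, he.symm⟩)⟩

/-- If the edge of the tree from `n` towards the leaf of `x` separates the ends of an edge of `G`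
at `x`, then so do all further edges on the way to the leaf. -/
theorem reachable_leaf (c : G.Carving) {x y : G.V} {e : G.E} (he : G.Joins e x y) (k : ℕ) :
    ∀ n a, c.tree.Adj n a → ∀ (hn : x ∈ c.bag n), (treeSide c.tree a n).ncard = k →
      c.leaf x ∈ treeSide c.tree a n → c.leaf y ∉ treeSide c.tree a n →
      (c.tree.induce {n | x ∈ c.bag n}).Reachable ⟨n, hn⟩ ⟨c.leaf x, c.leaf_mem_bag x⟩ := by
  have := c.finite_node
  have hT := c.isTree
  induction k using Nat.strong_induction_on with
  | _ k ih =>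
  rintro n a hna hn rfl hx hy
  have ha := (mem_bag_of_mem_treeSide he hna hx hy).2.1
  have hadj : (c.tree.induce {n | x ∈ c.bag n}).Reachable ⟨n, hn⟩ ⟨a, ha⟩ :=
    SimpleGraph.Adj.reachable hna
  refine hadj.trans ?_
  by_cases hax : c.leaf x = a
  · subst hax
    rfl
  · obtain ⟨b, hab, hxb⟩ := hT.exists_mem_treeSide hax
    have hbn : b ≠ n := by
      rintro rfl
      exact Set.disjoint_left.1 (hT.disjoint_treeSide hab) hx hxb
    have hsub := hT.treeSide_subset hab hna.symm hbn
    refine ih _ (Set.ncard_lt_ncard ⟨hsub, fun h => ?_⟩ (Set.toFinite _)) a b hab ha rfl hxb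
      fun h => hy (hsub h)
    exact Set.disjoint_left.1 (hT.disjoint_treeSide hab) (mem_treeSide_self _ _ _)
      (h (mem_treeSide_self _ _ _))

/-- The tree decomposition whose bags consist of the ends of the edges in the cuts at a node. -/
def treeDecomposition (c : G.Carving) : TreeDecomposition G.underlying where
  Node := c.Node
  finite_node := c.finite_node
  tree := c.tree
  isTree := c.isTree
  bag := c.bag
  vertex_mem x := ⟨c.leaf x, c.leaf_mem_bag x⟩
  edge_mem x y := by
    rintro ⟨hxy, e, he⟩
    obtain ⟨a, ha, hya⟩ :=
      c.isTree.exists_mem_treeSide (fun h => hxy (c.leaf_injective h).symm : c.leaf y ≠ c.leaf x)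
    have hx : c.leaf x ∉ treeSide c.tree a (c.leaf x) := fun h =>
      Set.disjoint_left.1 (c.isTree.disjoint_treeSide ha) (mem_treeSide_self _ _ _) h
    exact ⟨_, (mem_bag_of_mem_treeSide (Or.symm he) ha hya hx).2.2,
      (mem_bag_of_mem_treeSide (Or.symm he) ha hya hx).1⟩
  connected x := by
    have key : ∀ n : {n | x ∈ c.bag n}, (c.tree.induce {n | x ∈ c.bag n}).Reachable n
        ⟨c.leaf x, c.leaf_mem_bag x⟩ := by
      rintro ⟨n, hn⟩
      have hT := c.isTree
      by_cases hxn : c.leaf x = n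
      · subst hxn
        rfl
      obtain ⟨m, hm, e, hcut, y, he⟩ := Set.mem_iUnion₂.1 (hn.resolve_left hxn)
      obtain ⟨a, ha, hxa⟩ := hT.exists_mem_treeSide hxn
      refine c.reachable_leaf he _ n a ha hn rfl hxa fun hya => ?_
      by_cases ham : a = m
      · subst ham
        rcases he.mem_cut_iff.1 hcut with ⟨-, h⟩ | ⟨h, -⟩
        exacts [h hya, h hxa]
      · have hdisj := Set.disjoint_left.1 (hT.disjoint_treeSide_of_ne ha hm ham)
        rcases he.mem_cut_iff.1 hcut with ⟨h, -⟩ | ⟨-, h⟩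
        exacts [hdisj hxa h, hdisj hya h]
    exact (SimpleGraph.connected_iff _).2
      ⟨fun a b => (key a).trans (key b).symm, ⟨⟨_, c.leaf_mem_bag x⟩⟩⟩

end Carving

theorem treewidth_le_of_carvingWidth_le {k : ℕ} (h : G.carvingWidth ≤ k) :
    G.treewidth ≤ (6 * k : ℕ) := by
  obtain ⟨c, hc⟩ := ENat.exists_le_of_iInf_le h
  refine (iInf_le _ c.treeDecomposition).trans (tsub_le_iff_right.2 (iSup_le fun n => ?_))
  have h1 : (c.leaf ⁻¹' {n}).encard ≤ 1 := by
    rw [Set.encard_le_one_iff]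
    exact fun x y hx hy => c.leaf_injective (hx.trans hy.symm)
  have h2 : (c.tree.neighborSet n).encard ≤ (3 : ℕ) := by
    rcases c.cubic n with h | h <;> rw [h] <;> norm_num
  have h3 := Set.encard_biUnion_le_mul h2 (w := 2 * k)
    (f := fun m => G.endsOf (G.cut (c.leaf ⁻¹' treeSide c.tree m n))) fun m hm =>
      encard_endsOf_le (c.encard_cut_le hc (SimpleGraph.Adj.symm hm))
  refine (Set.encard_union_le _ _).trans ((add_le_add h1 h3).trans (le_of_eq ?_))
  push_cast
  ring

end MultiDigraph

/-! ### From split trees to arboreal decompositions -/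

namespace SplitTree

variable {α : Type*} {t s s' l r : SplitTree α} {p q : List Bool} {x y : α}

/-- All leaves carry labels. -/
def Full : SplitTree α → Prop
  | empty => False
  | leaf _ => True
  | node l r => l.Full ∧ r.Full

theorem exists_full (ht : t.Proper) (hne : t.supp.Nonempty) :
    ∃ t' : SplitTree α, t'.Full ∧ t'.supp = t.supp ∧ t'.Proper ∧ t'.displayed ⊆ t.displayed := by
  induction t with
  | empty => exact absurd rfl hne.ne_empty
  | leaf a => exact ⟨leaf a, trivial, rfl, trivial, subset_rfl⟩
  | node l r hl hr =>
    rcases l.supp.eq_empty_or_nonempty with h | h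
    · rw [supp, h, Set.empty_union] at hne
      obtain ⟨t', h1, h2, h3, h4⟩ := hr ht.2.2 hne
      exact ⟨t', h1, by rw [h2, supp, h, Set.empty_union], h3, fun E hE => Or.inr (Or.inr (h4 hE))⟩
    rcases r.supp.eq_empty_or_nonempty with h' | h'
    · obtain ⟨t', h1, h2, h3, h4⟩ := hl ht.2.1 h
      exact ⟨t', h1, by rw [h2, supp, h', Set.union_empty], h3, fun E hE => Or.inr (Or.inl (h4 hE))⟩
    obtain ⟨l', h1, h2, h3, h4⟩ := hl ht.2.1 h
    obtain ⟨r', k1, k2, k3, k4⟩ := hr ht.2.2 h'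
    refine ⟨node l' r', ⟨h1, k1⟩, by rw [supp, supp, h2, k2],
      ⟨by rw [h2, k2]; exact ht.1, h3, k3⟩, ?_⟩
    rw [displayed, displayed, h2, k2]
    exact Set.insert_subset_insert (Set.union_subset_union h4 k4)

/-- The list behind the first `false`. For the position of a leaf, this is the position of the last
node from which the path to the leaf turns right. -/
def afterTrue : List Bool → List Bool
  | [] => []
  | true :: p => afterTrue p
  | false :: p => p

theorem afterTrue_suffix (p : List Bool) : afterTrue p <:+ p := by
  induction p with
  | nil => exact List.suffix_rfl
  | cons b p ih =>
    cases b with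
    | true => exact ih.trans (List.suffix_cons _ _)
    | false => exact List.suffix_cons _ _

theorem suffix_afterTrue_or (h : q <:+ p) :
    q <:+ afterTrue p ∨ ∃ k, p = List.replicate k true ++ q := by
  induction p with
  | nil => exact Or.inr ⟨0, (List.suffix_nil.1 h).symm⟩
  | cons b p ih =>
    rcases List.suffix_cons_iff.1 h with rfl | h'
    · exact Or.inr ⟨0, rfl⟩
    · cases b with
      | true =>
        refine (ih h').imp_right ?_
        rintro ⟨k, rfl⟩
        exact ⟨k + 1, rfl⟩
      | false => exact Or.inl h'

theorem replicate_append_suffix_or (i j : ℕ) (p : List Bool) :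
    List.replicate i true ++ p <:+ List.replicate j true ++ p ∨
      List.replicate j true ++ p <:+ List.replicate i true ++ p := by
  have key : ∀ i j, i ≤ j → List.replicate i true ++ p <:+ List.replicate j true ++ p := by
    intro i j h
    obtain ⟨k, rfl⟩ := Nat.exists_eq_add_of_le' h
    exact ⟨List.replicate k true, by rw [← List.append_assoc, List.replicate_append_replicate]⟩
  exact (le_total i j).imp (key i j) (key j i)

namespace IsAt

theorem full (h : t.IsAt p s) (ht : t.Full) : s.Full := by
  induction h with
  | root => exact ht
  | left _ ih => exact ih.1
  | right _ ih => exact ih.2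

theorem afterTrue (h : t.IsAt p s) :
    SplitTree.afterTrue p = [] ∨ ∃ l r, t.IsAt (SplitTree.afterTrue p) (.node l r) := by
  induction h with
  | root => exact Or.inl rfl
  | left _ ih => exact ih
  | right h _ => exact Or.inr ⟨_, _, h⟩

theorem eq_replicate_append (h : t.IsAt p s) : ∃ k, p = List.replicate k true ++
    if SplitTree.afterTrue p = [] then [true] else false :: SplitTree.afterTrue p := by
  induction h with
  | root => exact ⟨0, rfl⟩
  | left _ ih =>
    obtain ⟨k, hk⟩ := ih
    exact ⟨k + 1, congrArg (List.cons true) hk⟩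
  | right h _ => exact ⟨0, (if_neg h.ne_nil).symm⟩

theorem exists_leaf_afterTrue_eq (h : t.IsAt p s) (hs : s.Full) :
    ∃ x q, t.IsAt q (.leaf x) ∧ SplitTree.afterTrue q = SplitTree.afterTrue p := by
  induction s generalizing p with
  | empty => exact hs.elim
  | leaf a => exact ⟨a, p, h, rfl⟩
  | node l r hl hr =>
    obtain ⟨x, q, h1, h2⟩ := hl h.left hs.1
    exact ⟨x, q, h1, h2⟩

theorem leaf_eq (hp : t.IsAt p (.leaf x)) (hq : t.IsAt q (.leaf y)) (h : p <:+ q ∨ q <:+ p) :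
    x = y := by
  rcases h with h | h
  · obtain ⟨s', h1, h2⟩ := hq.of_suffix h hp.ne_nil
    rw [← hp.unique h1] at h2
    exact (h2 rfl).symm
  · obtain ⟨s', h1, h2⟩ := hp.of_suffix h hq.ne_nil
    rw [← hq.unique h1] at h2
    exact h2 rfl

end IsAt

end SplitTree

namespace MultiDigraph

variable {G : MultiDigraph.{u, v}}

theorem maxDegree_le_of_splitWidthLE (hG : G.IsEulerian) {w : ℕ} (h : G.SplitWidthLE w) :
    G.maxDegree ≤ (2 * w : ℕ) := by
  obtain ⟨t, ht, -, hw⟩ := h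
  refine iSup_le fun x => ?_
  obtain ⟨p, hp⟩ := SplitTree.IsAt.root.exists_leaf (t := t) (x := x) (by rw [ht]; trivial)
  exact hG.encard_cut_le (hw _ hp.supp_mem_displayed)

/-- If there are no vertices, then the tree with a single node and an empty bag will do, since bags
must be nonempty only if there are vertices. -/
theorem directedTreewidth_of_isEmpty [IsEmpty G.V] : G.directedTreewidth = 0 := by
  let d : G.ArborealDecomposition :=
    { Node := Unit
      finite_node := inferInstance
      tree := ⊥
      isTree := .of_subsingleton
      root := ()
      bag := fun _ => ∅
      guard := fun _ => ∅
      bag_partition := fun x => isEmptyElim x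
      bag_nonempty := fun h => absurd h (not_nonempty_iff.2 inferInstance)
      normal := fun _ _ h => h.elim }
  refine le_antisymm ((iInf_le _ d).trans (tsub_le_iff_right.2 (iSup_le fun n => ?_))) bot_le
  rw [Set.eq_empty_of_isEmpty (_ ∪ _)]
  simp

/-- The nodes of the arboreal decomposition are the inner nodes of a split tree and one more node,
the root. The bag of an inner node consists of the leftmost leaf of its right branch, and the bag of
the root of the leftmost leaf of all. -/
theorem directedTreewidth_le_of_splitWidthLE (hG : G.IsEulerian) {w : ℕ} (h : G.SplitWidthLE w) :
    G.directedTreewidth ≤ (12 * w + 3 : ℕ) := by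
  rcases isEmpty_or_nonempty G.V with hV | ⟨⟨x₀⟩⟩
  · rw [directedTreewidth_of_isEmpty]
    exact bot_le
  obtain ⟨t₀, ht₀, hproper₀, hw₀⟩ := h
  obtain ⟨t, hfull, ht, hproper, hdisp⟩ :=
    SplitTree.exists_full hproper₀ (by rw [ht₀]; exact ⟨x₀, trivial⟩)
  rw [ht₀] at ht
  have hw : t.WidthLE G.outSize w := fun E hE => hw₀ E (hdisp hE)
  choose pos hpos using fun x =>
    SplitTree.IsAt.root.exists_leaf (t := t) (x := x) (by rw [ht]; trivial)
  let P : Set (List Bool) := {p | p = [] ∨ ∃ l r, t.IsAt p (.node l r)}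
  have hP : ∀ p ∈ P, p.tail ∈ P := by
    rintro p (rfl | ⟨l, r, h⟩)
    · exact Or.inl rfl
    · cases h with
      | root => exact Or.inl rfl
      | left h => exact Or.inr ⟨_, _, h⟩
      | right h => exact Or.inr ⟨_, _, h⟩
  have h0 : [] ∈ P := Or.inl rfl
  have hfin : Finite P := t.finite_setOf_isAt.subset fun p hp =>
    hp.imp_right fun ⟨l, r, h⟩ => ⟨_, h⟩
  -- `below p` is the set of the vertices in the bags at and below `p`, and `below p ⊆ supp p`.
  let supp : List Bool → Set G.V := fun p => {x | p <:+ pos x}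
  let below : List Bool → Set G.V := fun p => {x | p <:+ SplitTree.afterTrue (pos x)}
  let outer : List Bool → Set G.V := fun p =>
    (G.endsOf (G.cut (supp p)) ∪ (supp p \ below p)) \ below p
  have hbelow : ∀ p, below p ⊆ supp p := fun p x hx => hx.trans (SplitTree.afterTrue_suffix _)
  have hone : ∀ p, (supp p \ below p).encard ≤ 1 := by
    intro p
    rw [Set.encard_le_one_iff]
    rintro x y ⟨hx, hx'⟩ ⟨hy, hy'⟩
    obtain ⟨i, hi⟩ := (SplitTree.suffix_afterTrue_or hx).resolve_left hx'
    obtain ⟨j, hj⟩ := (SplitTree.suffix_afterTrue_or hy).resolve_left hy'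
    refine (hpos x).leaf_eq (hpos y) ?_
    rw [hi, hj]
    exact SplitTree.replicate_append_suffix_or i j p
  have houter : ∀ p ∈ P, p ≠ [] → (outer p).encard ≤ (4 * w + 1 : ℕ) := by
    intro p hp hne
    obtain ⟨l, r, h⟩ := hp.resolve_left hne
    have hsupp : supp p = (SplitTree.node l r).supp := by
      ext x
      constructor
      · intro hx
        obtain ⟨s', h1, h2⟩ := (hpos x).of_suffix hx hne
        rw [h.unique h1]
        exact h2 rfl
      · exact fun hx => h.suffix_leaf hproper (hpos x) hx
    have hcut : (G.cut (supp p)).encard ≤ (2 * w : ℕ) := by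
      rw [hsupp]
      exact hG.encard_cut_le (hw _ h.supp_mem_displayed)
    refine (Set.encard_le_encard Set.sdiff_subset).trans ((Set.encard_union_le _ _).trans
      ((add_le_add (encard_endsOf_le hcut) (hone p)).trans (le_of_eq ?_)))
    push_cast
    ring
  have hnormal : ∀ p, G.IsNormal (outer p) (below p) := by
    refine fun p => ⟨Set.disjoint_left.2 fun x hx hx' => hx'.2 hx, fun a ha b _ x hax hxb => ?_⟩
    clear hxb
    induction hax.2 with
    | refl => exact ha
    | @tail c d _ hcd ih =>
      have hc := ih ⟨hax.1, ‹_›⟩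
      obtain ⟨hd, e, rfl, rfl⟩ := hcd
      by_contra hnot
      refine hd ⟨?_, hnot⟩
      by_cases hs : G.head e ∈ supp p
      · exact Or.inr ⟨hs, hnot⟩
      · exact Or.inl ⟨e, Or.inl ⟨hbelow p hc, hs⟩, _, Or.inr ⟨rfl, rfl⟩⟩
  let d : G.ArborealDecomposition :=
    { Node := P
      finite_node := hfin
      tree := suffixTree P hP h0
      isTree := suffixTree_isTree
      root := ⟨[], h0⟩
      bag := fun n => {x | SplitTree.afterTrue (pos x) = n.1}
      guard := fun e => {y | ∃ (a b : P) (c : Bool), a.1 = c :: b.1 ∧ e = s(a, b) ∧ y ∈ outer a.1}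
      bag_partition := fun x => by
        refine ⟨⟨_, (hpos x).afterTrue⟩, rfl, ?_⟩
        rintro n hn
        exact Subtype.ext hn.symm
      bag_nonempty := by
        rintro - ⟨n, rfl | ⟨l, r, h⟩⟩
        · obtain ⟨x, q, h1, h2⟩ := SplitTree.IsAt.root.exists_leaf_afterTrue_eq hfull
          have : pos x = q := List.IsSuffix.eq_of_length ((hpos x).suffix_leaf hproper h1 rfl) <|
            le_antisymm ((hpos x).suffix_leaf hproper h1 rfl).length_le
              (h1.suffix_leaf hproper (hpos x) rfl).length_le
          exact ⟨x, by rw [Set.mem_ofPred_eq, this]; exact h2⟩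
        · obtain ⟨x, q, h1, h2⟩ := h.right.exists_leaf_afterTrue_eq (h.right.full hfull)
          have : pos x = q := List.IsSuffix.eq_of_length ((hpos x).suffix_leaf hproper h1 rfl) <|
            le_antisymm ((hpos x).suffix_leaf hproper h1 rfl).length_le
              (h1.suffix_leaf hproper (hpos x) rfl).length_le
          exact ⟨x, by rw [Set.mem_ofPred_eq, this]; exact h2⟩
      normal := by
        intro s a hsa hroot
        rcases suffixTree_adj.1 hsa with ⟨c, hc⟩ | ⟨c, hc⟩
        · refine absurd ?_ hroot
          rw [← suffixTree_isTree.compl_treeSide hsa, treeSide_suffixTree hc]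
          intro h
          have := List.suffix_nil.1 h
          rw [hc] at this
          exact List.cons_ne_nil _ _ this
        · rw [treeSide_suffixTree hc]
          convert hnormal a.1 using 1
          · ext y
            constructor
            · rintro ⟨a', b', c', h1, h2, hy⟩
              rcases Sym2.eq_iff.1 h2 with ⟨rfl, rfl⟩ | ⟨rfl, rfl⟩
              · rw [hc] at h1
                exact absurd (congrArg List.length h1) (by simp; omega)
              · exact hy
            · exact fun hy => ⟨a, s, c, hc, Sym2.eq_swap, hy⟩
          · ext x
            simp only [Set.mem_iUnion, Set.mem_ofPred_eq, below]
            constructor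
            · rintro ⟨n, hn, hx⟩
              rw [hx]
              exact hn
            · exact fun hx => ⟨⟨_, (hpos x).afterTrue⟩, hx, rfl⟩ }
  refine (iInf_le _ d).trans (tsub_le_iff_right.2 (iSup_le fun n => ?_))
  have hbag : (d.bag n).encard ≤ 1 := by
    rw [Set.encard_le_one_iff]
    intro x y hx hy
    have hx : SplitTree.afterTrue (pos x) = n.1 := hx
    have hy : SplitTree.afterTrue (pos y) = n.1 := hy
    obtain ⟨i, hi⟩ := (hpos x).eq_replicate_append
    obtain ⟨j, hj⟩ := (hpos y).eq_replicate_append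
    refine (hpos x).leaf_eq (hpos y) ?_
    rw [hx] at hi
    rw [hy] at hj
    rw [hi, hj]
    exact SplitTree.replicate_append_suffix_or i j _
  let A : Set (List Bool) := {a | a ∈ P ∧ a ≠ [] ∧ (a = n.1 ∨ a = true :: n.1 ∨ a = false :: n.1)}
  have hA : A.encard ≤ (3 : ℕ) := by
    have hsub : A ⊆ {n.1, true :: n.1, false :: n.1} := fun a ha => ha.2.2
    refine (Set.encard_le_encard hsub).trans ?_
    refine (Set.encard_insert_le _ _).trans ?_
    refine (add_le_add_left ((Set.encard_insert_le _ _).trans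
      (add_le_add_left (Set.encard_singleton _).le 1)) 1).trans ?_
    norm_num
  have hguard : (⋃ e ∈ d.tree.incidenceSet n, d.guard e) ⊆ ⋃ a ∈ A, outer a := by
    intro y hy
    obtain ⟨e, ⟨he, hne⟩, a, b, c, hab, rfl, hy⟩ := Set.mem_iUnion₂.1 hy
    have ha : a.1 ≠ [] := fun h => List.cons_ne_nil _ _ (hab.symm.trans h)
    refine Set.mem_biUnion (x := a.1) ⟨a.2, ha, ?_⟩ hy
    rcases Sym2.mem_iff.1 hne with rfl | rfl
    · exact Or.inl rfl
    · right
      cases c with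
      | true => exact Or.inl hab
      | false => exact Or.inr hab
  refine (Set.encard_union_le _ _).trans ((add_le_add hbag ((Set.encard_le_encard hguard).trans
    (Set.encard_biUnion_le_mul hA fun a ha => houter a ha.1 ha.2.1))).trans (le_of_eq ?_))
  push_cast
  ring

end MultiDigraph

/-! ### Separators of tree decompositions and arboreal decompositions -/

namespace MultiDigraph

variable {G : MultiDigraph.{u, v}} {Z : Set G.V} {x y z : G.V}

/-- The vertex set of the strong component of `x` in `G - Z`; it is empty if `x` lies in `Z`. -/
def strongComponent (G : MultiDigraph.{u, v}) (Z : Set G.V) (x : G.V) : Set G.V :=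
  {y | G.ReachableAvoiding Z x y ∧ G.ReachableAvoiding Z y x}

theorem ReachableAvoiding.trans (h : G.ReachableAvoiding Z x y) (h' : G.ReachableAvoiding Z y z) :
    G.ReachableAvoiding Z x z :=
  ⟨h.1, h.2.trans h'.2⟩

theorem ReachableAvoiding.mono {Z' : Set G.V} (hZ : Z' ⊆ Z) (h : G.ReachableAvoiding Z x y) :
    G.ReachableAvoiding Z' x y :=
  ⟨fun hx => h.1 (hZ hx),
    Relation.ReflTransGen.mono (fun _ _ hab => ⟨fun hb => hab.1 (hZ hb), hab.2⟩) _ _ h.2⟩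

/-- A finitely additive function on the sets of vertices. -/
def IsWeight (G : MultiDigraph.{u, v}) (w : Set G.V → ℕ) : Prop :=
  ∀ A B, Disjoint A B → w (A ∪ B) = w A + w B

theorem IsWeight.mono {w : Set G.V → ℕ} (hw : G.IsWeight w) {A B : Set G.V} (h : A ⊆ B) :
    w A ≤ w B := by
  have := hw A (B \ A) Set.disjoint_sdiff_right
  rw [Set.union_sdiff_cancel h] at this
  omega

theorem IsWeight.add_compl {w : Set G.V → ℕ} (hw : G.IsWeight w) (A : Set G.V) :
    w A + w Aᶜ = w Set.univ := by
  rw [← hw A Aᶜ disjoint_compl_right, Set.union_compl_self]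

/-- For every weight there is a set of at most `k` vertices such that no strong component of the
rest has more than half of the weight. -/
def HasBalancedSeparators (G : MultiDigraph.{u, v}) (k : ℕ) : Prop :=
  ∀ w, G.IsWeight w → ∃ Z : Set G.V, Z.encard ≤ k ∧
    ∀ x, 2 * w (G.strongComponent Z x) ≤ w Set.univ

/-- If a separator is attached to every node of a tree and every strong component of the rest is
confined to a branch at the node, then one of the separators is balanced. Otherwise every node
points to the branch with a heavy component, and two adjacent nodes would point to each other. -/
theorem exists_balanced_of_tree {N : Type} [Finite N] {T : SimpleGraph N} (hT : T.IsTree)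
    (S : N → Set G.V) (U : N → N → Set G.V) (hU : ∀ n a, T.Adj n a → Disjoint (U n a) (U a n))
    (hS : ∀ n x, x ∉ S n → ∃ a, T.Adj n a ∧ G.strongComponent (S n) x ⊆ U n a)
    {w : Set G.V → ℕ} (hw : G.IsWeight w) :
    ∃ n, ∀ x, 2 * w (G.strongComponent (S n) x) ≤ w Set.univ := by
  by_contra! hcon
  choose x hx using hcon
  have hxS : ∀ n, x n ∉ S n := by
    intro n h
    have h0 : G.strongComponent (S n) (x n) = ∅ :=
      Set.eq_empty_of_forall_notMem fun y hy => hy.1.1 h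
    have h1 := hw ∅ ∅ disjoint_bot_left
    have h2 := hx n
    rw [h0] at h2
    rw [Set.union_empty] at h1
    omega
  choose f hf hfU using fun n => hS n (x n) (hxS n)
  obtain ⟨n, hn⟩ := hT.exists_apply_apply_eq f hf
  have hdisj : Disjoint (G.strongComponent (S n) (x n))
      (G.strongComponent (S (f n)) (x (f n))) := by
    have h := hfU (f n)
    rw [hn] at h
    exact (hU n (f n) (hf n)).mono (hfU n) h
  have h1 := hw _ _ hdisj
  have h2 := hw.mono (Set.subset_univ
    (G.strongComponent (S n) (x n) ∪ G.strongComponent (S (f n)) (x (f n))))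
  have h3 := hx n
  have h4 := hx (f n)
  omega

/-- The nodes whose bags contain `x` lie in the same branch at `n` unless `x` belongs to the bag
of `n`. -/
theorem _root_.TreeDecomposition.mem_treeSide {V : Type u} {H : SimpleGraph V}
    (d : TreeDecomposition H) {x : V} {n a m m' : d.Node} (hn : x ∉ d.bag n) (hm : x ∈ d.bag m)
    (hm' : x ∈ d.bag m') (h : m ∈ treeSide d.tree a n) : m' ∈ treeSide d.tree a n := by
  refine (d.connected x).induction_on_adj (s := ⟨m, hm⟩)
    (P := fun m => m.1 ∈ treeSide d.tree a n) h ?_ ⟨m', hm'⟩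
  rintro ⟨b, hb⟩ ⟨c, hc⟩ hb' hbc
  refine mem_treeSide_of_adj' hb' hbc ?_
  rintro rfl
  exact hn hc

theorem hasBalancedSeparators_of_treewidth_le {k : ℕ} (h : G.treewidth ≤ k) :
    G.HasBalancedSeparators (k + 1) := by
  intro w hw
  obtain ⟨d, hd⟩ := ENat.exists_le_of_iInf_le h
  have := d.finite_node
  have hT := d.isTree
  let U : d.Node → d.Node → Set G.V := fun n a =>
    {x | x ∉ d.bag n ∧ ∃ m ∈ treeSide d.tree a n, x ∈ d.bag m}
  have hU : ∀ n a, d.tree.Adj n a → Disjoint (U n a) (U a n) := by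
    intro n a hna
    rw [Set.disjoint_left]
    rintro x ⟨hxn, m, hm, hxm⟩ ⟨-, m', hm', hxm'⟩
    exact Set.disjoint_left.1 (hT.disjoint_treeSide hna) hm' (d.mem_treeSide hxn hxm hxm' hm)
  have hS : ∀ n x, x ∉ d.bag n → ∃ a, d.tree.Adj n a ∧ G.strongComponent (d.bag n) x ⊆ U n a := by
    intro n x hx
    obtain ⟨m, hm⟩ := d.vertex_mem x
    obtain ⟨a, ha, hma⟩ := hT.exists_mem_treeSide (by rintro rfl; exact hx hm : m ≠ n)
    refine ⟨a, ha, fun y hy => ?_⟩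
    have hxy := hy.1.2
    clear hy
    induction hxy with
    | refl => exact ⟨hx, m, hma, hm⟩
    | tail _ hbc ih =>
      obtain ⟨hbn, m₁, hm₁, hbm₁⟩ := ih
      obtain ⟨hcn, e, rfl, rfl⟩ := hbc
      refine ⟨hcn, ?_⟩
      by_cases hloop : G.tail e = G.head e
      · exact ⟨m₁, hm₁, hloop ▸ hbm₁⟩
      · obtain ⟨m₂, h1, h2⟩ := d.edge_mem _ _ ⟨hloop, e, Or.inl ⟨rfl, rfl⟩⟩
        exact ⟨m₂, d.mem_treeSide hbn hbm₁ h1 hm₁, h2⟩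
  obtain ⟨n, hn⟩ := exists_balanced_of_tree hT d.bag U hU hS hw
  refine ⟨d.bag n, ?_, hn⟩
  push_cast
  exact (le_iSup (fun n => (d.bag n).encard) n).trans (tsub_le_iff_right.1 hd)

theorem hasBalancedSeparators_of_directedTreewidth_le {k : ℕ} (h : G.directedTreewidth ≤ k) :
    G.HasBalancedSeparators (k + 1) := by
  intro w hw
  obtain ⟨d, hd⟩ := ENat.exists_le_of_iInf_le h
  have := d.finite_node
  have hT := d.isTree
  let S : d.Node → Set G.V := fun n => d.bag n ∪ ⋃ e ∈ d.tree.incidenceSet n, d.guard e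
  let U : d.Node → d.Node → Set G.V := fun n a => ⋃ m ∈ treeSide d.tree a n, d.bag m
  have hU : ∀ n a, d.tree.Adj n a → Disjoint (U n a) (U a n) := by
    intro n a hna
    rw [Set.disjoint_left]
    rintro x hx hx'
    obtain ⟨m, hm, hxm⟩ := Set.mem_iUnion₂.1 hx
    obtain ⟨m', hm', hxm'⟩ := Set.mem_iUnion₂.1 hx'
    rw [(d.bag_partition x).unique hxm hxm'] at hm
    exact Set.disjoint_left.1 (hT.disjoint_treeSide hna) hm' hm
  have hS : ∀ n x, x ∉ S n → ∃ a, d.tree.Adj n a ∧ G.strongComponent (S n) x ⊆ U n a := by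
    intro n x hx
    obtain ⟨m, hm, -⟩ := d.bag_partition x
    obtain ⟨a, ha, hma⟩ :=
      hT.exists_mem_treeSide (by rintro rfl; exact hx (Or.inl hm) : m ≠ n)
    have hxU : x ∈ U n a := Set.mem_biUnion hma hm
    have hguard : d.guard s(n, a) ⊆ S n := fun y hy =>
      Or.inr (Set.mem_biUnion (x := s(n, a)) ⟨ha, Sym2.mem_mk_left n a⟩ hy)
    refine ⟨a, ha, fun y hy => ?_⟩
    have h1 := hy.1.mono hguard
    have h2 := hy.2.mono hguard
    by_cases hr : d.root ∈ treeSide d.tree a n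
    · have hr' : d.root ∉ treeSide d.tree n a :=
        Set.disjoint_right.1 (hT.disjoint_treeSide ha) hr
      have hnormal := (d.normal a n ha.symm hr').2
      rw [Sym2.eq_swap] at hnormal
      obtain ⟨m', hm', -⟩ := d.bag_partition y
      have hside : m' ∈ treeSide d.tree n a ∪ treeSide d.tree a n := by
        rw [hT.treeSide_union]
        trivial
      rcases hside with hside | hside
      · have hyU : y ∈ U a n := Set.mem_biUnion hside hm'
        exact absurd (hnormal y hyU y hyU x h2 h1) (Set.disjoint_left.1 (hU n a ha) hxU)
      · exact Set.mem_biUnion hside hm'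
    · exact (d.normal n a ha hr).2 x hxU x hxU y h1 h2
  obtain ⟨n, hn⟩ := exists_balanced_of_tree hT S U hU hS hw
  refine ⟨S n, ?_, hn⟩
  push_cast
  exact (le_iSup (fun n => (S n).encard) n).trans (tsub_le_iff_right.1 hd)

/-! ### From separators to split trees -/

/-- Among the sets that are closed under reachability in `G - Z` and have at least a quarter of the
weight, a minimal one has at most three quarters, since it can be diminished by a strong component.
The edges that leave it end in `Z`. -/
theorem exists_balanced_cut (hG : G.IsEulerian) {k : ℕ} (hk : ∀ x, G.outSize {x} ≤ k)
    {w : Set G.V → ℕ} (hw : G.IsWeight w) {Z : Set G.V} {m : ℕ} (hZ : Z.encard ≤ m)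
    (hcomp : ∀ x, 2 * w (G.strongComponent Z x) ≤ w Set.univ)
    (hZw : 4 * w Z < 3 * w Set.univ) :
    ∃ P : Set G.V, G.outSize P ≤ m * k ∧ 4 * w P ≤ 3 * w Set.univ ∧
      4 * w Pᶜ ≤ 3 * w Set.univ := by
  let Closed : Set G.V → Prop := fun P => Disjoint P Z ∧
    ∀ e, G.tail e ∈ P → G.head e ∉ Z → G.head e ∈ P
  have hexists : ∃ n, ∃ P, Closed P ∧ w Set.univ < 4 * w P ∧ P.ncard = n := by
    refine ⟨_, Zᶜ, ⟨disjoint_compl_left, fun e _ h => h⟩, ?_, rfl⟩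
    have := hw.add_compl Z
    omega
  classical
  obtain ⟨P, hP, hPw, hPn⟩ := Nat.find_spec hexists
  have hmin : ∀ Q, Closed Q → Q ⊂ P → 4 * w Q ≤ w Set.univ := by
    intro Q hQ hQP
    by_contra! h
    exact Nat.find_min hexists (hPn ▸ Set.ncard_lt_ncard hQP (Set.toFinite _)) ⟨Q, hQ, h, rfl⟩
  have hne : P.Nonempty := by
    rw [Set.nonempty_iff_ne_empty]
    rintro rfl
    have h1 := hw ∅ ∅ disjoint_bot_left
    rw [Set.union_empty] at h1
    omega
  -- A vertex of `P` that is reached by as few vertices as possible lies in a source component.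
  let pred : G.V → Set G.V := fun x => {y ∈ P | G.ReachableAvoiding Z y x}
  have hself : ∀ x ∈ P, x ∈ pred x := fun x hx =>
    ⟨hx, Set.disjoint_left.1 hP.1 hx, Relation.ReflTransGen.refl⟩
  obtain ⟨x, hx, hxmin⟩ := Set.exists_min_image P (fun x => (pred x).ncard) (Set.toFinite _) hne
  have hpred : pred x ⊆ G.strongComponent Z x := by
    intro y hy
    refine ⟨?_, hy.2⟩
    have hsub : pred y ⊆ pred x := fun z hz => ⟨hz.1, hz.2.trans hy.2⟩
    have heq := Set.eq_of_subset_of_ncard_le hsub (hxmin y hy.1) (Set.toFinite _)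
    have hxy := hself x hx
    rw [← heq] at hxy
    exact hxy.2
  have hclosed : Closed (P \ pred x) := by
    refine ⟨hP.1.mono_left Set.sdiff_subset, fun e he hhead => ?_⟩
    refine ⟨hP.2 e he.1 hhead, fun hh => he.2 ⟨he.1, ?_⟩⟩
    exact ReachableAvoiding.trans ⟨Set.disjoint_left.1 hP.1 he.1,
      Relation.ReflTransGen.single ⟨hhead, e, rfl, rfl⟩⟩ hh.2
  have hrest := hmin _ hclosed ⟨Set.sdiff_subset, fun h => (h hx).2 (hself x hx)⟩
  refine ⟨P, ?_, ?_, ?_⟩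
  · have hsub : G.outCut P ⊆ ⋃ z ∈ Z, G.outCut {z}ᶜ := by
      rintro e ⟨h1, h2⟩
      have hz : G.head e ∈ Z := by
        by_contra h
        exact h2 (hP.2 e h1 h)
      refine Set.mem_biUnion hz ⟨fun h => ?_, fun h => h rfl⟩
      have h : G.tail e = G.head e := h
      exact h2 (h ▸ h1)
    have hle := Set.encard_biUnion_le_mul hZ (w := k) (f := fun z => G.outCut {z}ᶜ) fun z _ => by
      rw [← (Set.toFinite _).cast_ncard_eq, Nat.cast_le]
      exact (hG.outSize_compl {z}).trans_le (hk z)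
    have := (Set.encard_le_encard hsub).trans hle
    rw [← (Set.toFinite _).cast_ncard_eq] at this
    exact_mod_cast this
  · have h1 := hw (P \ pred x) (pred x) Set.disjoint_sdiff_left
    rw [Set.sdiff_union_of_subset (fun y hy => hy.1)] at h1
    have h2 := hw.mono hpred
    have h3 := hcomp x
    omega
  · have := hw.add_compl P
    omega

theorem outSize_inter_le (G : MultiDigraph.{u, v}) (X P : Set G.V) :
    G.outSize (X ∩ P) ≤ G.outSize P + {e ∈ G.outCut X | G.tail e ∈ P}.ncard := by
  refine (Set.ncard_le_ncard ?_ (Set.toFinite _)).trans (Set.ncard_union_le _ _)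
  rintro e ⟨⟨h1, h2⟩, h3⟩
  by_cases h : G.head e ∈ P
  · exact Or.inr ⟨⟨h1, fun h' => h3 ⟨h', h⟩⟩, h2⟩
  · exact Or.inl ⟨h2, h⟩

/-- A set that is left by at most `4 * (m * k)` edges may be split at an arbitrary vertex. Otherwise
it is split along a cut of size `m * k` that is balanced with respect to the edges that leave the
set, and each part is left by at most three quarters of these edges and `m * k` further ones. -/
theorem splitWidthLE_of_hasBalancedSeparators (hG : G.IsEulerian) {k m : ℕ}
    (hk : ∀ x, G.outSize {x} ≤ k) (hsep : G.HasBalancedSeparators m) :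
    G.SplitWidthLE (4 * (m * k) + k) := by
  suffices h : ∀ n (X : Set G.V), X.ncard = n → G.outSize X ≤ 4 * (m * k) + k →
      ∃ t : SplitTree G.V, t.supp = X ∧ t.Proper ∧ t.WidthLE G.outSize (4 * (m * k) + k) from
    h _ Set.univ rfl (by rw [outSize_univ]; exact Nat.zero_le _)
  intro n
  induction n using Nat.strong_induction_on with
  | _ n ih =>
  rintro X rfl hX
  have glue : ∀ A, A ⊂ X → X \ A ⊂ X → G.outSize A ≤ 4 * (m * k) + k →
      G.outSize (X \ A) ≤ 4 * (m * k) + k → ∃ t : SplitTree G.V, t.supp = X ∧ t.Proper ∧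
        t.WidthLE G.outSize (4 * (m * k) + k) := by
    intro A hA hA' h1 h2
    obtain ⟨l, hl, pl, wl⟩ := ih _ (Set.ncard_lt_ncard hA (Set.toFinite _)) A rfl h1
    obtain ⟨r, hr, pr, wr⟩ := ih _ (Set.ncard_lt_ncard hA' (Set.toFinite _)) _ rfl h2
    have hsupp : l.supp ∪ r.supp = X := by rw [hl, hr, Set.union_sdiff_cancel hA.subset]
    refine ⟨.node l r, hsupp, ⟨by rw [hl, hr]; exact Set.disjoint_sdiff_right, pl, pr⟩, ?_⟩
    rintro E (rfl | hE | hE)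
    exacts [hsupp ▸ hX, wl E hE, wr E hE]
  rcases X.eq_empty_or_nonempty with rfl | ⟨x, hx⟩
  · exact ⟨.empty, rfl, trivial, by rintro E rfl; exact hX⟩
  by_cases hxX : X = {x}
  · subst hxX
    exact ⟨.leaf x, rfl, trivial, by rintro E rfl; exact hX⟩
  by_cases hsmall : G.outSize X ≤ 4 * (m * k)
  · have hsub : {x} ⊂ X := Set.ssubset_iff_subset_ne.2 ⟨Set.singleton_subset_iff.2 hx, Ne.symm hxX⟩
    refine glue {x} hsub ⟨Set.sdiff_subset, fun h => (h hx).2 rfl⟩ ((hk x).trans (by omega)) ?_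
    have h := (hG.isCutFunction).pos X {x}
    have := hk x
    omega
  · let w : Set G.V → ℕ := fun A => {e ∈ G.outCut X | G.tail e ∈ A}.ncard
    have hw : G.IsWeight w := by
      intro A B hAB
      change Set.ncard _ = Set.ncard _ + Set.ncard _
      rw [← Set.ncard_union_eq ?_ (Set.toFinite _) (Set.toFinite _)]
      · congr 1
        ext e
        simp only [Set.mem_union, Set.mem_ofPred_eq]
        tauto
      · exact Set.disjoint_left.2 fun e h1 h2 => Set.disjoint_left.1 hAB h1.2 h2.2
    have huniv : w Set.univ = G.outSize X := by
      change Set.ncard _ = Set.ncard _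
      congr 1
      ext e
      simp
    obtain ⟨Z, hZ, hcomp⟩ := hsep w hw
    have hZw : w Z ≤ m * k := by
      have hsub : {e ∈ G.outCut X | G.tail e ∈ Z} ⊆ ⋃ z ∈ Z, {e ∈ G.outCut X | G.tail e = z} :=
        fun e he => Set.mem_biUnion he.2 ⟨he.1, rfl⟩
      have hle := Set.encard_biUnion_le_mul hZ (w := k)
        (f := fun z => {e ∈ G.outCut X | G.tail e = z}) fun z _ => by
          rw [← (Set.toFinite _).cast_ncard_eq, Nat.cast_le]
          refine (Set.ncard_le_ncard ?_ (Set.toFinite _)).trans (hk z)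
          rintro e ⟨⟨h1, h2⟩, rfl⟩
          refine ⟨rfl, fun h => ?_⟩
          have h : G.head e = G.tail e := h
          exact h2 (h ▸ h1)
      have := (Set.encard_le_encard hsub).trans hle
      rw [← (Set.toFinite _).cast_ncard_eq] at this
      exact_mod_cast this
    obtain ⟨P, hP, hP1, hP2⟩ := exists_balanced_cut hG hk hw hZ hcomp (by omega)
    have h1 : G.outSize (X ∩ P) ≤ G.outSize P + w P := G.outSize_inter_le X P
    have h2 : G.outSize (X ∩ Pᶜ) ≤ G.outSize Pᶜ + w Pᶜ := G.outSize_inter_le X Pᶜ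
    rw [hG.outSize_compl] at h2
    -- The parts are proper, as neither has the whole weight.
    have hproper : ∀ A, 4 * w A ≤ 3 * w Set.univ → ¬ X ⊆ A := by
      intro A hA hXA
      have : G.outSize X ≤ w A :=
        Set.ncard_le_ncard (fun e he => ⟨he, hXA he.1⟩) (Set.toFinite _)
      omega
    have hdiff : X \ (X ∩ P) = X ∩ Pᶜ := by rw [Set.sdiff_self_inter, Set.sdiff_eq]
    refine glue (X ∩ P) ⟨Set.inter_subset_left, fun h => hproper P hP1 fun y hy => (h hy).2⟩ ?_
      (by omega) (by rw [hdiff]; omega)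
    rw [hdiff]
    exact ⟨Set.inter_subset_left, fun h => hproper _ hP2 fun y hy => (h hy).2⟩

end MultiDigraph

/-! ### Well-quasi-ordering under bounded width -/

namespace MultiDigraph

theorem outSize_singleton_le_of_maxDegree_le {G : MultiDigraph.{u, v}} {k : ℕ}
    (h : G.maxDegree ≤ k) (x : G.V) : G.outSize {x} ≤ k := by
  have := (le_iSup (fun x => (G.cut {x}).encard) x).trans h
  rw [← (Set.toFinite _).cast_ncard_eq, Nat.cast_le] at this
  exact (G.outSize_le_ncard_cut _).trans this

theorem isWellQuasiOrderedBy_of_splitWidthLE {C : Set MultiDigraph.{u, v}} {w : ℕ}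
    (h : ∀ G ∈ C, G.IsEulerian ∧ G.SplitWidthLE w) : IsWellQuasiOrderedBy C StronglyImmersed where
  refl G _ := StronglyImmersed.refl G
  trans _ _ _ _ _ _ h1 h2 := h1.trans h2
  wqo := (partiallyWellOrderedOn_of_splitTree w).mono h

end MultiDigraph

/-- For every `k`, the class of Eulerian digraphs of carving width at most `k`, the class of those of
maximum degree and treewidth at most `k`, and the class of those of maximum degree and directed
treewidth at most `k` are well-quasi-ordered by strong immersion. Moreover, bounding the carving width,
bounding the maximum degree and the treewidth, and bounding the maximum degree and the
directed treewidth are equivalent for Eulerian digraphs. -/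
theorem theorem1p3 (k : ℕ) :
    IsWellQuasiOrderedBy
      {G : MultiDigraph.{u, v} | G.IsEulerian ∧ G.carvingWidth ≤ k}
      MultiDigraph.StronglyImmersed ∧
    IsWellQuasiOrderedBy
      {G : MultiDigraph.{u, v} | G.IsEulerian ∧ G.maxDegree ≤ k ∧ G.treewidth ≤ k}
      MultiDigraph.StronglyImmersed ∧
    IsWellQuasiOrderedBy
      {G : MultiDigraph.{u, v} | G.IsEulerian ∧ G.maxDegree ≤ k ∧ G.directedTreewidth ≤ k}
      MultiDigraph.StronglyImmersed ∧
    (∃ m : ℕ, ∀ G : MultiDigraph.{u, v}, G.IsEulerian →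
      (G.carvingWidth ≤ k →
        G.maxDegree ≤ m ∧ G.treewidth ≤ m ∧ G.directedTreewidth ≤ m) ∧
      (G.maxDegree ≤ k ∧ G.treewidth ≤ k → G.carvingWidth ≤ m) ∧
      (G.maxDegree ≤ k ∧ G.directedTreewidth ≤ k → G.carvingWidth ≤ m)) := by
  have htw : ∀ G : MultiDigraph.{u, v}, G.IsEulerian → G.maxDegree ≤ k ∧ G.treewidth ≤ k →
      G.SplitWidthLE (4 * ((k + 1) * k) + k) := fun G hG h =>
    G.splitWidthLE_of_hasBalancedSeparators hG
      (MultiDigraph.outSize_singleton_le_of_maxDegree_le h.1)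
      (MultiDigraph.hasBalancedSeparators_of_treewidth_le h.2)
  have hdtw : ∀ G : MultiDigraph.{u, v}, G.IsEulerian →
      G.maxDegree ≤ k ∧ G.directedTreewidth ≤ k → G.SplitWidthLE (4 * ((k + 1) * k) + k) :=
    fun G hG h => G.splitWidthLE_of_hasBalancedSeparators hG
      (MultiDigraph.outSize_singleton_le_of_maxDegree_le h.1)
      (MultiDigraph.hasBalancedSeparators_of_directedTreewidth_le h.2)
  refine ⟨MultiDigraph.isWellQuasiOrderedBy_of_splitWidthLE fun G hG =>
      ⟨hG.1, MultiDigraph.splitWidthLE_of_carvingWidth_le hG.2⟩,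
    MultiDigraph.isWellQuasiOrderedBy_of_splitWidthLE fun G hG => ⟨hG.1, htw G hG.1 hG.2⟩,
    MultiDigraph.isWellQuasiOrderedBy_of_splitWidthLE fun G hG => ⟨hG.1, hdtw G hG.1 hG.2⟩,
    12 * k + 3 + 2 * (4 * ((k + 1) * k) + k), fun G hG => ⟨fun h => ?_, fun h => ?_, fun h => ?_⟩⟩
  · have hs := MultiDigraph.splitWidthLE_of_carvingWidth_le h
    refine ⟨(MultiDigraph.maxDegree_le_of_splitWidthLE hG hs).trans ?_,
      (MultiDigraph.treewidth_le_of_carvingWidth_le h).trans ?_,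
      (MultiDigraph.directedTreewidth_le_of_splitWidthLE hG hs).trans ?_⟩
    all_goals
      rw [Nat.cast_le]
      omega
  · refine (MultiDigraph.carvingWidth_le_of_splitWidthLE hG (htw G hG h)).trans ?_
    rw [Nat.cast_le]
    omega
  · refine (MultiDigraph.carvingWidth_le_of_splitWidthLE hG (hdtw G hG h)).trans ?_
    rw [Nat.cast_le]
    omega
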